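/- **Conventions.** Fix an integer $N\ge 1$. Let $\deg a=(2,0)$, and let every marking variable have bidegree $(0,2)$; the two components are the $a$- and $x$-degree. For a bigraded module $M$, let $M\{q,r\}$ be $M$ with all bidegrees increased by $(q,r)$, and for a matrix factorization let $\langle 1\rangle$ exchange its even and odd parts. For homogeneous $a_0,a_1\in R$ with $\deg a_0+\deg a_1=(2,2N+2)$, let $(a_0,a_1)_R$ be the $\mathbb Z_2\oplus\mathbb Z^2$-graded matrix factorization $$R\xrightarrow{\,a_0\,}R\{1-\deg_a a_0,\;N+1-\deg_x a_0\}\xrightarrow{\,a_1\,}R,$$ and let a matrix with several such rows denote the tensor product of its rows (signed Leibniz rule). **The homology $\mathcal H_N$.** Mark every arc of a closed braid diagram by variables and cut at the markings. * An arc from $y$ to $x$ gets $\bigl(a\tfrac{x^{N+1}-y^{N+1}}{x-y},\;x-y\bigr)$, in homological degree $0$. * For a crossing with top end points $x_1$ (left), $y_1$ (right) and bottom end points $y_2$ (left), $x_2$ (right), put $R_\partial=\mathbb Q[a,x_1,y_1,x_2,y_2]$. Let $\Gamma_0$ be the oriented resolution (arcs $y_2\to x_1$ and $x_2\to y_1$),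 so that $\mathcal C_N(\Gamma_0)$ is the tensor product of the two arc factorizations. Let $\Gamma_1$ be the resolution with a wide edge of color $2$, marked by a two-letter alphabet with elementary symmetric polynomials $W_1,W_2$ (of bidegrees $(0,2)$ and $(0,4)$). Then $\mathcal C_N(\Gamma_1)$ is the tensor product over $R_\partial[W_1,W_2]$, viewed over $R_\partial$ and shifted by $\{0,-1\}$, of the factorizations of the splitting and the merging vertex. Here a vertex of total color $2$ has rows $(aU_1,X_1-Y_1),(aU_2,X_2-Y_2)$, where $X_1,X_2$ (resp. $Y_1,Y_2$) are the elementary symmetric polynomials of its exits (resp. entrances), $$U_1=\tfrac{p(X_1,X_2)-p(Y_1,X_2)}{X_1-Y_1},\qquad U_2=\tfrac{p(Y_1,X_2)-p(Y_1,Y_2)}{X_2-Y_2},$$ and $p(s+t,st)=s^{N+1}+t^{N+1}$. * Let $\chi^0:\mathcal C_N(\Gamma_0)\to\mathcal C_N(\Gamma_1)$ and $\chi^1:\mathcal C_N(\Gamma_1)\to\mathcal C_N(\Gamma_0)$ be homotopically non-trivial homogeneous morphisms of matrix factorizations over $R_\partial$ of $\mathbb Z_2\oplus\mathbb Z^2$-degree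 $(0,0,1)$ whose two compositions are homotopic to multiplication by $x_2-x_1$. (Such a pair is unique up to homotopy and scaling.) * The positive crossing gets $\mathcal C_N(\Gamma_1)\langle1\rangle\{1,N\}\xrightarrow{\chi^1}\mathcal C_N(\Gamma_0)\langle1\rangle\{1,N-1\}$ in homological degrees $-1,0$. The negative crossing gets $\mathcal C_N(\Gamma_0)\langle1\rangle\{-1,-N+1\}\xrightarrow{\chi^0}\mathcal C_N(\Gamma_1)\langle1\rangle\{-1,-N\}$ in homological degrees $0,1$. For a closed braid $B$, $\mathcal C_N(B)$ is the tensor product of the complexes of its pieces over their common markings, with differentials $d_{mf}$ (of the matrix factorizations) and $d_\chi$ (of the complexes). Put $\mathcal H_N(B)=H(H(\mathcal C_N(B),d_{mf}),d_\chi)$, and let $\mathcal H_N^{\varepsilon,i,\star,\star}(B)$ be its part of $\mathbb Z_2$-degree $\varepsilon$ and homological degree $i$, a $\mathbb Z^{\oplus 2}$-graded $\mathbb Q[a]$-module. **Corollary.** Let $U$ be the transverse unknot represented by the $1$-strand braid and $U_-$ the closure of the $2$-strand braid $\sigma_1^{-1}$, which is obtained from $U$ by a single negative stabilization. Then, for every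 $N\ge 1$, a pair $(\chi^0,\chi^1)$ as above exists, and for every choice of it, as $\mathbb Z^{\oplus 2}$-graded $\mathbb Q[a]$-modules, $$\mathcal H_N^{\varepsilon,i,\star,\star}(U)\cong\begin{cases}\Bigl(\bigoplus_{l=0}^{N-1}\mathbb Q[a]\{-1,-N+1+2l\}\Bigr)\oplus\Bigl(\bigoplus_{m=0}^{\infty}\mathbb Q[a]/(a)\{-1,N+1+2m\}\Bigr)&\text{if }\varepsilon=1,\ i=0,\\ 0&\text{otherwise,}\end{cases}$$ $$\mathcal H_N^{\varepsilon,i,\star,\star}(U_-)\cong\begin{cases}\bigoplus_{l=0}^{N-1}\mathbb Q[a]\{-1,-N+1+2l\}&\text{if }\varepsilon=1,\ i=0,\\ \bigoplus_{m=0}^{\infty}\mathbb Q[a]/(a)\{-2,2m\}&\text{if }\varepsilon=0,\ i=1,\\ 0&\text{otherwise.}\end{cases}$$ In particular, for some $(\varepsilon,i)$ the modules $\mathcal H_N^{\varepsilon,i,\star,\star}(U_-)$ and $\mathcal H_N^{\varepsilon,i,\star,\star}(U)$ are not isomorphic, so $\mathcal H_N$ is not invariant under negative stabilization. -/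

import Mathlib

open scoped TensorProduct DirectSum Polynomial

noncomputable section

namespace TransverseHomology

/-! Throughout, `ℚ[a]` is `Polynomial ℚ` with `a = Polynomial.X`, and a bidegree `(j, k) : ℤ × ℤ`
consists of an `a`-degree `j` and an `x`-degree `k`. -/

/-! ### Bigradings of the polynomial rings -/

/-- The homogeneous components of `ℚ[a]`, where `deg a = (2, 0)`: the polynomials all of whose
nonzero coefficients sit at an `n` with `d = (2n, 0)`. -/
def baseGr (d : ℤ × ℤ) : AddSubgroup ℚ[X] :=
  ⨅ n : ℕ, (if d = (2 * (n : ℤ), 0) then (⊤ : AddSubgroup ℚ) else ⊥).comap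
    (Polynomial.lcoeff ℚ n).toAddMonoidHom

/-- The homogeneous components of a polynomial ring over a bigraded ring `A`, where the
indeterminate `i` has bidegree `w i`: the coefficient of each monomial `m` is homogeneous of
bidegree `d - deg m`. -/
def polyGr {A : Type} [CommRing A] {σ : Type} (gr : ℤ × ℤ → AddSubgroup A) (w : σ → ℤ × ℤ)
    (d : ℤ × ℤ) : AddSubgroup (MvPolynomial σ A) :=
  ⨅ m : σ →₀ ℕ, (gr (d - m.sum fun i n => n • w i)).comap
    (MvPolynomial.lcoeff A m).toAddMonoidHom

/-- The polynomial ring `ℚ[a][V]` on a set `V` of markings. -/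
abbrev MarkRing (V : Type) : Type := MvPolynomial V ℚ[X]

/-- The bigrading of `ℚ[a][V]`, every marking having bidegree `(0, 2)`. -/
def markGr (V : Type) : ℤ × ℤ → AddSubgroup (MarkRing V) := polyGr baseGr fun _ => (0, 2)

/-- The element `a` of `ℚ[a][V]`. -/
def aElt (V : Type) : MarkRing V := MvPolynomial.C Polynomial.X

/-! ### Graded `ℚ[a]`-modules -/

/-- A `ℚ[a]`-module with a family of homogeneous components indexed by bidegrees. -/
structure GrMod where
  carrier : Type
  [addCommGroup : AddCommGroup carrier]
  [module : Module ℚ[X] carrier]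
  homog : ℤ × ℤ → AddSubgroup carrier

attribute [instance] GrMod.addCommGroup GrMod.module

namespace GrMod

/-- Isomorphism of bigraded `ℚ[a]`-modules: a `ℚ[a]`-linear isomorphism matching the homogeneous
components. -/
def Iso (M M' : GrMod) : Prop :=
  ∃ e : M.carrier ≃ₗ[ℚ[X]] M'.carrier, ∀ d x, x ∈ M.homog d ↔ e x ∈ M'.homog d

/-- The zero module. -/
def zero : GrMod where
  carrier := PUnit
  homog _ := ⊤

/-- `ℚ[a]` itself. -/
def free : GrMod where
  carrier := ℚ[X]
  homog := baseGr

/-- `ℚ[a]/(a)`, with the quotient grading. -/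
def torsion : GrMod where
  carrier := ℚ[X] ⧸ Ideal.span {(Polynomial.X : ℚ[X])}
  homog d := (baseGr d).map
    (Ideal.Quotient.mk (Ideal.span {(Polynomial.X : ℚ[X])})).toAddMonoidHom

/-- `M{q, r}`: a homogeneous element of bidegree `d` in `M` has bidegree `d + (q, r)` in
`M{q, r}`. -/
def shift (M : GrMod) (q r : ℤ) : GrMod where
  carrier := M.carrier
  homog d := M.homog (d - (q, r))

/-- Direct sum of two bigraded modules. -/
def prod (M M' : GrMod) : GrMod where
  carrier := M.carrier × M'.carrier
  homog d := (M.homog d).prod (M'.homog d)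

/-- Direct sum of a family of bigraded modules. -/
def dsum {ι : Type} (M : ι → GrMod) : GrMod where
  carrier := ⨁ i, (M i).carrier
  homog d := ⨅ i, ((M i).homog d).comap
    (DirectSum.component ℚ[X] ι (fun i => (M i).carrier) i).toAddMonoidHom

end GrMod

/-! ### Matrix factorizations -/

/-- The data of a `ℤ₂ ⊕ ℤ²`-graded matrix factorization over `S`: the underlying module
`M = M₀ ⊕ M₁`, its homogeneous components (by `ℤ₂`-degree and bidegree), the operator `sgn` acting
by `(-1)^ε` on `M_ε`, and the differential. -/
structure GradedMF (S : Type) [CommRing S] where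
  carrier : Type
  [addCommGroup : AddCommGroup carrier]
  [module : Module S carrier]
  homog : ZMod 2 → ℤ × ℤ → AddSubgroup carrier
  sgn : carrier →ₗ[S] carrier
  d : carrier →ₗ[S] carrier

attribute [instance] GradedMF.addCommGroup GradedMF.module

/-- A row `(a₀, a₁)` of a Koszul matrix factorization, with the bidegree `deg0` of `a₀`. -/
structure KRow (R : Type) where
  a0 : R
  a1 : R
  deg0 : ℤ × ℤ

/-- The Koszul matrix factorization
`(a_{1,0}, a_{1,1})_R ⊗ ⋯ ⊗ (a_{n,0}, a_{n,1})_R`, where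
`(a₀, a₁)_R = (R --a₀--> R{1 - deg_a a₀, N + 1 - deg_x a₀} --a₁--> R)`,
viewed over a subring `R₀` of `R`. The basis element `e_s` attached to a set `s` of rows is the
tensor product of the generators of the odd parts for the rows in `s` and of the even parts for the
other rows; the signs are those of the Leibniz rule. -/
def koszul (R₀ : Type) {R : Type} [CommRing R₀] [CommRing R] [Algebra R₀ R] (N : ℕ)
    (gr : ℤ × ℤ → AddSubgroup R) {n : ℕ} (row : Fin n → KRow R) : GradedMF R₀ where
  carrier := Finset (Fin n) → R
  homog ε d := ⨅ s : Finset (Fin n),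
    (if ((s.card : ℕ) : ZMod 2) = ε then
        gr (d - ∑ i ∈ s, ((1, (N : ℤ) + 1) - (row i).deg0)) else ⊥).comap
      (Pi.evalAddMonoidHom (fun _ : Finset (Fin n) => R) s)
  sgn := (LinearMap.pi fun s : Finset (Fin n) =>
    ((-1 : R) ^ s.card) •
      (LinearMap.proj s : (Finset (Fin n) → R) →ₗ[R] R)).restrictScalars R₀
  d := (LinearMap.pi fun s : Finset (Fin n) => ∑ i : Fin n,
    ((-1 : R) ^ (s.filter fun j => j < i).card) •
      (if i ∈ s then (row i).a0 • (LinearMap.proj (s.erase i) : (Finset (Fin n) → R) →ₗ[R] R)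
        else (row i).a1 •
          (LinearMap.proj (insert i s) : (Finset (Fin n) → R) →ₗ[R] R))).restrictScalars R₀

namespace GradedMF

variable {S : Type} [CommRing S]

/-- `M{q, r}`. -/
def shift (M : GradedMF S) (q r : ℤ) : GradedMF S where
  carrier := M.carrier
  homog ε d := M.homog ε (d - (q, r))
  sgn := M.sgn
  d := M.d

/-- `M⟨1⟩`: the two parts `M₀` and `M₁` are exchanged. -/
def flip (M : GradedMF S) : GradedMF S where
  carrier := M.carrier
  homog ε d := M.homog (ε + 1) d
  sgn := -M.sgn
  d := M.d

/-- Two linear maps `f, g : M → M'` are homotopic if `f - g = d h + h d` for a linear map `h`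
shifting the `ℤ₂`-grading by `1`. -/
def Homotopic (M M' : GradedMF S) (f g : M.carrier →ₗ[S] M'.carrier) : Prop :=
  ∃ h : M.carrier →ₗ[S] M'.carrier,
    h ∘ₗ M.sgn = -(M'.sgn ∘ₗ h) ∧ f - g = M'.d ∘ₗ h + h ∘ₗ M.d

/-- `f : M → M'` is a homogeneous morphism of matrix factorizations of
`ℤ₂ ⊕ ℤ²`-degree `(0, δ)`. -/
structure IsHomogMorphism (M M' : GradedMF S) (δ : ℤ × ℤ)
    (f : M.carrier →ₗ[S] M'.carrier) : Prop where
  comm : f ∘ₗ M.d = M'.d ∘ₗ f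
  sgn : f ∘ₗ M.sgn = M'.sgn ∘ₗ f
  degree : ∀ ε d x, x ∈ M.homog ε d → f x ∈ M'.homog ε (d + δ)

end GradedMF

/-! ### Symmetric polynomials in at most two indeterminates -/

/-- `p_{1,N+1}(x) - p_{1,N+1}(y)` divided by `x - y`, that is, `∑ xⁱ y^{N-i}`. -/
def hSum {R : Type} [CommRing R] (N : ℕ) (x y : R) : R :=
  ∑ i ∈ Finset.range (N + 1), x ^ i * y ^ (N - i)

theorem hSum_spec {R : Type} [CommRing R] (N : ℕ) (x y : R) :
    (x - y) * hSum N x y = x ^ (N + 1) - y ^ (N + 1) := by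
  have h := (Commute.all x y).geom_sum₂_mul (N + 1)
  simpa [hSum, mul_comm] using h

/-- `p_{2,n}(X₁, X₂)`, the `n`-th power sum of two indeterminates as a polynomial in their
elementary symmetric polynomials. -/
def pow2 {R : Type} [CommRing R] (X₁ X₂ : R) : ℕ → R
  | 0 => 2
  | 1 => X₁
  | n + 2 => X₁ * pow2 X₁ X₂ (n + 1) - X₂ * pow2 X₁ X₂ n

theorem pow2_spec {R : Type} [CommRing R] (x y : R) :
    ∀ n, pow2 (x + y) (x * y) n = x ^ n + y ^ n
  | 0 => by simp only [pow2, pow_zero]; norm_num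
  | 1 => by simp [pow2]
  | n + 2 => by rw [pow2, pow2_spec x y (n + 1), pow2_spec x y n]; ring

/-- `(p_{2,n}(X₁, X₂) - p_{2,n}(Y₁, X₂)) / (X₁ - Y₁)`. -/
def quot1 {R : Type} [CommRing R] (X₁ X₂ Y₁ : R) : ℕ → R
  | 0 => 0
  | 1 => 1
  | n + 2 => pow2 X₁ X₂ (n + 1) + Y₁ * quot1 X₁ X₂ Y₁ (n + 1) - X₂ * quot1 X₁ X₂ Y₁ n

theorem quot1_spec {R : Type} [CommRing R] (X₁ X₂ Y₁ : R) :
    ∀ n, (X₁ - Y₁) * quot1 X₁ X₂ Y₁ n = pow2 X₁ X₂ n - pow2 Y₁ X₂ n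
  | 0 => by simp [pow2, quot1]
  | 1 => by simp [pow2, quot1]
  | n + 2 => by
      rw [pow2, pow2, quot1]
      linear_combination Y₁ * quot1_spec X₁ X₂ Y₁ (n + 1) - X₂ * quot1_spec X₁ X₂ Y₁ n

/-- `(p_{2,n}(Y₁, X₂) - p_{2,n}(Y₁, Y₂)) / (X₂ - Y₂)`. -/
def quot2 {R : Type} [CommRing R] (X₂ Y₁ Y₂ : R) : ℕ → R
  | 0 => 0
  | 1 => 0
  | n + 2 => Y₁ * quot2 X₂ Y₁ Y₂ (n + 1) - pow2 Y₁ X₂ n - Y₂ * quot2 X₂ Y₁ Y₂ n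

theorem quot2_spec {R : Type} [CommRing R] (X₂ Y₁ Y₂ : R) :
    ∀ n, (X₂ - Y₂) * quot2 X₂ Y₁ Y₂ n = pow2 Y₁ X₂ n - pow2 Y₁ Y₂ n
  | 0 => by simp [pow2, quot2]
  | 1 => by simp [pow2, quot2]
  | n + 2 => by
      rw [pow2, pow2, quot2]
      linear_combination Y₁ * quot2_spec X₂ Y₁ Y₂ (n + 1) - Y₂ * quot2_spec X₂ Y₁ Y₂ n

/-! ### Matrix factorizations of vertices with potential `a x^{N+1}` -/

/-- The row `(a U₁, x - y)` of a `2`-valent vertex of color `1` with exit `x` and entrance `y`. -/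
def arcRow {R : Type} [CommRing R] (N : ℕ) (a x y : R) : KRow R where
  a0 := a * hSum N x y
  a1 := x - y
  deg0 := (2, 2 * N)

/-- The two rows `(a U₁, X₁ - Y₁)`, `(a U₂, X₂ - Y₂)` of a vertex of total color `2`; `X₁, X₂` are
the elementary symmetric polynomials of the alphabet of all exits and `Y₁, Y₂` those of the alphabet
of all entrances. -/
def vertexRows {R : Type} [CommRing R] (N : ℕ) (a X₁ X₂ Y₁ Y₂ : R) : Fin 2 → KRow R :=
  ![{ a0 := a * quot1 X₁ X₂ Y₁ (N + 1), a1 := X₁ - Y₁, deg0 := (2, 2 * N) },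
    { a0 := a * quot2 X₂ Y₁ Y₂ (N + 1), a1 := X₂ - Y₂, deg0 := (2, 2 * N - 2) }]

/-! ### The two resolutions of a crossing

All strands point upward. The markings at the end points of a crossing are `x₁` (top left),
`y₁` (top right), `x₂` (bottom right), `y₂` (bottom left), indexed by `0, 1, 2, 3`. -/

/-- The boundary ring `ℚ[a, x₁, y₁, x₂, y₂]`. -/
abbrev BdryRing : Type := MarkRing (Fin 4)

/-- `ℚ[a, x₁, y₁, x₂, y₂] ⊗ Sym(𝕎)` where `𝕎` is an alphabet of two indeterminates, marking the
edge of color `2`; it is the polynomial ring on the elementary symmetric polynomials `W₁, W₂`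
of `𝕎` over the boundary ring. -/
abbrev WideRing : Type := MvPolynomial (Fin 2) BdryRing

/-- The bigrading of `WideRing`, with `deg W₁ = (0, 2)` and `deg W₂ = (0, 4)`. -/
def wideGr : ℤ × ℤ → AddSubgroup WideRing := polyGr (markGr (Fin 4)) ![(0, 2), (0, 4)]

/-- The marking at an end point of the crossing. -/
def bv (i : Fin 4) : BdryRing := MvPolynomial.X i

/-- The same marking in `WideRing`. -/
def wv (i : Fin 4) : WideRing := MvPolynomial.C (bv i)

/-- The matrix factorization of the resolution `Γ₀` (two parallel arcs `y₂ → x₁`, `x₂ → y₁`). -/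
def resolution0 (N : ℕ) : GradedMF BdryRing :=
  koszul BdryRing N (markGr (Fin 4))
    ![arcRow N (aElt _) (bv 0) (bv 3), arcRow N (aElt _) (bv 1) (bv 2)]

/-- The matrix factorization of the resolution `Γ₁`: the edges `y₂, x₂` merge into an edge of
color `2`, which then splits into the edges `x₁, y₁`. The splitting vertex contributes the shift
`{0, -1}`. -/
def resolution1 (N : ℕ) : GradedMF BdryRing :=
  (koszul BdryRing N wideGr
    (Fin.append
      (vertexRows N (MvPolynomial.C (aElt _)) (wv 0 + wv 1) (wv 0 * wv 1)
        (MvPolynomial.X 0) (MvPolynomial.X 1))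
      (vertexRows N (MvPolynomial.C (aElt _)) (MvPolynomial.X 0) (MvPolynomial.X 1)
        (wv 2 + wv 3) (wv 2 * wv 3)))).shift 0 (-1)

/-- For matrix factorizations `P`, `Q` over `S` and `s : S`, a pair of homotopically non-trivial
homogeneous morphisms `P → Q`, `Q → P` of `ℤ₂ ⊕ ℤ²`-degree `(0, 0, 1)` such that both compositions
are homotopic to the multiplication by `s`. -/
structure MorphismPair {S : Type} [CommRing S] (P Q : GradedMF S) (s : S) where
  chi0 : P.carrier →ₗ[S] Q.carrier
  chi1 : Q.carrier →ₗ[S] P.carrier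
  morphism0 : GradedMF.IsHomogMorphism P Q (0, 1) chi0
  morphism1 : GradedMF.IsHomogMorphism Q P (0, 1) chi1
  nontrivial0 : ¬ GradedMF.Homotopic P Q chi0 0
  nontrivial1 : ¬ GradedMF.Homotopic Q P chi1 0
  comp10 : GradedMF.Homotopic P P (chi1 ∘ₗ chi0) (s • LinearMap.id)
  comp01 : GradedMF.Homotopic Q Q (chi0 ∘ₗ chi1) (s • LinearMap.id)

/-- A pair of `χ`-morphisms `χ⁰ : C(Γ₀) → C(Γ₁)`, `χ¹ : C(Γ₁) → C(Γ₀)`, both of whose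
compositions are homotopic to the multiplication by `x₂ - x₁`. Such pairs are unique up to homotopy
and scaling. -/
abbrev ChiPair (N : ℕ) : Type := MorphismPair (resolution0 N) (resolution1 N) (bv 2 - bv 0)

/-! ### Chain complexes of matrix factorizations -/

/-- A chain complex of matrix factorizations over `S`, as one module with the homogeneous components
`homog ε i (j, k)` (`ℤ₂`-degree `ε`, homological degree `i`, bidegree `(j, k)`), the operators
`sgn = (-1)^ε` and `hsgn = (-1)^i`, the differential `dmf` of the matrix factorizations and the
differential `dchi` of the complex. -/
structure MFComplex (S : Type) [CommRing S] where
  carrier : Type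
  [addCommGroup : AddCommGroup carrier]
  [module : Module S carrier]
  homog : ZMod 2 → ℤ → ℤ × ℤ → AddSubgroup carrier
  sgn : carrier →ₗ[S] carrier
  hsgn : carrier →ₗ[S] carrier
  dmf : carrier →ₗ[S] carrier
  dchi : carrier →ₗ[S] carrier
  dchi_dmf : dchi ∘ₗ dmf = dmf ∘ₗ dchi
  sgn_dchi : sgn ∘ₗ dchi = dchi ∘ₗ sgn
  hsgn_dmf : hsgn ∘ₗ dmf = dmf ∘ₗ hsgn
  sgn_hsgn : sgn ∘ₗ hsgn = hsgn ∘ₗ sgn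

attribute [instance] MFComplex.addCommGroup MFComplex.module

namespace MFComplex

variable {S : Type} [CommRing S]

/-- A matrix factorization as a complex concentrated in homological degree `0`. -/
def single (M : GradedMF S) : MFComplex S where
  carrier := M.carrier
  homog ε i d := if i = 0 then M.homog ε d else ⊥
  sgn := M.sgn
  hsgn := LinearMap.id
  dmf := M.d
  dchi := 0
  dchi_dmf := by simp
  sgn_dchi := by simp
  hsgn_dmf := by simp
  sgn_hsgn := by simp

/-- The complex `0 → P --f--> Q → 0` with `P` in homological degree `i₀` and `Q` in degree
`i₀ + 1`. -/
def twoTerm (i₀ : ℤ) (P Q : GradedMF S) (f : P.carrier →ₗ[S] Q.carrier)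
    (hf : f ∘ₗ P.d = Q.d ∘ₗ f) (hs : f ∘ₗ P.sgn = Q.sgn ∘ₗ f) : MFComplex S where
  carrier := P.carrier × Q.carrier
  homog ε i d := if i = i₀ then (P.homog ε d).prod ⊥
    else if i = i₀ + 1 then (⊥ : AddSubgroup P.carrier).prod (Q.homog ε d) else ⊥
  sgn := P.sgn.prodMap Q.sgn
  hsgn := (((i₀.negOnePow : ℤ) : S) • LinearMap.id).prodMap
    ((((i₀ + 1).negOnePow : ℤ) : S) • LinearMap.id)
  dmf := P.d.prodMap Q.d
  dchi := LinearMap.inr S P.carrier Q.carrier ∘ₗ f ∘ₗ LinearMap.fst S P.carrier Q.carrier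
  dchi_dmf := by
    ext x
    · simp
    · simpa using LinearMap.congr_fun hf x
    · simp
    · simp
  sgn_dchi := by
    ext x
    · simp
    · simpa using (LinearMap.congr_fun hs x).symm
    · simp
    · simp
  hsgn_dmf := by ext <;> simp
  sgn_hsgn := by ext <;> simp

/-- For a homogeneous morphism `f : P → Q`, the complex
`0 → P⟨1⟩{q, r} --f--> Q⟨1⟩{q', r'} → 0` with its first term in homological degree `i₀`. -/
def crossing {P Q : GradedMF S} {δ : ℤ × ℤ} {f : P.carrier →ₗ[S] Q.carrier} (i₀ q r q' r' : ℤ)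
    (hf : GradedMF.IsHomogMorphism P Q δ f) : MFComplex S :=
  twoTerm i₀ (P.flip.shift q r) (Q.flip.shift q' r') f hf.comm (by
    change f ∘ₗ (-P.sgn) = (-Q.sgn) ∘ₗ f
    rw [LinearMap.comp_neg, LinearMap.neg_comp, hf.sgn])

/-- Extension of scalars along `R → S`; a homogeneous element of bidegree `d` is a sum of elements
`s ⊗ m` with `s`, `m` homogeneous and `deg s + deg m = d`. -/
def baseChange {R : Type} [CommRing R] [Algebra R S] (gr : ℤ × ℤ → AddSubgroup S)
    (C : MFComplex R) : MFComplex S where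
  carrier := S ⊗[R] C.carrier
  homog ε i d := AddSubgroup.closure
    {z | ∃ d₁ d₂ s m, d₁ + d₂ = d ∧ s ∈ gr d₁ ∧ m ∈ C.homog ε i d₂ ∧ z = s ⊗ₜ[R] m}
  sgn := C.sgn.baseChange S
  hsgn := C.hsgn.baseChange S
  dmf := C.dmf.baseChange S
  dchi := C.dchi.baseChange S
  dchi_dmf := by rw [← LinearMap.baseChange_comp, ← LinearMap.baseChange_comp, C.dchi_dmf]
  sgn_dchi := by rw [← LinearMap.baseChange_comp, ← LinearMap.baseChange_comp, C.sgn_dchi]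
  hsgn_dmf := by rw [← LinearMap.baseChange_comp, ← LinearMap.baseChange_comp, C.hsgn_dmf]
  sgn_hsgn := by rw [← LinearMap.baseChange_comp, ← LinearMap.baseChange_comp, C.sgn_hsgn]

/-- Tensor product of complexes of matrix factorizations, with the signed Leibniz rule (with respect
to the `ℤ₂`-grading for `dmf`, and to the homological grading for `dchi`). -/
def tensor (C D : MFComplex S) : MFComplex S where
  carrier := C.carrier ⊗[S] D.carrier
  homog ε i d := AddSubgroup.closure
    {z | ∃ ε₁ ε₂ i₁ i₂ d₁ d₂ m n, ε₁ + ε₂ = ε ∧ i₁ + i₂ = i ∧ d₁ + d₂ = d ∧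
      m ∈ C.homog ε₁ i₁ d₁ ∧ n ∈ D.homog ε₂ i₂ d₂ ∧ z = m ⊗ₜ[S] n}
  sgn := TensorProduct.map C.sgn D.sgn
  hsgn := TensorProduct.map C.hsgn D.hsgn
  dmf := TensorProduct.map C.dmf LinearMap.id + TensorProduct.map C.sgn D.dmf
  dchi := TensorProduct.map C.dchi LinearMap.id + TensorProduct.map C.hsgn D.dchi
  dchi_dmf := by
    simp only [LinearMap.add_comp, LinearMap.comp_add, ← TensorProduct.map_comp,
      LinearMap.comp_id, LinearMap.id_comp, C.dchi_dmf, C.sgn_dchi, C.hsgn_dmf, C.sgn_hsgn,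
      D.dchi_dmf]
    abel
  sgn_dchi := by
    simp only [LinearMap.add_comp, LinearMap.comp_add, ← TensorProduct.map_comp,
      LinearMap.comp_id, LinearMap.id_comp, C.sgn_dchi, C.sgn_hsgn, D.sgn_dchi]
  hsgn_dmf := by
    simp only [LinearMap.add_comp, LinearMap.comp_add, ← TensorProduct.map_comp,
      LinearMap.comp_id, LinearMap.id_comp, C.hsgn_dmf, C.sgn_hsgn, D.hsgn_dmf]
  sgn_hsgn := by
    simp only [← TensorProduct.map_comp, C.sgn_hsgn, D.sgn_hsgn]

/-- The complex of the empty graph, `S → 0 → S` in homological degree `0`. -/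
def unit (gr : ℤ × ℤ → AddSubgroup S) : MFComplex S :=
  single (koszul S 0 gr (Fin.elim0 : Fin 0 → KRow S))

/-- Tensor product of a list of complexes. -/
def tensorList (gr : ℤ × ℤ → AddSubgroup S) : List (MFComplex S) → MFComplex S
  | [] => unit gr
  | [C] => C
  | C :: D :: l => C.tensor (tensorList gr (D :: l))

/-! ### The homology `H(H(C, dmf), dchi)` -/

/-- `ker d / im d`; for `d ∘ d = 0`, the homology of `d`. -/
abbrev Homology {M : Type} [AddCommGroup M] [Module S M] (d : M →ₗ[S] M) : Type :=
  LinearMap.ker d ⧸ (LinearMap.range d).submoduleOf (LinearMap.ker d)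

/-- The classes in `ker d / im d` of the elements of `ker d` that lie in `A`. -/
def homologyClasses {M : Type} [AddCommGroup M] [Module S M] (d : M →ₗ[S] M)
    (A : AddSubgroup M) : AddSubgroup (Homology d) :=
  (A.comap (LinearMap.ker d).subtype.toAddMonoidHom).map
    (Submodule.mkQ ((LinearMap.range d).submoduleOf (LinearMap.ker d))).toAddMonoidHom

/-- The map induced on `ker d / im d` by a linear map commuting with `d`. -/
def inducedMap {M : Type} [AddCommGroup M] [Module S M] (d f : M →ₗ[S] M)
    (h : f ∘ₗ d = d ∘ₗ f) : Homology d →ₗ[S] Homology d :=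
  Submodule.mapQ _ _
    (f.restrict (p := LinearMap.ker d) (q := LinearMap.ker d) fun x hx => by
      have := LinearMap.congr_fun h x
      simp only [LinearMap.comp_apply, LinearMap.mem_ker.mp hx, map_zero] at this
      exact LinearMap.mem_ker.mpr this.symm)
    (by
      rintro ⟨x, hx⟩ hxr
      obtain ⟨y, hy⟩ := hxr
      refine ⟨f y, ?_⟩
      have := LinearMap.congr_fun h y
      simp only [LinearMap.comp_apply] at this
      simp only [Submodule.subtype_apply] at hy
      simp [← this, hy])

/-- `H(C, dmf)`. -/
abbrev H₁ (C : MFComplex S) : Type := Homology C.dmf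

/-- The differential induced by `dchi` on `H(C, dmf)`. -/
def dchiH (C : MFComplex S) : C.H₁ →ₗ[S] C.H₁ := inducedMap C.dmf C.dchi C.dchi_dmf

/-- `H(H(C, dmf), dchi)`. -/
abbrev H₂ (C : MFComplex S) : Type := Homology C.dchiH

/-- The homogeneous components of `H(H(C, dmf), dchi)`. -/
def homogH (C : MFComplex S) (ε : ZMod 2) (i : ℤ) (d : ℤ × ℤ) : AddSubgroup C.H₂ :=
  homologyClasses C.dchiH (homologyClasses C.dmf (C.homog ε i d))

/-- The part of `H(H(C, dmf), dchi)` of `ℤ₂`-degree `ε` and homological degree `i`: the direct sum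
over all bidegrees of the homogeneous components. (`S` acts with `ℤ₂`-degree and homological degree
`0`, so the sum is an `S`-submodule.) -/
def partH (C : MFComplex S) (ε : ZMod 2) (i : ℤ) : Submodule S C.H₂ :=
  Submodule.span S (⋃ d, (C.homogH ε i d : Set C.H₂))

end MFComplex

/-! ### Marked diagrams and closed braids -/

/-- A piece of a marked diagram with markings in `V`: an arc, or a positive (`true`) or negative
(`false`) crossing with its four end points. -/
inductive Piece (V : Type)
  | arc (exit entrance : V)
  | crossing (positive : Bool) (x₁ y₁ x₂ y₂ : V)

/-- The complex of the positive crossing,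
`C(Γ₁)⟨1⟩{1, N} --χ¹--> C(Γ₀)⟨1⟩{1, N - 1}` in homological degrees `-1, 0`. -/
def posCrossing (N : ℕ) (χ : ChiPair N) : MFComplex BdryRing :=
  MFComplex.crossing (-1) 1 N 1 (N - 1) χ.morphism1

/-- The complex of the negative crossing,
`C(Γ₀)⟨1⟩{-1, -N + 1} --χ⁰--> C(Γ₁)⟨1⟩{-1, -N}` in homological degrees `0, 1`. -/
def negCrossing (N : ℕ) (χ : ChiPair N) : MFComplex BdryRing :=
  MFComplex.crossing 0 (-1) (-N + 1) (-1) (-N) χ.morphism0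

/-- The complex of a piece, over the ring `ℚ[a][V]` of all markings. For a crossing, the four
indeterminates of the boundary ring are replaced by the markings of its end points (which need not be
distinct). -/
def pieceComplex (N : ℕ) (χ : ChiPair N) {V : Type} : Piece V → MFComplex (MarkRing V)
  | .arc x y => MFComplex.single (koszul (MarkRing V) N (markGr V)
      ![arcRow N (aElt V) (MvPolynomial.X x) (MvPolynomial.X y)])
  | .crossing s x₁ y₁ x₂ y₂ =>
      letI : Algebra BdryRing (MarkRing V) :=
        (MvPolynomial.rename (R := ℚ[X]) ![x₁, y₁, x₂, y₂]).toRingHom.toAlgebra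
      (if s then posCrossing N χ else negCrossing N χ).baseChange (markGr V)

/-- A braid word on `m + 1` strands: the letter `(i, true)` is the generator `σ_{i+1}` and
`(i, false)` is its inverse. -/
abbrev BraidWord (m : ℕ) : Type := List (Fin m × Bool)

/-- The negative stabilization `μ ↦ μ σ_{m+1}⁻¹`, from braid words on `m + 1` strands to braid words
on `m + 2` strands. -/
def negStab {m : ℕ} (w : BraidWord m) : BraidWord (m + 1) :=
  w.map (fun l => (l.1.castSucc, l.2)) ++ [(Fin.last m, false)]

/-- Markings of the closure of a braid word of length `ℓ`: one on every strand, at each of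
`max ℓ 1` levels. The `k`-th letter sits between the level `k` and the next level, cyclically. -/
abbrev ClosureMarks {m : ℕ} (w : BraidWord m) : Type := Fin (w.length - 1 + 1) × Fin (m + 1)

/-- The pieces between the level `k` and the next level. -/
def slice {m : ℕ} (w : BraidWord m) (k : Fin (w.length - 1 + 1)) : List (Piece (ClosureMarks w)) :=
  match w[(k : ℕ)]? with
  | none => (List.finRange (m + 1)).map fun j => .arc (k + 1, j) (k, j)
  | some (i, s) =>
      .crossing s (k + 1, i.castSucc) (k + 1, i.succ) (k, i.succ) (k, i.castSucc) ::
        ((List.finRange (m + 1)).filter fun j => j ≠ i.castSucc ∧ j ≠ i.succ).map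
          fun j => .arc (k + 1, j) (k, j)

/-- The chain complex `C_N(B)` of the closure `B` of a braid word: the tensor product of the complexes
of its pieces. -/
def braidComplex (N : ℕ) (χ : ChiPair N) {m : ℕ} (w : BraidWord m) :
    MFComplex (MarkRing (ClosureMarks w)) :=
  MFComplex.tensorList (markGr _)
    (((List.finRange (w.length - 1 + 1)).flatMap (slice w)).map (pieceComplex N χ))

/-- `𝓗_N^{ε, i, ⋆, ⋆}(B)` for the closure `B` of a braid word, as a bigraded `ℚ[a]`-module. -/
def braidHomology (N : ℕ) (χ : ChiPair N) {m : ℕ} (w : BraidWord m) (ε : ZMod 2) (i : ℤ) : GrMod :=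
  letI : Module ℚ[X] ((braidComplex N χ w).partH ε i) :=
    Module.compHom _ (algebraMap ℚ[X] (MarkRing (ClosureMarks w)))
  { carrier := (braidComplex N χ w).partH ε i
    homog := fun d => ((braidComplex N χ w).homogH ε i d).comap
      ((braidComplex N χ w).partH ε i).subtype.toAddMonoidHom }

/-- The `1`-strand braid, whose closure is the transverse unknot `U`. -/
def unknotU : BraidWord 0 := []

/-- The negative stabilization of the `1`-strand braid, whose closure is `U_-`. -/
def unknotUMinus : BraidWord 1 := negStab unknotU

end TransverseHomology

end

open scoped TensorProduct DirectSum Polynomial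

noncomputable section

namespace TransverseHomology

/-! The unknot. Closing the single arc of `U` gives the Koszul factorization with the one row
`((N+1) a x^N, 0)` over `ℚ[a, x]`. Multiplication by the first entry is injective, so only the odd
part survives, and it is `ℚ[a, x]/(a x^N)`: the powers `x^l` with `l < N` generate free summands,
and the higher powers are killed by `a`.

The stabilization. Let `A = ℚ[a, x, y]` be the ring of the two markings of `U_-`, and let `h_n` be
the complete symmetric polynomial in `x, y` (`hSum`). The variables of the wide edge can be excluded
up to homotopy (`contractionRes1`). After closing up, all second entries of the rows vanish and the
difference quotients become partial derivatives of power sums (`quot1_self`, `quot2_self`). The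
first entries are then `(N+1) a x^N`, `(N+1) a y^N` for the two arcs, and `(N+1) a h_N`, `-(N+1) a
h_{N-1}` for the wide edge. For rows `(a α, 0)`, `(a β, 0)` with `α, β` coprime, the homology is
`A/(a α, a β)` on the top generator plus `A/(a)` on the syzygy `(α, β)` (`kosD_diagRows_eq_zero`).

The map `χ⁰` need not be computed, and uniqueness of the pair is not used. A homogeneous chain map
acts on top generators and on syzygies by one element of `A` each, of prescribed bidegree
(`map_top`, `map_syzygy`). For `χ⁰` on top generators and for `χ¹` on syzygies this bidegree is `0`,
so the element is a rational number. It is nonzero: `χ¹ χ⁰` is homotopic to `y - x`, boundaries are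
divisible by `a`, and `a` does not divide `y - x` (`exists_map_top`, `exists_map_syzygy`). Up to
units `χ⁰` is therefore the projection `A/(a x^N, a y^N) → A/(a h_N, a h_{N-1})` together with
multiplication by `y - x` on `A/(a)`. The second map is injective with cokernel `A/(a, y - x)`, the
torsion part in homological degree `1`. The first is surjective; as `h_N = x^N + y h_{N-1}`, its
kernel is generated by `a h_{N-1}`, whose annihilator is `(y - x, x^N)` (`X_pow_dvd_diag_iff`). This
is the free part in homological degree `0`. The torsion of `U` has thus moved to a degree in which
the homology of `U` vanishes.

Existence of `χ⁰, χ¹`. The second entries of the wide-edge rows arise from those of the arcs by a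
matrix of determinant `x₁ - x₂`. This matrix, its adjugate and one correction term `k` for the first
entries give the two morphisms (`exists_chiCorrection`, `chiModel0_kosD`, `chiModel1_kosD`).

The iterated homology is handled through representatives, as the subquotient `cyc / bd` of the
complex. A `WeakEquiv`, which respects `dchi` only up to homotopy, suffices to compare such
subquotients. `IsGenerator` expresses that a part of the homology is cyclic, with prescribed
annihilator and grading. -/

/-! ### Gradings of polynomial rings -/

/-- A family of subgroups of a ring that contains `1` and is compatible with products. -/
structure IsGr {A : Type} [CommRing A] (gr : ℤ × ℤ → AddSubgroup A) : Prop where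
  one : (1 : A) ∈ gr 0
  mul : ∀ {d e : ℤ × ℤ} {f g : A}, f ∈ gr d → g ∈ gr e → f * g ∈ gr (d + e)

theorem IsGr.pow {A : Type} [CommRing A] {gr : ℤ × ℤ → AddSubgroup A} (h : IsGr gr) {d : ℤ × ℤ}
    {f : A} (hf : f ∈ gr d) (n : ℕ) : f ^ n ∈ gr (n • d) := by
  induction n with
  | zero => simpa using h.one
  | succ n ih => rw [pow_succ, succ_nsmul]; exact h.mul ih hf

theorem mem_congr {A : Type} [CommRing A] {gr : ℤ × ℤ → AddSubgroup A} {d e : ℤ × ℤ} {f : A}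
    (hf : f ∈ gr d) (h : d = e) : f ∈ gr e := h ▸ hf

/-- Projections to the homogeneous components of a graded ring. -/
structure GrProj {A : Type} [CommRing A] (gr : ℤ × ℤ → AddSubgroup A) where
  pr : ℤ × ℤ → A →+ A
  mem : ∀ d f, pr d f ∈ gr d
  eq_self : ∀ {d f}, f ∈ gr d → pr d f = f
  mul : ∀ {e r} (d f), r ∈ gr e → pr d (r * f) = r * pr (d - e) f

theorem mem_baseGr {d : ℤ × ℤ} {p : ℚ[X]} :
    p ∈ baseGr d ↔ ∀ n : ℕ, d ≠ (2 * (n : ℤ), 0) → p.coeff n = 0 := by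
  simp only [baseGr, AddSubgroup.mem_iInf, AddSubgroup.mem_comap]
  refine forall_congr' fun n => ?_
  split_ifs with h <;> simp [h]

theorem baseGr_isGr : IsGr baseGr where
  one := by
    rw [mem_baseGr]
    intro n hn
    rw [Polynomial.coeff_one, if_neg]
    rintro rfl
    exact hn rfl
  mul := by
    intro d e f g hf hg
    rw [mem_baseGr] at *
    intro n hn
    rw [Polynomial.coeff_mul]
    refine Finset.sum_eq_zero fun p hp => ?_
    by_cases h1 : d = (2 * (p.1 : ℤ), 0)
    · rw [hg p.2, mul_zero]
      rintro rfl
      apply hn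
      rw [h1, ← Finset.HasAntidiagonal.mem_antidiagonal.1 hp]
      ext <;> simp
      ring
    · rw [hf p.1 h1, zero_mul]

theorem X_mem_baseGr : (Polynomial.X : ℚ[X]) ∈ baseGr (2, 0) := by
  rw [mem_baseGr]
  intro n hn
  rw [Polynomial.coeff_X, if_neg]
  rintro rfl
  exact hn rfl

/-- The projections of `ℚ[a]` to its homogeneous components. -/
def baseProj : GrProj baseGr where
  -- The guard singles out the bidegrees `(2n, 0)`. Without it, division by `2` and `toNat` would
  -- assign a monomial to odd and negative degrees too.
  pr d := if d.2 = 0 ∧ 0 ≤ d.1 ∧ 2 ∣ d.1 then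
    ((Polynomial.monomial (d.1 / 2).toNat).comp
      (Polynomial.lcoeff ℚ (d.1 / 2).toNat)).toAddMonoidHom else 0
  mem d f := by
    rw [mem_baseGr]
    intro n hn
    split_ifs with h
    · simp only [LinearMap.toAddMonoidHom_coe, LinearMap.comp_apply, Polynomial.coeff_monomial]
      rw [if_neg]
      rintro rfl
      apply hn
      ext
      · simp; omega
      · exact h.1
    · simp
  eq_self := by
    intro d f hf
    rw [mem_baseGr] at hf
    split_ifs with h
    · ext n
      simp only [LinearMap.toAddMonoidHom_coe, LinearMap.comp_apply, Polynomial.coeff_monomial,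
        Polynomial.lcoeff_apply]
      split_ifs with h'
      · rw [h']
      · rw [hf n]
        rintro rfl
        simp at h'
    · ext n
      simp only [AddMonoidHom.zero_apply, Polynomial.coeff_zero]
      rw [hf n]
      rintro rfl
      simp at h
  mul := by
    intro e r d f hr
    rw [mem_baseGr] at hr
    -- Either `e = (2k, 0)`, and `r` is a monomial `c a^k`, or the component of degree `e` is zero
    -- and so is `r`.
    by_cases he : ∃ k : ℕ, e = (2 * (k : ℤ), 0)
    · obtain ⟨k, rfl⟩ := he
      have hr' : r = Polynomial.monomial k (r.coeff k) := by
        ext n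
        rw [Polynomial.coeff_monomial]
        split_ifs with h
        · rw [h]
        · rw [hr n]
          intro h'
          simp only [Prod.mk.injEq, and_true] at h'
          omega
      rw [hr']
      generalize r.coeff k = c
      have key : ∀ (f : ℚ[X]) (n : ℕ), (Polynomial.monomial k c * f).coeff n =
          if k ≤ n then c * f.coeff (n - k) else 0 := by
        intro f n
        rw [← Polynomial.C_mul_X_pow_eq_monomial, mul_assoc, Polynomial.coeff_C_mul,
          Polynomial.coeff_X_pow_mul']
        split_ifs <;> simp
      ext n
      obtain ⟨d1, d2⟩ := d
      simp only [Prod.mk_sub_mk, sub_zero]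
      rw [key]
      by_cases h : d2 = 0 ∧ 0 ≤ d1 ∧ 2 ∣ d1
      · rw [if_pos h]
        obtain ⟨h0, h1, j, rfl⟩ := h
        lift j to ℕ using by omega
        have e1 : (2 * (j : ℤ) / 2).toNat = j := by omega
        simp only [LinearMap.toAddMonoidHom_coe, LinearMap.comp_apply, Polynomial.coeff_monomial,
          Polynomial.lcoeff_apply, key, e1]
        by_cases hkj : k ≤ j
        · rw [if_pos (show d2 = 0 ∧ 0 ≤ 2 * (j : ℤ) - 2 * k ∧ 2 ∣ 2 * (j : ℤ) - 2 * k by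
            refine ⟨h0, by omega, by omega⟩)]
          have e2 : ((2 * (j : ℤ) - 2 * k) / 2).toNat = j - k := by omega
          simp only [LinearMap.toAddMonoidHom_coe, LinearMap.comp_apply,
            Polynomial.coeff_monomial, Polynomial.lcoeff_apply, e2]
          rw [if_pos hkj]
          by_cases hjn : j = n
          · subst hjn
            simp [hkj]
          · rw [if_neg hjn]
            split_ifs with h3 h4
            · omega
            · simp
            · rfl
        · rw [if_neg (show ¬ (d2 = 0 ∧ 0 ≤ 2 * (j : ℤ) - 2 * k ∧ 2 ∣ 2 * (j : ℤ) - 2 * k) by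
            rintro ⟨-, h, -⟩; omega)]
          rw [if_neg hkj]
          simp
      · rw [if_neg h, if_neg (show ¬ (d2 = 0 ∧ 0 ≤ d1 - 2 * (k : ℤ) ∧ 2 ∣ d1 - 2 * (k : ℤ)) by
          rintro ⟨h1, h2, h3⟩
          exact h ⟨h1, by omega, by omega⟩)]
        simp
    · have : r = 0 := by
        ext n
        exact hr n fun h => he ⟨n, h⟩
      subst this
      simp

/-! ### Polynomial rings over a bigraded ring -/

section PolyGr

variable {A σ : Type} [CommRing A] {gr : ℤ × ℤ → AddSubgroup A} {w : σ → ℤ × ℤ}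

/-- The bidegree of a monomial. -/
abbrev wt (w : σ → ℤ × ℤ) (m : σ →₀ ℕ) : ℤ × ℤ := m.sum fun i n => n • w i

theorem wt_add (m m' : σ →₀ ℕ) : wt w (m + m') = wt w m + wt w m' :=
  Finsupp.sum_add_index' (by simp) (by intros; rw [add_nsmul])

theorem mem_polyGr {d : ℤ × ℤ} {f : MvPolynomial σ A} :
    f ∈ polyGr gr w d ↔ ∀ m, f.coeff m ∈ gr (d - wt w m) := by
  rw [polyGr, AddSubgroup.mem_iInf]
  rfl

theorem C_mem_polyGr {d : ℤ × ℤ} {r : A} (hr : r ∈ gr d) :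
    (MvPolynomial.C r : MvPolynomial σ A) ∈ polyGr gr w d := by
  classical
  rw [mem_polyGr]
  intro m
  rw [MvPolynomial.coeff_C]
  split_ifs with h
  · subst h
    simpa using hr
  · exact zero_mem _

theorem X_mem_polyGr (h : IsGr gr) (i : σ) :
    (MvPolynomial.X i : MvPolynomial σ A) ∈ polyGr gr w (w i) := by
  classical
  rw [mem_polyGr]
  intro m
  rw [MvPolynomial.coeff_X]
  split_ifs with h'
  · subst h'
    simpa [wt] using h.one
  · exact zero_mem _

theorem polyGr_isGr (h : IsGr gr) : IsGr (polyGr gr w) where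
  one := by
    rw [← MvPolynomial.C_1]
    exact C_mem_polyGr h.one
  mul := by
    classical
    intro d e f g hf hg
    rw [mem_polyGr] at *
    intro m
    rw [MvPolynomial.coeff_mul]
    refine sum_mem fun p hp => mem_congr (h.mul (hf p.1) (hg p.2)) ?_
    rw [← Finset.HasAntidiagonal.mem_antidiagonal.1 hp, wt_add]
    abel

theorem monomial_induction {Q : ℤ × ℤ → MvPolynomial σ A → Prop}
    (one : Q 0 1) (X : ∀ i, Q (w i) (MvPolynomial.X i))
    (mul : ∀ d e f g, Q d f → Q e g → Q (d + e) (f * g)) (m : σ →₀ ℕ) :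
    Q (wt w m) (m.prod fun i n => MvPolynomial.X i ^ n) := by
  classical
  have hp : ∀ (i : σ) (n : ℕ), Q (n • w i) (MvPolynomial.X i ^ n) := by
    intro i n
    induction n with
    | zero => simpa using one
    | succ n ih => rw [pow_succ, succ_nsmul]; exact mul _ _ _ _ ih (X i)
  have : ∀ s : Finset σ, Q (∑ i ∈ s, m i • w i) (∏ i ∈ s, MvPolynomial.X i ^ m i) := by
    intro s
    induction s using Finset.induction_on with
    | empty => simpa using one
    | insert i s hi ih => rw [Finset.sum_insert hi, Finset.prod_insert hi]
                          exact mul _ _ _ _ (hp _ _) ih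
  exact this m.support

/-- Induction for homogeneous polynomials. -/
theorem polyGr_induction {Q : ℤ × ℤ → MvPolynomial σ A → Prop} (h : IsGr gr)
    (zero : ∀ d, Q d 0) (add : ∀ d f g, Q d f → Q d g → Q d (f + g))
    (C : ∀ d r, r ∈ gr d → Q d (MvPolynomial.C r)) (X : ∀ i, Q (w i) (MvPolynomial.X i))
    (mul : ∀ d e f g, Q d f → Q e g → Q (d + e) (f * g)) {d : ℤ × ℤ} {f : MvPolynomial σ A}
    (hf : f ∈ polyGr gr w d) : Q d f := by
  classical
  rw [mem_polyGr] at hf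
  rw [f.as_sum]
  refine Finset.sum_induction _ (Q d) (add d) (zero d) fun m _ => ?_
  rw [MvPolynomial.monomial_eq]
  have h1 := mul _ _ _ _ (C _ _ (hf m))
    (monomial_induction (w := w) (by simpa using C 0 1 h.one) X mul m)
  simpa using h1

/-- Constants and variables suffice, because homogeneous polynomials are built from them by products
and by sums within one degree. -/
theorem map_mem_of_mem_polyGr {B : Type} [CommRing B] {grB : ℤ × ℤ → AddSubgroup B} (h : IsGr gr)
    (hB : IsGr grB) (φ : MvPolynomial σ A →+* B)
    (hC : ∀ d r, r ∈ gr d → φ (MvPolynomial.C r) ∈ grB d)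
    (hX : ∀ i, φ (MvPolynomial.X i) ∈ grB (w i)) {d : ℤ × ℤ} {f : MvPolynomial σ A}
    (hf : f ∈ polyGr gr w d) : φ f ∈ grB d := by
  refine polyGr_induction (Q := fun d f => φ f ∈ grB d) h ?_ ?_ hC hX ?_ hf
  · intro d; simp
  · intro d f g h1 h2; rw [map_add]; exact add_mem h1 h2
  · intro d e f g h1 h2; rw [map_mul]; exact hB.mul h1 h2

/-- Divisibility of `f - E f` by `u` passes to products, since `f g - E f * E g = f (g - E g) + (f -
E f) E g`. With `E` a substitution this is division by a linear polynomial with a homogeneous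
quotient. -/
theorem exists_mul_eq_sub_of_mem (h : IsGr gr) (E : MvPolynomial σ A →+* MvPolynomial σ A)
    (u : MvPolynomial σ A) (δ : ℤ × ℤ) (hC : ∀ r, E (MvPolynomial.C r) = MvPolynomial.C r)
    (hE : ∀ i, E (MvPolynomial.X i) ∈ polyGr gr w (w i))
    (hX : ∀ i, ∃ c ∈ polyGr gr w (w i - δ), u * c = MvPolynomial.X i - E (MvPolynomial.X i))
    {d : ℤ × ℤ} {f : MvPolynomial σ A} (hf : f ∈ polyGr gr w d) :
    ∃ c ∈ polyGr gr w (d - δ), u * c = f - E f := by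
  have hg : IsGr (polyGr gr w) := polyGr_isGr h
  -- The quotient for a product involves `f` and `E g`, so their homogeneity has to be part of the
  -- induction hypothesis.
  suffices f ∈ polyGr gr w d ∧ E f ∈ polyGr gr w d ∧
      ∃ c ∈ polyGr gr w (d - δ), u * c = f - E f from this.2.2
  refine polyGr_induction (Q := fun d f => f ∈ polyGr gr w d ∧ E f ∈ polyGr gr w d ∧
      ∃ c ∈ polyGr gr w (d - δ), u * c = f - E f) h ?_ ?_ ?_ ?_ ?_ hf
  · intro d
    exact ⟨zero_mem _, by simp, 0, zero_mem _, by simp⟩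
  · rintro d f g ⟨h1, h2, c, h3, h4⟩ ⟨h1', h2', c', h3', h4'⟩
    refine ⟨add_mem h1 h1', by rw [map_add]; exact add_mem h2 h2', c + c', add_mem h3 h3', ?_⟩
    rw [mul_add, h4, h4', map_add]
    ring
  · intro d r hr
    refine ⟨C_mem_polyGr hr, by rw [hC]; exact C_mem_polyGr hr, 0, zero_mem _, ?_⟩
    rw [hC]
    simp
  · intro i
    exact ⟨X_mem_polyGr h i, hE i, hX i⟩
  · rintro d e f g ⟨h1, h2, c, h3, h4⟩ ⟨h1', h2', c', h3', h4'⟩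
    refine ⟨hg.mul h1 h1', by rw [map_mul]; exact hg.mul h2 h2', f * c' + c * E g, ?_, ?_⟩
    · exact add_mem (mem_congr (hg.mul h1 h3') (by abel)) (mem_congr (hg.mul h3 h2') (by abel))
    · rw [map_mul]
      linear_combination f * h4' + E g * h4

theorem exists_mul_eq_sub (E : MvPolynomial σ A →+* MvPolynomial σ A)
    (u : MvPolynomial σ A) (hC : ∀ r, E (MvPolynomial.C r) = MvPolynomial.C r)
    (hX : ∀ i, ∃ c, u * c = MvPolynomial.X i - E (MvPolynomial.X i)) (f : MvPolynomial σ A) :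
    ∃ c, u * c = f - E f := by
  induction f using MvPolynomial.induction_on with
  | C r => exact ⟨0, by rw [hC]; simp⟩
  | add f g hf hg =>
    obtain ⟨c, hc⟩ := hf
    obtain ⟨c', hc'⟩ := hg
    exact ⟨c + c', by rw [mul_add, hc, hc', map_add]; ring⟩
  | mul_X f i hf =>
    obtain ⟨c, hc⟩ := hf
    obtain ⟨c', hc'⟩ := hX i
    exact ⟨f * c' + c * E (MvPolynomial.X i), by
      rw [map_mul]; linear_combination f * hc' + E (MvPolynomial.X i) * hc⟩

/-- Coefficientwise projections to homogeneous components. -/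
def polyPr (P : GrProj gr) (w : σ → ℤ × ℤ) (d : ℤ × ℤ) : MvPolynomial σ A →+ MvPolynomial σ A where
  toFun f := ∑ m ∈ f.support, MvPolynomial.monomial m (P.pr (d - wt w m) (f.coeff m))
  map_zero' := by simp
  map_add' f g := by
    classical
    have key : ∀ (f : MvPolynomial σ A) (m : σ →₀ ℕ), MvPolynomial.coeff m
        (∑ m ∈ f.support, MvPolynomial.monomial m (P.pr (d - wt w m) (f.coeff m))) =
          P.pr (d - wt w m) (f.coeff m) := by
      intro f m
      rw [MvPolynomial.coeff_sum]
      simp only [MvPolynomial.coeff_monomial]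
      rw [Finset.sum_ite_eq' f.support m]
      split_ifs with h
      · rfl
      · rw [MvPolynomial.notMem_support_iff.1 h, map_zero]
    ext m
    rw [MvPolynomial.coeff_add, key, key, key, MvPolynomial.coeff_add, map_add]

theorem coeff_polyPr (P : GrProj gr) (d : ℤ × ℤ) (f : MvPolynomial σ A) (m : σ →₀ ℕ) :
    MvPolynomial.coeff m (polyPr P w d f) = P.pr (d - wt w m) (f.coeff m) := by
  classical
  change MvPolynomial.coeff m
        (∑ m ∈ f.support, MvPolynomial.monomial m (P.pr (d - wt w m) (f.coeff m))) = _
  rw [MvPolynomial.coeff_sum]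
  simp only [MvPolynomial.coeff_monomial]
  rw [Finset.sum_ite_eq' f.support m]
  split_ifs with h
  · rfl
  · rw [MvPolynomial.notMem_support_iff.1 h, map_zero]

/-- The projections of a polynomial ring over a graded ring to its homogeneous components. -/
def polyProj (P : GrProj gr) (w : σ → ℤ × ℤ) : GrProj (polyGr gr w) where
  pr := polyPr P w
  mem d f := by
    rw [mem_polyGr]
    intro m
    rw [coeff_polyPr]
    exact P.mem _ _
  eq_self := by
    intro d f hf
    rw [mem_polyGr] at hf
    ext m
    rw [coeff_polyPr, P.eq_self (hf m)]
  mul := by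
    classical
    intro e r d f hr
    rw [mem_polyGr] at hr
    ext m
    rw [coeff_polyPr, MvPolynomial.coeff_mul, MvPolynomial.coeff_mul, map_sum]
    refine Finset.sum_congr rfl fun p hp => ?_
    rw [coeff_polyPr, P.mul _ _ (hr p.1)]
    congr 2
    rw [← Finset.HasAntidiagonal.mem_antidiagonal.1 hp, wt_add]
    congr 1
    abel

end PolyGr

theorem markGr_isGr (V : Type) : IsGr (markGr V) := polyGr_isGr baseGr_isGr

/-- The projections of `ℚ[a][V]` to its homogeneous components. -/
def markProj (V : Type) : GrProj (markGr V) := polyProj baseProj _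

theorem X_mem_markGr {V : Type} (v : V) : (MvPolynomial.X v : MarkRing V) ∈ markGr V (0, 2) :=
  X_mem_polyGr (w := fun _ => (0, 2)) baseGr_isGr v

theorem aElt_mem_markGr (V : Type) : aElt V ∈ markGr V (2, 0) :=
  C_mem_polyGr X_mem_baseGr

theorem C_mem_markGr {V : Type} {d : ℤ × ℤ} {p : ℚ[X]} (hp : p ∈ baseGr d) :
    (MvPolynomial.C p : MarkRing V) ∈ markGr V d := C_mem_polyGr hp

theorem natCast_mem {A : Type} [CommRing A] {gr : ℤ × ℤ → AddSubgroup A} (h : IsGr gr) (n : ℕ) :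
    (n : A) ∈ gr 0 := by
  simpa using nsmul_mem h.one n

/-! ### Koszul matrix factorizations, one row at a time -/

section Koszul

variable {B : Type} [CommRing B]

/-- The differential of a Koszul matrix factorization. -/
def kosD {n : ℕ} (row : Fin n → KRow B) : (Finset (Fin n) → B) →ₗ[B] (Finset (Fin n) → B) :=
  LinearMap.pi fun s : Finset (Fin n) => ∑ i : Fin n,
    ((-1 : B) ^ (s.filter fun j => j < i).card) •
      (if i ∈ s then (row i).a0 • (LinearMap.proj (s.erase i) : (Finset (Fin n) → B) →ₗ[B] B)
        else (row i).a1 • (LinearMap.proj (insert i s) : (Finset (Fin n) → B) →ₗ[B] B))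

/-- The sign operator of a Koszul matrix factorization. -/
def kosSgn (B : Type) [CommRing B] (n : ℕ) : (Finset (Fin n) → B) →ₗ[B] (Finset (Fin n) → B) :=
  LinearMap.pi fun s : Finset (Fin n) =>
    ((-1 : B) ^ s.card) • (LinearMap.proj s : (Finset (Fin n) → B) →ₗ[B] B)

theorem kosD_apply {n : ℕ} (row : Fin n → KRow B) (f : Finset (Fin n) → B) (s : Finset (Fin n)) :
    kosD row f s = ∑ i : Fin n, (-1 : B) ^ (s.filter fun j => j < i).card *
      (if i ∈ s then (row i).a0 * f (s.erase i) else (row i).a1 * f (insert i s)) := by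
  simp only [kosD, LinearMap.pi_apply, LinearMap.sum_apply, LinearMap.smul_apply, smul_eq_mul]
  refine Finset.sum_congr rfl fun i _ => ?_
  split_ifs <;> simp

theorem kosSgn_apply {n : ℕ} (f : Finset (Fin n) → B) (s : Finset (Fin n)) :
    kosSgn B n f s = (-1 : B) ^ s.card * f s := rfl

theorem kosD_zero (row : Fin 0 → KRow B) (f : Finset (Fin 0) → B) : kosD row f = 0 := by
  ext s
  rw [kosD_apply]
  simp

/-- The components of an element of a Koszul matrix factorization without the first generator. -/
def lo {M : Type} {n : ℕ} (f : Finset (Fin (n + 1)) → M) (s : Finset (Fin n)) : M :=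
  f (s.map (Fin.succEmb n))

/-- The components of an element of a Koszul matrix factorization with the first generator. -/
def hi {M : Type} {n : ℕ} (f : Finset (Fin (n + 1)) → M) (s : Finset (Fin n)) : M :=
  f (insert 0 (s.map (Fin.succEmb n)))

/-- The element of a Koszul matrix factorization with prescribed components. -/
def mk {M : Type} {n : ℕ} (f g : Finset (Fin n) → M) (t : Finset (Fin (n + 1))) : M :=
  if 0 ∈ t then g (Finset.univ.filter fun i => i.succ ∈ t)
  else f (Finset.univ.filter fun i => i.succ ∈ t)

theorem lo_mk {M : Type} {n : ℕ} (f g : Finset (Fin n) → M) : lo (mk f g) = f := by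
  ext s
  simp [lo, mk]

theorem hi_mk {M : Type} {n : ℕ} (f g : Finset (Fin n) → M) : hi (mk f g) = g := by
  ext s
  simp [hi, mk]

theorem eq_map_or_insert {n : ℕ} (t : Finset (Fin (n + 1))) :
    ∃ s : Finset (Fin n), t = s.map (Fin.succEmb n) ∨ t = insert 0 (s.map (Fin.succEmb n)) := by
  refine ⟨Finset.univ.filter fun i => i.succ ∈ t, ?_⟩
  by_cases h : 0 ∈ t
  · right
    ext i
    refine Fin.cases ?_ (fun j => ?_) i <;> simp [h]
  · left
    ext i
    refine Fin.cases ?_ (fun j => ?_) i <;> simp [h]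

theorem ext_lo_hi {M : Type} {n : ℕ} {f g : Finset (Fin (n + 1)) → M} (h0 : lo f = lo g)
    (h1 : hi f = hi g) : f = g := by
  ext t
  obtain ⟨s, rfl | rfl⟩ := eq_map_or_insert t
  · exact congrFun h0 s
  · exact congrFun h1 s

/-- Splitting off the first generator writes the differential in blocks `(d', a₁; a₀, -d')`, with
`d'` the differential of the remaining rows. The sign in `hi_kosD` comes from moving `d'` past an
odd generator. All later facts about Koszul factorizations are inductions on these two formulas. -/
theorem lo_kosD {n : ℕ} (row : Fin (n + 1) → KRow B) (f : Finset (Fin (n + 1)) → B) :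
    lo (kosD row f) = kosD (fun i => row i.succ) (lo f) + (row 0).a1 • hi f := by
  ext s
  rw [lo, kosD_apply, Fin.sum_univ_succ, Pi.add_apply, kosD_apply, add_comm]
  congr 1
  · refine Finset.sum_congr rfl fun i _ => ?_
    have h1 : ((s.map (Fin.succEmb n)).filter fun j => j < i.succ) =
        (s.filter fun j => j < i).map (Fin.succEmb n) := by
      ext k
      refine Fin.cases ?_ (fun j => ?_) k <;> simp
    rw [h1, Finset.card_map]
    have h2 : i.succ ∈ s.map (Fin.succEmb n) ↔ i ∈ s := by simp
    have h3 : (s.map (Fin.succEmb n)).erase i.succ = (s.erase i).map (Fin.succEmb n) := by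
      rw [Finset.map_erase]; rfl
    have h4 : insert i.succ (s.map (Fin.succEmb n)) = (insert i s).map (Fin.succEmb n) := by
      rw [Finset.map_insert]; rfl
    simp only [h2, h3, h4, lo]
  · have h1 : ((s.map (Fin.succEmb n)).filter fun j => j < 0) = ∅ := by simp
    rw [h1]
    simp [hi]

theorem hi_kosD {n : ℕ} (row : Fin (n + 1) → KRow B) (f : Finset (Fin (n + 1)) → B) :
    hi (kosD row f) = (row 0).a0 • lo f - kosD (fun i => row i.succ) (hi f) := by
  ext s
  rw [hi, kosD_apply, Fin.sum_univ_succ, Pi.sub_apply, kosD_apply, sub_eq_add_neg,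
    ← Finset.sum_neg_distrib]
  have h0 : (0 : Fin (n + 1)) ∉ s.map (Fin.succEmb n) := by simp
  congr 1
  · have h1 : ((insert 0 (s.map (Fin.succEmb n))).filter fun j => j < 0) = ∅ := by
      simp
    rw [h1]
    simp [lo, Finset.erase_insert h0]
  · refine Finset.sum_congr rfl fun i _ => ?_
    have h1 : ((insert 0 (s.map (Fin.succEmb n))).filter fun j => j < i.succ) =
        insert 0 ((s.filter fun j => j < i).map (Fin.succEmb n)) := by
      ext k
      refine Fin.cases ?_ (fun j => ?_) k <;> simp
    rw [h1, Finset.card_insert_of_notMem (by simp), Finset.card_map, pow_succ]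
    have h2 : i.succ ∈ insert 0 (s.map (Fin.succEmb n)) ↔ i ∈ s := by simp
    have h3 : (insert 0 (s.map (Fin.succEmb n))).erase i.succ =
        insert 0 ((s.erase i).map (Fin.succEmb n)) := by
      rw [Finset.map_erase, Finset.erase_insert_of_ne (Fin.succ_ne_zero i).symm]; rfl
    have h4 : insert i.succ (insert 0 (s.map (Fin.succEmb n))) =
        insert 0 ((insert i s).map (Fin.succEmb n)) := by
      rw [Finset.map_insert, Finset.insert_comm]; rfl
    simp only [h2, h3, h4, hi]
    ring

theorem lo_add {n : ℕ} (f g : Finset (Fin (n + 1)) → B) : lo (f + g) = lo f + lo g := rfl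

theorem hi_add {n : ℕ} (f g : Finset (Fin (n + 1)) → B) : hi (f + g) = hi f + hi g := rfl

theorem lo_sub {n : ℕ} (f g : Finset (Fin (n + 1)) → B) : lo (f - g) = lo f - lo g := rfl

theorem hi_sub {n : ℕ} (f g : Finset (Fin (n + 1)) → B) : hi (f - g) = hi f - hi g := rfl

theorem lo_neg {n : ℕ} (f : Finset (Fin (n + 1)) → B) : lo (-f) = -lo f := rfl

theorem hi_neg {n : ℕ} (f : Finset (Fin (n + 1)) → B) : hi (-f) = -hi f := rfl

theorem lo_smul {n : ℕ} {R M : Type} [SMul R M] (r : R) (f : Finset (Fin (n + 1)) → M) :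
    lo (r • f) = r • lo f := rfl

theorem hi_smul {n : ℕ} {R M : Type} [SMul R M] (r : R) (f : Finset (Fin (n + 1)) → M) :
    hi (r • f) = r • hi f := rfl

theorem lo_kosSgn {n : ℕ} (f : Finset (Fin (n + 1)) → B) :
    lo (kosSgn B (n + 1) f) = kosSgn B n (lo f) := by
  ext s
  simp [lo, kosSgn_apply]

theorem hi_kosSgn {n : ℕ} (f : Finset (Fin (n + 1)) → B) :
    hi (kosSgn B (n + 1) f) = -kosSgn B n (hi f) := by
  ext s
  have h0 : (0 : Fin (n + 1)) ∉ s.map (Fin.succEmb n) := by simp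
  simp [hi, kosSgn_apply, Finset.card_insert_of_notMem h0, pow_succ]

theorem kosD_kosSgn {n : ℕ} (row : Fin n → KRow B) (f : Finset (Fin n) → B) :
    kosD row (kosSgn B n f) = -kosSgn B n (kosD row f) := by
  induction n with
  | zero => simp [kosD_zero]
  | succ n ih =>
    apply ext_lo_hi
    · rw [lo_kosD, lo_neg, lo_kosSgn, lo_kosSgn, lo_kosD, hi_kosSgn, ih, map_add, map_smul,
        smul_neg]
      abel
    · rw [hi_kosD, hi_neg, hi_kosSgn, hi_kosSgn, hi_kosD, lo_kosSgn, map_neg, ih, map_sub, map_smul]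
      abel

/-- In the square of the block matrix the off-diagonal blocks cancel, and each diagonal block is
`d'² + a₀ a₁`. -/
theorem kosD_kosD {n : ℕ} (row : Fin n → KRow B) (f : Finset (Fin n) → B) :
    kosD row (kosD row f) = (∑ i, (row i).a0 * (row i).a1) • f := by
  induction n with
  | zero => simp [kosD_zero]
  | succ n ih =>
    apply ext_lo_hi
    · rw [lo_kosD, lo_kosD, hi_kosD, map_add, ih, map_smul, Fin.sum_univ_succ, lo_smul, smul_sub,
        add_smul, smul_smul, mul_comm (row 0).a0]
      abel
    · rw [hi_kosD, lo_kosD, hi_kosD, map_sub, ih, map_smul, Fin.sum_univ_succ, hi_smul, smul_add,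
        add_smul, smul_smul]
      abel

theorem kosD_map {A : Type} [CommRing A] (φ : B →+* A) {n : ℕ} (row : Fin n → KRow B)
    (row' : Fin n → KRow A) (h0 : ∀ i, (row' i).a0 = φ (row i).a0)
    (h1 : ∀ i, (row' i).a1 = φ (row i).a1) (f : Finset (Fin n) → B) :
    kosD row' (φ ∘ f) = φ ∘ kosD row f := by
  ext s
  simp only [Function.comp_apply, kosD_apply, map_sum, map_mul, map_pow, map_neg, map_one]
  refine Finset.sum_congr rfl fun i _ => ?_
  split_ifs <;> simp [h0, h1]

theorem kosSgn_map {A : Type} [CommRing A] (φ : B →+* A) {n : ℕ} (f : Finset (Fin n) → B) :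
    kosSgn A n (φ ∘ f) = φ ∘ kosSgn B n f := by
  ext s
  simp [kosSgn_apply]

/-- The homogeneous components of a Koszul matrix factorization. -/
def kosHomog (N : ℕ) (gr : ℤ × ℤ → AddSubgroup B) {n : ℕ} (row : Fin n → KRow B) (ε : ZMod 2)
    (d : ℤ × ℤ) : AddSubgroup (Finset (Fin n) → B) :=
  ⨅ s : Finset (Fin n),
    (if ((s.card : ℕ) : ZMod 2) = ε then
        gr (d - ∑ i ∈ s, ((1, (N : ℤ) + 1) - (row i).deg0)) else ⊥).comap
      (Pi.evalAddMonoidHom (fun _ : Finset (Fin n) => B) s)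

theorem mem_kosHomog {N : ℕ} {gr : ℤ × ℤ → AddSubgroup B} {n : ℕ} {row : Fin n → KRow B}
    {ε : ZMod 2} {d : ℤ × ℤ} {f : Finset (Fin n) → B} :
    f ∈ kosHomog N gr row ε d ↔ ∀ s : Finset (Fin n),
      f s ∈ (if ((s.card : ℕ) : ZMod 2) = ε then
        gr (d - ∑ i ∈ s, ((1, (N : ℤ) + 1) - (row i).deg0)) else ⊥ : AddSubgroup B) := by
  rw [kosHomog, AddSubgroup.mem_iInf]
  rfl

theorem mem_kosHomog_lo_hi {N : ℕ} {gr : ℤ × ℤ → AddSubgroup B} {n : ℕ}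
    {row : Fin (n + 1) → KRow B} {ε : ZMod 2} {d : ℤ × ℤ} {f : Finset (Fin (n + 1)) → B} :
    f ∈ kosHomog N gr row ε d ↔
      lo f ∈ kosHomog N gr (fun i => row i.succ) ε d ∧
      hi f ∈ kosHomog N gr (fun i => row i.succ) (ε + 1)
        (d - ((1, (N : ℤ) + 1) - (row 0).deg0)) := by
  have hz : ∀ c ε : ZMod 2, c + 1 = ε ↔ c = ε + 1 := by decide
  have key : ∀ s : Finset (Fin n), ((((insert 0 (s.map (Fin.succEmb n))).card : ℕ) : ZMod 2) = ε ↔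
      ((s.card : ℕ) : ZMod 2) = ε + 1) := by
    intro s
    rw [Finset.card_insert_of_notMem (by simp), Finset.card_map, Nat.cast_succ]
    exact hz _ _
  have key2 : ∀ s : Finset (Fin n), d - ∑ i ∈ insert 0 (s.map (Fin.succEmb n)),
      ((1, (N : ℤ) + 1) - (row i).deg0) = d - ((1, (N : ℤ) + 1) - (row 0).deg0) -
        ∑ i ∈ s, ((1, (N : ℤ) + 1) - (row i.succ).deg0) := by
    intro s
    rw [Finset.sum_insert (by simp), Finset.sum_map, ← sub_sub]
    rfl
  simp only [mem_kosHomog]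
  constructor
  · intro h
    refine ⟨fun s => ?_, fun s => ?_⟩
    · have := h (s.map (Fin.succEmb n))
      rw [Finset.card_map, Finset.sum_map] at this
      exact this
    · have := h (insert 0 (s.map (Fin.succEmb n)))
      rw [key2] at this
      simp only [key] at this
      exact this
  · rintro ⟨h0, h1⟩ t
    obtain ⟨s, rfl | rfl⟩ := eq_map_or_insert t
    · rw [Finset.card_map, Finset.sum_map]
      exact h0 s
    · rw [key2]
      simp only [key]
      exact h1 s

theorem smul_mem_kosHomog {N : ℕ} {gr : ℤ × ℤ → AddSubgroup B} (hgr : IsGr gr) {n : ℕ}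
    {row : Fin n → KRow B} {ε : ZMod 2} {d e : ℤ × ℤ} {f : Finset (Fin n) → B} {r : B}
    (hr : r ∈ gr e) (hf : f ∈ kosHomog N gr row ε d) : r • f ∈ kosHomog N gr row ε (e + d) := by
  rw [mem_kosHomog] at *
  intro s
  have := hf s
  split_ifs with h
  · rw [if_pos h] at this
    exact mem_congr (hgr.mul hr this) (by abel)
  · rw [if_neg h] at this
    rw [AddSubgroup.mem_bot] at *
    rw [Pi.smul_apply, this, smul_zero]

/-- The entries of the rows are homogeneous of the appropriate bidegrees. -/
def IsRow (N : ℕ) (gr : ℤ × ℤ → AddSubgroup B) (row : KRow B) : Prop :=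
  row.a0 ∈ gr row.deg0 ∧ row.a1 ∈ gr ((2, 2 * (N : ℤ) + 2) - row.deg0)

/-- The differential has half the bidegree `(2, 2N + 2)` of the potential. The shift of the odd
generators is chosen so that both entries of a row contribute this same degree. -/
theorem kosD_mem_kosHomog {N : ℕ} {gr : ℤ × ℤ → AddSubgroup B} (hgr : IsGr gr) {n : ℕ}
    {row : Fin n → KRow B} (hrow : ∀ i, IsRow N gr (row i)) {ε : ZMod 2} {d : ℤ × ℤ}
    {f : Finset (Fin n) → B} (hf : f ∈ kosHomog N gr row ε d) :
    kosD row f ∈ kosHomog N gr row (ε + 1) (d + (1, (N : ℤ) + 1)) := by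
  induction n generalizing ε d with
  | zero => rw [kosD_zero]; exact zero_mem _
  | succ n ih =>
    rw [mem_kosHomog_lo_hi] at *
    obtain ⟨h0, h1⟩ := hf
    rw [lo_kosD, hi_kosD]
    have hz : ε + 1 + 1 = ε := by clear h0 h1; revert ε; decide
    have e1 : (2, 2 * (N : ℤ) + 2) = ((1, (N : ℤ) + 1) : ℤ × ℤ) + (1, (N : ℤ) + 1) := by
      ext <;> simp; ring
    refine ⟨add_mem (ih (fun i => hrow i.succ) h0) ?_, sub_mem ?_ ?_⟩
    · convert smul_mem_kosHomog hgr (hrow 0).2 h1 using 2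
      rw [e1]
      abel
    · rw [hz]
      convert smul_mem_kosHomog hgr (hrow 0).1 h0 using 2
      abel
    · convert ih (fun i => hrow i.succ) h1 using 2
      abel

end Koszul

/-! ### Contractions -/

/-- A strong deformation retraction of matrix factorizations. -/
structure Contraction {R : Type} [CommRing R] (C K : GradedMF R) where
  p : C.carrier →ₗ[R] K.carrier
  i : K.carrier →ₗ[R] C.carrier
  h : C.carrier →ₗ[R] C.carrier
  p_hom : GradedMF.IsHomogMorphism C K 0 p
  i_hom : GradedMF.IsHomogMorphism K C 0 i
  p_i : ∀ x, p (i x) = x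
  h_sgn : ∀ x, h (C.sgn x) = -C.sgn (h x)
  homotopy : ∀ x, x - i (p x) = C.d (h x) + h (C.d x)

namespace Contraction

variable {R : Type} [CommRing R] {C K L : GradedMF R}

theorem p_d (c : Contraction C K) (x : C.carrier) : c.p (C.d x) = K.d (c.p x) :=
  LinearMap.congr_fun c.p_hom.comm x

theorem i_d (c : Contraction C K) (x : K.carrier) : c.i (K.d x) = C.d (c.i x) :=
  LinearMap.congr_fun c.i_hom.comm x

theorem p_sgn (c : Contraction C K) (x : C.carrier) : c.p (C.sgn x) = K.sgn (c.p x) :=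
  LinearMap.congr_fun c.p_hom.sgn x

theorem i_sgn (c : Contraction C K) (x : K.carrier) : c.i (K.sgn x) = C.sgn (c.i x) :=
  LinearMap.congr_fun c.i_hom.sgn x

end Contraction

theorem GradedMF.IsHomogMorphism.comp {R : Type} [CommRing R] {C K L : GradedMF R} {δ δ' : ℤ × ℤ}
    {g : K.carrier →ₗ[R] L.carrier} {f : C.carrier →ₗ[R] K.carrier}
    (hg : GradedMF.IsHomogMorphism K L δ' g) (hf : GradedMF.IsHomogMorphism C K δ f) :
    GradedMF.IsHomogMorphism C L (δ + δ') (g ∘ₗ f) where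
  comm := by rw [LinearMap.comp_assoc, hf.comm, ← LinearMap.comp_assoc, hg.comm,
    LinearMap.comp_assoc]
  sgn := by rw [LinearMap.comp_assoc, hf.sgn, ← LinearMap.comp_assoc, hg.sgn,
    LinearMap.comp_assoc]
  degree ε d x hx := by
    rw [← add_assoc]
    exact hg.degree _ _ _ (hf.degree _ _ _ hx)

namespace Contraction

variable {R : Type} [CommRing R] {C K L : GradedMF R}

/-- Composition of contractions. -/
def trans (c : Contraction C K) (c' : Contraction K L) : Contraction C L where
  p := c'.p ∘ₗ c.p
  i := c.i ∘ₗ c'.i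
  h := c.h + c.i ∘ₗ c'.h ∘ₗ c.p
  p_hom := by simpa using c'.p_hom.comp c.p_hom
  i_hom := by simpa using c.i_hom.comp c'.i_hom
  p_i x := by simp [c.p_i, c'.p_i]
  h_sgn x := by
    simp only [LinearMap.add_apply, LinearMap.comp_apply, c.p_sgn, c'.h_sgn, map_neg, c.i_sgn,
      c.h_sgn, map_add]
    abel
  homotopy x := by
    have h1 := c.homotopy x
    have h2 := congrArg c.i (c'.homotopy (c.p x))
    simp only [map_sub, map_add, c.i_d] at h2
    simp only [LinearMap.add_apply, LinearMap.comp_apply, map_add, c.p_d]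
    rw [add_add_add_comm, ← h1, ← h2]
    abel

/-- Contractions are compatible with shifts. -/
def shift (c : Contraction C K) (q r : ℤ) : Contraction (C.shift q r) (K.shift q r) where
  p := c.p
  i := c.i
  h := c.h
  p_hom := ⟨c.p_hom.comm, c.p_hom.sgn, fun ε d x hx => by
    have := c.p_hom.degree ε (d - (q, r)) x hx
    rw [add_zero] at *
    exact this⟩
  i_hom := ⟨c.i_hom.comm, c.i_hom.sgn, fun ε d x hx => by
    have := c.i_hom.degree ε (d - (q, r)) x hx
    rw [add_zero] at *
    exact this⟩
  p_i := c.p_i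
  h_sgn := c.h_sgn
  homotopy := c.homotopy

end Contraction

/-! ### Excluding a variable from a Koszul matrix factorization -/

section Exclusion

variable {R A B : Type} [CommRing R] [CommRing A] [CommRing B] [Algebra R A] [Algebra R B]

/-- Data for the exclusion of a variable: `B` is a polynomial ring over `A`, and `u` is a monic
linear polynomial with `B / u = A`. -/
structure Excl (R : Type) {A B : Type} [CommRing R] [CommRing A] [CommRing B] [Algebra R A]
    [Algebra R B] (grA : ℤ × ℤ → AddSubgroup A) (grB : ℤ × ℤ → AddSubgroup B) (δ : ℤ × ℤ) where
  π : B →ₐ[R] A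
  σ : A →ₐ[R] B
  u : B
  isGr : IsGr grB
  π_mem : ∀ {d b}, b ∈ grB d → π b ∈ grA d
  σ_mem : ∀ {d a}, a ∈ grA d → σ a ∈ grB d
  π_σ : ∀ a, π (σ a) = a
  π_u : π u = 0
  cancel : ∀ {b c}, u * b = u * c → b = c
  exists_div : ∀ b, ∃ c, u * c = b - σ (π b)
  exists_div_mem : ∀ {d b}, b ∈ grB d → ∃ c ∈ grB (d - δ), u * c = b - σ (π b)

namespace Excl

variable {grA : ℤ × ℤ → AddSubgroup A} {grB : ℤ × ℤ → AddSubgroup B} {δ : ℤ × ℤ}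

/-- The quotient of the division by `u`. -/
def q (e : Excl R grA grB δ) : B →ₗ[R] B where
  toFun b := (e.exists_div b).choose
  map_add' b c := by
    apply e.cancel
    rw [mul_add, (e.exists_div _).choose_spec, (e.exists_div _).choose_spec,
      (e.exists_div _).choose_spec, map_add, map_add]
    ring
  map_smul' r b := by
    apply e.cancel
    rw [RingHom.id_apply, mul_smul_comm, (e.exists_div _).choose_spec,
      (e.exists_div _).choose_spec, map_smul, map_smul, smul_sub]

theorem u_q (e : Excl R grA grB δ) (b : B) : e.u * e.q b = b - e.σ (e.π b) :=
  (e.exists_div b).choose_spec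

theorem q_mem (e : Excl R grA grB δ) {d : ℤ × ℤ} {b : B} (hb : b ∈ grB d) :
    e.q b ∈ grB (d - δ) := by
  obtain ⟨c, hc, h⟩ := e.exists_div_mem hb
  have : e.q b = c := e.cancel (by rw [h, u_q])
  rwa [this]

theorem q_u (e : Excl R grA grB δ) (b : B) : e.q (e.u * b) = b := by
  apply e.cancel
  rw [u_q, map_mul, e.π_u]
  simp

end Excl

theorem comp_mem_kosHomog {N : ℕ} {grA : ℤ × ℤ → AddSubgroup A} {grB : ℤ × ℤ → AddSubgroup B}
    {n : ℕ} {rowA : Fin n → KRow A} {rowB : Fin n → KRow B}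
    (hdeg : ∀ i, (rowA i).deg0 = (rowB i).deg0) (φ : B →+ A) {δ : ℤ × ℤ}
    (hφ : ∀ {d b}, b ∈ grB d → φ b ∈ grA (d - δ))
    {ε : ZMod 2} {d : ℤ × ℤ} {f : Finset (Fin n) → B} (hf : f ∈ kosHomog N grB rowB ε d) :
    (φ ∘ f) ∈ kosHomog N grA rowA ε (d - δ) := by
  rw [mem_kosHomog] at *
  intro s
  have := hf s
  split_ifs with h
  · rw [if_pos h] at this
    refine mem_congr (hφ this) ?_
    simp only [hdeg]
    abel
  · rw [if_neg h] at this
    rw [AddSubgroup.mem_bot] at *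
    rw [Function.comp_apply, this, map_zero]

section

variable (N : ℕ) {grA : ℤ × ℤ → AddSubgroup A} {grB : ℤ × ℤ → AddSubgroup B} {δ : ℤ × ℤ}
    (e : Excl R grA grB δ) {n : ℕ} (row : Fin (n + 1) → KRow B)

/-- The projection of the exclusion of a variable. -/
def exclP (n : ℕ) : (Finset (Fin (n + 1)) → B) →ₗ[R] (Finset (Fin n) → A) where
  toFun f := e.π ∘ lo f
  map_add' f g := by ext s; simp [lo]
  map_smul' r f := by ext s; simp [lo]

/-- The inclusion of the exclusion of a variable. -/
def exclI : (Finset (Fin n) → A) →ₗ[R] (Finset (Fin (n + 1)) → B) where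
  -- The second component is forced. Compatibility with the differentials in the `lo` block reads
  -- `d' (σ m) + u * hi = σ (d m)`, and `q` performs the division by `u`.
  toFun m := mk (e.σ ∘ m) (-(e.q ∘ kosD (fun i => row i.succ) (e.σ ∘ m)))
  map_add' f g := by
    have : e.σ ∘ (f + g) = e.σ ∘ f + e.σ ∘ g := by ext s; simp
    apply ext_lo_hi
    · rw [lo_add, lo_mk, lo_mk, lo_mk, this]
    · rw [hi_add, hi_mk, hi_mk, hi_mk, this, map_add]
      ext s
      simp
      abel
  map_smul' r f := by
    have : e.σ ∘ (r • f) = r • (e.σ ∘ f) := by ext s; simp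
    have h2 : kosD (fun i => row i.succ) (r • (e.σ ∘ f)) =
        r • kosD (fun i => row i.succ) (e.σ ∘ f) :=
      ((kosD fun i => row i.succ).restrictScalars R).map_smul r _
    apply ext_lo_hi
    · rw [RingHom.id_apply, lo_smul, lo_mk, lo_mk, this]
    · rw [RingHom.id_apply, hi_smul, hi_mk, hi_mk, this, h2]
      ext s
      simp

/-- The homotopy of the exclusion of a variable. -/
def exclH (n : ℕ) : (Finset (Fin (n + 1)) → B) →ₗ[R] (Finset (Fin (n + 1)) → B) where
  toFun f := mk 0 (e.q ∘ lo f)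
  map_add' f g := by
    apply ext_lo_hi
    · rw [lo_mk, lo_add, lo_mk, lo_mk, add_zero]
    · rw [hi_mk, hi_add, hi_mk, hi_mk]
      ext s
      simp [lo]
  map_smul' r f := by
    apply ext_lo_hi
    · rw [RingHom.id_apply, lo_mk, lo_smul, lo_mk, smul_zero]
    · rw [RingHom.id_apply, hi_mk, hi_smul, hi_mk]
      ext s
      simp [lo]

variable {row}

theorem exclP_kosD {row' : Fin n → KRow A} (hu : (row 0).a1 = e.u)
    (h0 : ∀ i, (row' i).a0 = e.π (row i.succ).a0) (h1 : ∀ i, (row' i).a1 = e.π (row i.succ).a1)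
    (f : Finset (Fin (n + 1)) → B) : exclP e n (kosD row f) = kosD row' (exclP e n f) := by
  change e.π ∘ lo (kosD row f) = kosD row' (e.π ∘ lo f)
  rw [lo_kosD, hu]
  refine Eq.trans ?_ (kosD_map (e.π : B →+* A) (fun i => row i.succ) row' h0 h1 (lo f)).symm
  ext s
  simp [e.π_u]

theorem exclP_kosSgn (f : Finset (Fin (n + 1)) → B) :
    exclP e n (kosSgn B _ f) = kosSgn A _ (exclP e n f) := by
  change e.π ∘ lo (kosSgn B _ f) = kosSgn A _ (e.π ∘ lo f)
  rw [lo_kosSgn]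
  exact (kosSgn_map (e.π : B →+* A) (lo f)).symm

theorem exclP_mem {row' : Fin n → KRow A} (hdeg : ∀ i, (row' i).deg0 = (row i.succ).deg0)
    {ε : ZMod 2} {d : ℤ × ℤ} {f : Finset (Fin (n + 1)) → B} (hf : f ∈ kosHomog N grB row ε d) :
    exclP e n f ∈ kosHomog N grA row' ε d := by
  have h3 := comp_mem_kosHomog (grA := grA) (rowA := row') hdeg
    ((e.π : B →+* A) : B →+ A) (δ := 0)
    (fun {d b} hb => by rw [sub_zero]; exact e.π_mem hb) (mem_kosHomog_lo_hi.1 hf).1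
  rw [sub_zero] at h3
  exact h3

theorem u_smul_q {row' : Fin n → KRow A}
    (h0 : ∀ i, (row' i).a0 = e.π (row i.succ).a0) (h1 : ∀ i, (row' i).a1 = e.π (row i.succ).a1)
    (m : Finset (Fin n) → A) : (e.u) • (e.q ∘ kosD (fun i => row i.succ) (e.σ ∘ m)) =
      kosD (fun i => row i.succ) (e.σ ∘ m) - e.σ ∘ kosD row' m := by
  have h2 : kosD row' m = e.π ∘ kosD (fun i => row i.succ) (e.σ ∘ m) := by
    refine Eq.trans ?_ (kosD_map (e.π : B →+* A) (fun i => row i.succ) row' h0 h1 (e.σ ∘ m))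
    congr 1
    ext s
    simp [e.π_σ]
  rw [h2]
  ext s
  simp [e.u_q]

/-- The `lo` block holds by the choice of the second component. The `hi` block is checked after
multiplication by `u`: both squared differentials are given by the potential, which comes from the
base ring `R` by `hw` and therefore commutes with `σ`. -/
theorem exclI_kosD {row' : Fin n → KRow A} (hu : (row 0).a1 = e.u)
    (h0 : ∀ i, (row' i).a0 = e.π (row i.succ).a0) (h1 : ∀ i, (row' i).a1 = e.π (row i.succ).a1)
    {w : R} (hw : ∑ i, (row i).a0 * (row i).a1 = algebraMap R B w) (m : Finset (Fin n) → A) :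
    exclI e row (kosD row' m) = kosD row (exclI e row m) := by
  change mk (e.σ ∘ kosD row' m) (-(e.q ∘ kosD (fun i => row i.succ) (e.σ ∘ kosD row' m))) =
    kosD row (mk (e.σ ∘ m) (-(e.q ∘ kosD (fun i => row i.succ) (e.σ ∘ m))))
  apply ext_lo_hi
  · rw [lo_kosD, lo_mk, lo_mk, hi_mk, hu, smul_neg, u_smul_q e h0 h1]
    abel
  · rw [hi_kosD, lo_mk, hi_mk, hi_mk]
    ext s
    apply e.cancel
    have h2 := congrFun (u_smul_q e h0 h1 (kosD row' m)) s
    have h3 : kosD row' (kosD row' m) = w • m := by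
      rw [kosD_kosD]
      have : ∑ i, (row' i).a0 * (row' i).a1 = algebraMap R A w := by
        have h4 := congrArg e.π hw
        rw [Fin.sum_univ_succ, map_add, map_mul, hu, e.π_u, mul_zero, zero_add, map_sum,
          AlgHom.commutes] at h4
        rw [← h4]
        refine Finset.sum_congr rfl fun i _ => ?_
        rw [h0, h1, map_mul]
      rw [this]
      ext s
      simp [Algebra.smul_def]
    have h4 := kosD_kosD (fun i => row i.succ) (e.σ ∘ m)
    have h5 := congrArg (kosD (fun i => row i.succ)) (u_smul_q e h0 h1 m)
    rw [map_smul, map_sub, h4] at h5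
    have h6 := congrFun h5 s
    rw [h3] at h2
    have h7 : (∑ i : Fin n, (row i.succ).a0 * (row i.succ).a1) =
        algebraMap R B w - (row 0).a0 * e.u := by
      rw [← hw, Fin.sum_univ_succ, hu]; ring
    rw [h7] at h6
    have h8 : e.σ (w • m s) = algebraMap R B w * e.σ (m s) := by
      rw [map_smul, Algebra.smul_def]
    simp only [Pi.smul_apply, Pi.neg_apply, Pi.sub_apply, smul_eq_mul, Function.comp_apply,
      map_neg, h8] at h2 h6 ⊢
    linear_combination -h2 - h6

theorem q_comp_kosSgn (f : Finset (Fin n) → B) : e.q ∘ kosSgn B n f = kosSgn B n (e.q ∘ f) := by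
  ext s
  simp only [Function.comp_apply, kosSgn_apply]
  rcases neg_one_pow_eq_or B s.card with h | h <;> simp [h]

theorem exclI_kosSgn (m : Finset (Fin n) → A) :
    exclI e row (kosSgn A n m) = kosSgn B (n + 1) (exclI e row m) := by
  change mk (e.σ ∘ kosSgn A n m) (-(e.q ∘ kosD (fun i => row i.succ) (e.σ ∘ kosSgn A n m))) =
    kosSgn B (n + 1) (mk (e.σ ∘ m) (-(e.q ∘ kosD (fun i => row i.succ) (e.σ ∘ m))))
  have h2 : e.σ ∘ kosSgn A n m = kosSgn B n (e.σ ∘ m) :=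
    (kosSgn_map (e.σ : A →+* B) m).symm
  apply ext_lo_hi
  · rw [lo_mk, lo_kosSgn, lo_mk, h2]
  · rw [hi_mk, hi_kosSgn, hi_mk, h2, kosD_kosSgn, map_neg, neg_neg, ← q_comp_kosSgn]
    ext s
    simp

theorem exclI_mem {row' : Fin n → KRow A} (hδ : δ = (2, 2 * (N : ℤ) + 2) - (row 0).deg0)
    (hrow : ∀ i, IsRow N grB (row i)) (hdeg : ∀ i, (row' i).deg0 = (row i.succ).deg0)
    {ε : ZMod 2} {d : ℤ × ℤ} {m : Finset (Fin n) → A} (hm : m ∈ kosHomog N grA row' ε d) :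
    exclI e row m ∈ kosHomog N grB row ε d := by
  have h3 := comp_mem_kosHomog (grA := grB) (rowA := fun i => row i.succ)
    (fun i => (hdeg i).symm) ((e.σ : A →+* B) : A →+ B) (δ := 0)
    (fun {d b} hb => by rw [sub_zero]; exact e.σ_mem hb) hm
  rw [sub_zero] at h3
  refine mem_kosHomog_lo_hi.2 ⟨?_, ?_⟩
  · change lo (mk _ _) ∈ _
    rw [lo_mk]
    exact h3
  · change hi (mk _ _) ∈ _
    rw [hi_mk]
    refine neg_mem ?_
    have h4 := kosD_mem_kosHomog e.isGr (fun i => hrow i.succ) h3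
    have h5 := comp_mem_kosHomog (grA := grB) (rowA := fun i => row i.succ)
      (fun i => rfl) (e.q : B →+ B) (fun {d b} hb => e.q_mem hb) h4
    have e1 : d + (1, (N : ℤ) + 1) - δ = d - ((1, (N : ℤ) + 1) - (row 0).deg0) := by
      rw [hδ]
      ext <;> simp <;> ring
    rw [← e1]
    exact h5

theorem exclH_kosSgn (f : Finset (Fin (n + 1)) → B) :
    exclH e n (kosSgn B _ f) = -kosSgn B _ (exclH e n f) := by
  change mk 0 (e.q ∘ lo (kosSgn B _ f)) = -kosSgn B _ (mk 0 (e.q ∘ lo f))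
  apply ext_lo_hi
  · rw [lo_mk, lo_neg, lo_kosSgn, lo_mk, map_zero, neg_zero]
  · rw [hi_mk, hi_neg, hi_kosSgn, hi_mk, lo_kosSgn, q_comp_kosSgn, neg_neg]

/-- The `lo` block is the division identity `u * q b = b - σ (π b)`; the `hi` block uses `q (u * b)
= b`. -/
theorem exclH_homotopy (hu : (row 0).a1 = e.u) (f : Finset (Fin (n + 1)) → B) :
    f - exclI e row (exclP e n f) = kosD row (exclH e n f) + exclH e n (kosD row f) := by
  change f - mk (e.σ ∘ (e.π ∘ lo f)) (-(e.q ∘ kosD (fun i => row i.succ) (e.σ ∘ (e.π ∘ lo f)))) =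
    kosD row (mk 0 (e.q ∘ lo f)) + mk 0 (e.q ∘ lo (kosD row f))
  have key : e.u • (e.q ∘ lo f) = lo f - e.σ ∘ (e.π ∘ lo f) := by
    ext s
    simp [e.u_q]
  apply ext_lo_hi
  · rw [lo_sub, lo_mk, lo_add, lo_kosD, lo_mk, hi_mk, lo_mk, hu, key]
    simp
  · rw [hi_sub, hi_mk, hi_add, hi_kosD, lo_mk, hi_mk, hi_mk, lo_kosD, hu]
    have h2 : e.σ ∘ (e.π ∘ lo f) = lo f - e.u • (e.q ∘ lo f) := by rw [key]; abel
    rw [h2, map_sub, map_smul]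
    ext s
    simp [e.q_u]
    abel

/-- Exclusion of a variable from a Koszul matrix factorization. -/
def exclude (row : Fin (n + 1) → KRow B) (row' : Fin n → KRow A)
    (hu : (row 0).a1 = e.u) (hδ : δ = (2, 2 * (N : ℤ) + 2) - (row 0).deg0)
    (hrow : ∀ i, IsRow N grB (row i))
    (h0 : ∀ i, (row' i).a0 = e.π (row i.succ).a0) (h1 : ∀ i, (row' i).a1 = e.π (row i.succ).a1)
    (hdeg : ∀ i, (row' i).deg0 = (row i.succ).deg0)
    (w : R) (hw : ∑ i, (row i).a0 * (row i).a1 = algebraMap R B w) :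
    Contraction (koszul R N grB row) (koszul R N grA row') where
  p := exclP e n
  i := exclI e row
  h := exclH e n
  p_hom := ⟨LinearMap.ext (exclP_kosD e hu h0 h1), LinearMap.ext (exclP_kosSgn e),
    fun ε d f hf => by rw [add_zero]; exact exclP_mem N e hdeg hf⟩
  i_hom := ⟨LinearMap.ext (exclI_kosD e hu h0 h1 hw), LinearMap.ext (exclI_kosSgn e),
    fun ε d f hf => by rw [add_zero]; exact exclI_mem N e hδ hrow hdeg hf⟩
  p_i m := by
    change e.π ∘ lo (mk _ _) = m
    rw [lo_mk]
    funext s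
    exact e.π_σ _
  h_sgn := exclH_kosSgn e
  homotopy := exclH_homotopy e hu

end

end Exclusion

/-! ### Rows of vertices -/

section Rows

variable {A : Type} [CommRing A] {gr : ℤ × ℤ → AddSubgroup A}

theorem hSum_mem (h : IsGr gr) {x y : A} (hx : x ∈ gr (0, 2)) (hy : y ∈ gr (0, 2)) (N : ℕ) :
    hSum N x y ∈ gr (0, 2 * N) := by
  refine sum_mem fun i hi => mem_congr (h.mul (h.pow hx i) (h.pow hy (N - i))) ?_
  have : i ≤ N := by simpa [Nat.lt_succ_iff] using hi
  ext <;> simp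
  push_cast [this]
  ring

theorem pow2_mem (h : IsGr gr) {x y : A} (hx : x ∈ gr (0, 2)) (hy : y ∈ gr (0, 4)) :
    ∀ n : ℕ, pow2 x y n ∈ gr (0, 2 * (n : ℤ))
  | 0 => mem_congr (natCast_mem h 2) (by ext <;> simp)
  | 1 => by simpa [pow2] using hx
  | n + 2 => by
      rw [pow2]
      refine sub_mem (mem_congr (h.mul hx (pow2_mem h hx hy (n + 1))) ?_)
        (mem_congr (h.mul hy (pow2_mem h hx hy n)) ?_) <;> ext <;> simp <;> ring

theorem quot1_mem (h : IsGr gr) {x y z : A} (hx : x ∈ gr (0, 2)) (hy : y ∈ gr (0, 4))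
    (hz : z ∈ gr (0, 2)) : ∀ n : ℕ, quot1 x y z n ∈ gr (0, 2 * (n : ℤ) - 2)
  | 0 => by rw [quot1]; exact zero_mem _
  | 1 => by rw [quot1]; exact mem_congr h.one (by ext <;> simp)
  | n + 2 => by
      rw [quot1]
      refine sub_mem (add_mem (mem_congr (pow2_mem h hx hy (n + 1)) ?_)
        (mem_congr (h.mul hz (quot1_mem h hx hy hz (n + 1))) ?_))
        (mem_congr (h.mul hy (quot1_mem h hx hy hz n)) ?_) <;> ext <;> simp <;> ring

theorem quot2_mem (h : IsGr gr) {x y z : A} (hx : x ∈ gr (0, 4)) (hy : y ∈ gr (0, 2))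
    (hz : z ∈ gr (0, 4)) : ∀ n : ℕ, quot2 x y z n ∈ gr (0, 2 * (n : ℤ) - 4)
  | 0 => by rw [quot2]; exact zero_mem _
  | 1 => by rw [quot2]; exact zero_mem _
  | n + 2 => by
      rw [quot2]
      refine sub_mem (sub_mem (mem_congr (h.mul hy (quot2_mem h hx hy hz (n + 1))) ?_)
        (mem_congr (pow2_mem h hy hx n) ?_))
        (mem_congr (h.mul hz (quot2_mem h hx hy hz n)) ?_) <;> ext <;> simp <;> ring

variable {B : Type} [CommRing B]

theorem map_hSum (φ : A →+* B) (N : ℕ) (x y : A) : φ (hSum N x y) = hSum N (φ x) (φ y) := by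
  simp [hSum]

theorem map_pow2 (φ : A →+* B) (x y : A) : ∀ n : ℕ, φ (pow2 x y n) = pow2 (φ x) (φ y) n
  | 0 => map_ofNat φ 2
  | 1 => by simp [pow2]
  | n + 2 => by simp [pow2, map_pow2 φ x y (n + 1), map_pow2 φ x y n]

theorem map_quot1 (φ : A →+* B) (x y z : A) :
    ∀ n : ℕ, φ (quot1 x y z n) = quot1 (φ x) (φ y) (φ z) n
  | 0 => by simp [quot1]
  | 1 => by simp [quot1]
  | n + 2 => by
      simp [quot1, map_quot1 φ x y z (n + 1), map_quot1 φ x y z n, map_pow2]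

theorem map_quot2 (φ : A →+* B) (x y z : A) :
    ∀ n : ℕ, φ (quot2 x y z n) = quot2 (φ x) (φ y) (φ z) n
  | 0 => by simp [quot2]
  | 1 => by simp [quot2]
  | n + 2 => by
      simp [quot2, map_quot2 φ x y z (n + 1), map_quot2 φ x y z n, map_pow2]

/-- The image of a row under a ring homomorphism. -/
def mapRow (φ : A →+* B) (r : KRow A) : KRow B := ⟨φ r.a0, φ r.a1, r.deg0⟩

theorem mapRow_vertexRows (φ : A →+* B) (N : ℕ) (a X₁ X₂ Y₁ Y₂ : A) (i : Fin 2) :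
    mapRow φ (vertexRows N a X₁ X₂ Y₁ Y₂ i) =
      vertexRows N (φ a) (φ X₁) (φ X₂) (φ Y₁) (φ Y₂) i := by
  fin_cases i
  · simp [mapRow, vertexRows, map_quot1]
  · simp [mapRow, vertexRows, map_quot2]

theorem isRow_arcRow (h : IsGr gr) {a x y : A} (ha : a ∈ gr (2, 0)) (hx : x ∈ gr (0, 2))
    (hy : y ∈ gr (0, 2)) (N : ℕ) : IsRow N gr (arcRow N a x y) := by
  refine ⟨mem_congr (h.mul ha (hSum_mem h hx hy N)) ?_, mem_congr (sub_mem hx hy) ?_⟩ <;>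
    ext <;> simp [arcRow]

theorem isRow_vertexRows (h : IsGr gr) {a X₁ X₂ Y₁ Y₂ : A} (ha : a ∈ gr (2, 0))
    (hX₁ : X₁ ∈ gr (0, 2)) (hX₂ : X₂ ∈ gr (0, 4)) (hY₁ : Y₁ ∈ gr (0, 2)) (hY₂ : Y₂ ∈ gr (0, 4))
    (N : ℕ) (i : Fin 2) : IsRow N gr (vertexRows N a X₁ X₂ Y₁ Y₂ i) := by
  fin_cases i
  · refine ⟨mem_congr (h.mul ha (quot1_mem h hX₁ hX₂ hY₁ (N + 1))) ?_,
      mem_congr (sub_mem hX₁ hY₁) ?_⟩ <;> ext <;> simp [vertexRows]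
    ring
  · refine ⟨mem_congr (h.mul ha (quot2_mem h hX₂ hY₁ hY₂ (N + 1))) ?_,
      mem_congr (sub_mem hX₂ hY₂) ?_⟩ <;> ext <;> simp [vertexRows]
    ring

theorem sum_vertexRows (N : ℕ) (a X₁ X₂ Y₁ Y₂ : A) :
    ∑ i, (vertexRows N a X₁ X₂ Y₁ Y₂ i).a0 * (vertexRows N a X₁ X₂ Y₁ Y₂ i).a1 =
      a * (pow2 X₁ X₂ (N + 1) - pow2 Y₁ Y₂ (N + 1)) := by
  rw [Fin.sum_univ_two]
  simp only [vertexRows, Matrix.cons_val_zero, Matrix.cons_val_one]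
  linear_combination a * quot1_spec X₁ X₂ Y₁ (N + 1) + a * quot2_spec X₂ Y₁ Y₂ (N + 1)

end Rows

/-! ### Removing the wide edge -/

/-- The polynomial ring in the second elementary symmetric polynomial of the alphabet of the wide
edge. -/
abbrev MidRing : Type := MvPolynomial (Fin 1) BdryRing

/-- The bigrading of `MidRing`. -/
def midGr : ℤ × ℤ → AddSubgroup MidRing := polyGr (markGr (Fin 4)) fun _ => (0, 4)

theorem wideGr_isGr : IsGr (A := WideRing) wideGr := polyGr_isGr (markGr_isGr _)

theorem bv_mem (i : Fin 4) : bv i ∈ markGr (Fin 4) (0, 2) := X_mem_markGr i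

theorem bv_add_mem (i j : Fin 4) : bv i + bv j ∈ markGr (Fin 4) (0, 2) :=
  add_mem (bv_mem i) (bv_mem j)

theorem bv_mul_mem (i j : Fin 4) : bv i * bv j ∈ markGr (Fin 4) (0, 4) :=
  mem_congr ((markGr_isGr _).mul (bv_mem i) (bv_mem j)) (by ext <;> simp)

/-- A specialization sending `u` to `1` certifies that `u` is nonzero. -/
theorem mul_left_cancel_of_map_eq_one {A B : Type} [CommRing A] [IsDomain A] [CommRing B]
    [Nontrivial B] {u : A} (φ : A →+* B) (h : φ u = 1) {b c : A} (hbc : u * b = u * c) : b = c := by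
  refine mul_left_cancel₀ ?_ hbc
  rintro rfl
  rw [map_zero] at h
  exact zero_ne_one h

/-! ### Division by `c - X` in polynomial rings in one or two variables -/

section Variables

variable {R : Type} [CommRing R] [IsDomain R] {gr : ℤ × ℤ → AddSubgroup R}

/-- Substitution of `c` for the first variable. -/
def subst1 (c : R) : MvPolynomial (Fin 2) R →ₐ[R] MvPolynomial (Fin 1) R :=
  MvPolynomial.aeval ![MvPolynomial.C c, MvPolynomial.X 0]

/-- The inclusion of the polynomials in the second variable. -/
def incl1 (R : Type) [CommRing R] : MvPolynomial (Fin 1) R →ₐ[R] MvPolynomial (Fin 2) R :=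
  MvPolynomial.aeval fun _ => MvPolynomial.X 1

/-- Exclusion of the first of two variables. -/
def exclFirst (hg : IsGr gr) {δ δ' : ℤ × ℤ} {c : R} (hc : c ∈ gr δ) :
    Excl R (polyGr (σ := Fin 1) gr fun _ => δ') (polyGr (σ := Fin 2) gr ![δ, δ']) δ where
  π := subst1 c
  σ := incl1 R
  u := MvPolynomial.C c - MvPolynomial.X 0
  isGr := polyGr_isGr hg
  π_mem {d b} hb := by
    refine map_mem_of_mem_polyGr hg (polyGr_isGr hg) (subst1 c).toRingHom ?_ ?_ hb
    · intro d r hr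
      simpa [subst1] using C_mem_polyGr hr
    · intro i
      fin_cases i
      · simpa [subst1] using C_mem_polyGr hc
      · simpa [subst1] using (X_mem_polyGr hg 0 : (MvPolynomial.X 0 : MvPolynomial (Fin 1) R) ∈
          polyGr gr (fun _ => δ') δ')
  σ_mem {d a} ha := by
    refine map_mem_of_mem_polyGr hg (polyGr_isGr hg) (incl1 R).toRingHom ?_ ?_ ha
    · intro d r hr
      simpa [incl1] using C_mem_polyGr hr
    · intro i
      simpa [incl1] using (X_mem_polyGr hg 1 : (MvPolynomial.X 1 : MvPolynomial (Fin 2) R) ∈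
          polyGr gr ![δ, δ'] δ')
  π_σ a := by
    have : (subst1 c).comp (incl1 R) = AlgHom.id R _ := by
      apply MvPolynomial.algHom_ext
      intro i
      simp [Fin.fin_one_eq_zero i, subst1, incl1]
    exact DFunLike.congr_fun this a
  π_u := by simp [subst1]
  -- At `X₀ = c - 1` the polynomial `c - X₀` takes the value `1`.
  cancel := mul_left_cancel_of_map_eq_one
    (MvPolynomial.aeval ![c - 1, 0] : MvPolynomial (Fin 2) R →ₐ[R] R).toRingHom (by simp)
  exists_div := exists_mul_eq_sub ((incl1 R).comp (subst1 c)).toRingHom _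
    (by intro r; simp [incl1, subst1]) (by
      intro i
      fin_cases i
      · exact ⟨-1, by simp [incl1, subst1]⟩
      · exact ⟨0, by simp [incl1, subst1]⟩)
  exists_div_mem := exists_mul_eq_sub_of_mem hg ((incl1 R).comp (subst1 c)).toRingHom _ _
    (by intro r; simp [incl1, subst1]) (by
      intro i
      fin_cases i
      · simpa [incl1, subst1] using C_mem_polyGr hc
      · simpa [incl1, subst1] using (X_mem_polyGr hg 1 :
          (MvPolynomial.X 1 : MvPolynomial (Fin 2) R) ∈ polyGr gr ![δ, δ'] δ'))
    (by
      intro i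
      fin_cases i
      · exact ⟨-1, neg_mem (mem_congr (polyGr_isGr hg).one (by simp)), by simp [incl1, subst1]⟩
      · exact ⟨0, zero_mem _, by simp [incl1, subst1]⟩)

/-- Exclusion of the only variable. -/
def exclOnly (hg : IsGr gr) {δ : ℤ × ℤ} {c : R} (hc : c ∈ gr δ) :
    Excl R gr (polyGr (σ := Fin 1) gr fun _ => δ) δ where
  π := MvPolynomial.aeval fun _ => c
  σ := Algebra.ofId R _
  u := MvPolynomial.C c - MvPolynomial.X 0
  isGr := polyGr_isGr hg
  π_mem {d b} hb := by
    refine map_mem_of_mem_polyGr hg hg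
      (MvPolynomial.aeval fun _ => c : MvPolynomial (Fin 1) R →ₐ[R] R).toRingHom ?_ ?_ hb
    · intro d r hr
      simpa using hr
    · intro i
      simpa using hc
  σ_mem {d a} ha := C_mem_polyGr ha
  π_σ a := by simp [Algebra.ofId_apply]
  π_u := by simp
  cancel := mul_left_cancel_of_map_eq_one
    (MvPolynomial.aeval fun _ => c - 1 : MvPolynomial (Fin 1) R →ₐ[R] R).toRingHom (by simp)
  exists_div := exists_mul_eq_sub ((Algebra.ofId R (MvPolynomial (Fin 1) R)).comp
      (MvPolynomial.aeval fun _ => c)).toRingHom _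
    (by intro r; simp) (by
      intro i
      exact ⟨-1, by simp [Algebra.ofId_apply, Fin.fin_one_eq_zero i]⟩)
  exists_div_mem := exists_mul_eq_sub_of_mem hg ((Algebra.ofId R (MvPolynomial (Fin 1) R)).comp
      (MvPolynomial.aeval fun _ => c)).toRingHom _ _
    (by intro r; simp) (by
      intro i
      simpa [Algebra.ofId_apply] using C_mem_polyGr hc)
    (by
      intro i
      exact ⟨-1, neg_mem (mem_congr (polyGr_isGr hg).one (by simp)),
        by simp [Algebra.ofId_apply, Fin.fin_one_eq_zero i]⟩)

end Variables

/-- Exclusion of `W₁`. -/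
def exclW1 : Excl (A := MidRing) (B := WideRing) BdryRing midGr wideGr (0, 2) :=
  exclFirst (markGr_isGr _) (bv_add_mem 0 1)

/-- Exclusion of `W₂`. -/
def exclW2 : Excl (A := BdryRing) (B := MidRing) BdryRing (markGr (Fin 4)) midGr (0, 4) :=
  exclOnly (markGr_isGr _) (bv_mul_mem 0 1)

theorem exclW1_u : exclW1.u = wv 0 + wv 1 - MvPolynomial.X 0 := by
  rw [wv, wv, ← map_add]
  rfl

theorem exclW1_π_C (r : BdryRing) : exclW1.π (MvPolynomial.C r) = MvPolynomial.C r :=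
  exclW1.π.commutes r

theorem exclW1_π_X0 : exclW1.π (MvPolynomial.X 0) = MvPolynomial.C (bv 0 + bv 1) :=
  MvPolynomial.aeval_X _ _

theorem exclW1_π_X1 : exclW1.π (MvPolynomial.X 1) = MvPolynomial.X 0 :=
  MvPolynomial.aeval_X _ _

theorem exclW2_u : exclW2.u = MvPolynomial.C (bv 0 * bv 1) - MvPolynomial.X 0 := rfl

theorem exclW2_π_C (r : BdryRing) : exclW2.π (MvPolynomial.C r) = r :=
  exclW2.π.commutes r

theorem exclW2_π_X : exclW2.π (MvPolynomial.X 0) = bv 0 * bv 1 :=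
  MvPolynomial.aeval_X _ _

/-- The rows of the small model of the resolution with a wide edge. -/
def smallRows (N : ℕ) : Fin 2 → KRow BdryRing :=
  vertexRows N (aElt _) (bv 0 + bv 1) (bv 0 * bv 1) (bv 2 + bv 3) (bv 2 * bv 3)

/-- The small model of the resolution with a wide edge, without the variables of the wide edge. -/
def smallRes1 (N : ℕ) : GradedMF BdryRing :=
  (koszul BdryRing N (markGr (Fin 4)) (smallRows N)).shift 0 (-1)

/-- The rows of the resolution with a wide edge. -/
def wideRows (N : ℕ) : Fin (3 + 1) → KRow WideRing :=
  Fin.append (m := 2) (n := 2)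
      (vertexRows N (MvPolynomial.C (aElt _)) (wv 0 + wv 1) (wv 0 * wv 1)
        (MvPolynomial.X 0) (MvPolynomial.X 1))
      (vertexRows N (MvPolynomial.C (aElt _)) (MvPolynomial.X 0) (MvPolynomial.X 1)
        (wv 2 + wv 3) (wv 2 * wv 3))

/-- The rows of the resolution with a wide edge after the exclusion of `W₁`. -/
def midRows (N : ℕ) (i : Fin (2 + 1)) : KRow MidRing :=
  mapRow (exclW1.π : WideRing →+* MidRing) (wideRows N i.succ)

theorem wv_mem (i : Fin 4) : wv i ∈ wideGr (0, 2) := C_mem_polyGr (bv_mem i)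

theorem wideX0_mem : (MvPolynomial.X 0 : WideRing) ∈ wideGr (0, 2) :=
  X_mem_polyGr (w := ![(0, 2), (0, 4)]) (markGr_isGr _) 0

theorem wideX1_mem : (MvPolynomial.X 1 : WideRing) ∈ wideGr (0, 4) :=
  X_mem_polyGr (w := ![(0, 2), (0, 4)]) (markGr_isGr _) 1

theorem wide_a_mem : (MvPolynomial.C (aElt _) : WideRing) ∈ wideGr (2, 0) :=
  C_mem_polyGr (aElt_mem_markGr _)

theorem wv_add_mem (i j : Fin 4) : wv i + wv j ∈ wideGr (0, 2) := add_mem (wv_mem i) (wv_mem j)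

theorem wv_mul_mem (i j : Fin 4) : wv i * wv j ∈ wideGr (0, 4) := by
  rw [wv, wv, ← map_mul]
  exact C_mem_polyGr (bv_mul_mem i j)

theorem isRow_wideRows (N : ℕ) (i : Fin 4) : IsRow N wideGr (wideRows N i) := by
  refine Fin.addCases (m := 2) (n := 2) (fun j => ?_) (fun j => ?_) i
  · rw [wideRows, Fin.append_left]
    exact isRow_vertexRows wideGr_isGr wide_a_mem (wv_add_mem _ _) (wv_mul_mem _ _) wideX0_mem
      wideX1_mem N j
  · rw [wideRows, Fin.append_right]
    exact isRow_vertexRows wideGr_isGr wide_a_mem wideX0_mem wideX1_mem (wv_add_mem _ _)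
      (wv_mul_mem _ _) N j

/-- The potential of a crossing. -/
def crossingPotential (N : ℕ) : BdryRing :=
  aElt _ * (pow2 (bv 0 + bv 1) (bv 0 * bv 1) (N + 1) - pow2 (bv 2 + bv 3) (bv 2 * bv 3) (N + 1))

theorem wideRows_zero (N : ℕ) : wideRows N 0 =
    ⟨MvPolynomial.C (aElt _) * quot1 (wv 0 + wv 1) (wv 0 * wv 1) (MvPolynomial.X 0) (N + 1),
      wv 0 + wv 1 - MvPolynomial.X 0, (2, 2 * N)⟩ :=
  (Fin.append_left (m := 2) (n := 2) _ _ 0).trans rfl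

theorem wideRows_one (N : ℕ) : wideRows N 1 =
    ⟨MvPolynomial.C (aElt _) * quot2 (wv 0 * wv 1) (MvPolynomial.X 0) (MvPolynomial.X 1) (N + 1),
      wv 0 * wv 1 - MvPolynomial.X 1, (2, 2 * N - 2)⟩ :=
  (Fin.append_left (m := 2) (n := 2) _ _ 1).trans rfl

theorem wideRows_succ_succ (N : ℕ) (i : Fin 2) : wideRows N i.succ.succ =
    vertexRows N (MvPolynomial.C (aElt _)) (MvPolynomial.X 0) (MvPolynomial.X 1) (wv 2 + wv 3)
      (wv 2 * wv 3) i := by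
  have h : i.succ.succ = Fin.natAdd 2 i := by
    ext
    simp
  rw [h]
  exact Fin.append_right (m := 2) (n := 2) _ _ i

/-- The power sum in `W₁, W₂` enters the two vertices with opposite signs and cancels. The potential
therefore comes from the boundary ring, which is what excluding `W₁` and `W₂` requires. -/
theorem sum_wideRows (N : ℕ) :
    ∑ i, (wideRows N i).a0 * (wideRows N i).a1 = algebraMap BdryRing WideRing
      (crossingPotential N) := by
  have h := Fin.sum_univ_add (a := 2) (b := 2) fun i => (wideRows N i).a0 * (wideRows N i).a1
  refine h.trans ?_
  simp only [wideRows, Fin.append_left, Fin.append_right]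
  have hp : ∀ x y : BdryRing, algebraMap BdryRing WideRing (pow2 x y (N + 1)) =
      pow2 (algebraMap BdryRing WideRing x) (algebraMap BdryRing WideRing y) (N + 1) :=
    fun x y => map_pow2 (A := BdryRing) (B := WideRing) _ x y _
  rw [sum_vertexRows, sum_vertexRows, crossingPotential, map_mul, map_sub, hp, hp]
  simp only [map_add, map_mul, wv, MvPolynomial.algebraMap_eq]
  ring

/-- The row used for the exclusion drops out because its second entry is `u`, which `π` kills. -/
theorem sum_midRows (N : ℕ) :
    ∑ i, (midRows N i).a0 * (midRows N i).a1 = algebraMap BdryRing MidRing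
      (crossingPotential N) := by
  have h := congrArg exclW1.π (sum_wideRows N)
  rw [Fin.sum_univ_succ, map_add, map_mul, AlgHom.commutes, map_sum] at h
  have h0 : exclW1.π (wideRows N 0).a1 = 0 := by
    rw [wideRows_zero, ← exclW1_u, exclW1.π_u]
  rw [h0, mul_zero, zero_add] at h
  rw [← h]
  refine Finset.sum_congr rfl fun i _ => ?_
  rw [map_mul]
  rfl

theorem smallRows_eq (N : ℕ) (i : Fin 2) :
    smallRows N i = mapRow (exclW2.π : MidRing →+* BdryRing) (midRows N i.succ) := by
  rw [midRows, wideRows_succ_succ, mapRow_vertexRows, mapRow_vertexRows, smallRows]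
  simp only [wv, RingHom.coe_coe, map_add, map_mul, exclW1_π_C, exclW1_π_X0, exclW1_π_X1,
    exclW2_π_C, exclW2_π_X]

/-- The resolution with a wide edge contracts to its small model. -/
def contractionRes1 (N : ℕ) : Contraction (resolution1 N) (smallRes1 N) :=
  Contraction.shift
    ((exclude N exclW1 (wideRows N) (midRows N)
      (by rw [wideRows_zero, exclW1_u])
      (by rw [wideRows_zero]; ext <;> simp)
      (isRow_wideRows N) (fun _ => rfl) (fun _ => rfl) (fun _ => rfl) _ (sum_wideRows N)).trans
    (exclude N exclW2 (midRows N) (smallRows N)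
      (by
        change exclW1.π (wideRows N 1).a1 = _
        rw [wideRows_one, exclW2_u, wv, wv, map_sub, map_mul, exclW1_π_C, exclW1_π_C, exclW1_π_X1,
          map_mul])
      (by
        change _ = _ - (wideRows N 1).deg0
        rw [wideRows_one]
        ext <;> simp)
      (fun i => ⟨exclW1.π_mem (isRow_wideRows N i.succ).1,
        exclW1.π_mem (isRow_wideRows N i.succ).2⟩)
      (fun i => by rw [smallRows_eq]; rfl) (fun i => by rw [smallRows_eq]; rfl)
      (fun i => by rw [smallRows_eq]; rfl) _ (sum_midRows N))) 0 (-1)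

/-! ### Koszul matrix factorizations with two rows -/

section Vec

variable {A : Type}

/-- The element of a Koszul matrix factorization with two rows with given components. -/
def vec (p q r t : A) (s : Finset (Fin 2)) : A :=
  if 0 ∈ s then (if 1 ∈ s then t else q) else (if 1 ∈ s then r else p)

theorem vec_empty (p q r t : A) : vec p q r t ∅ = p := by simp [vec]

theorem vec_zero (p q r t : A) : vec p q r t {0} = q := by simp [vec]

theorem vec_one (p q r t : A) : vec p q r t {1} = r := by simp [vec]

theorem vec_univ (p q r t : A) : vec p q r t {0, 1} = t := by simp [vec]

theorem finset_two_cases (s : Finset (Fin 2)) : s = ∅ ∨ s = {0} ∨ s = {1} ∨ s = {0, 1} := by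
  revert s
  decide

theorem eq_vec (f : Finset (Fin 2) → A) : f = vec (f ∅) (f {0}) (f {1}) (f {0, 1}) := by
  ext s
  rcases finset_two_cases s with rfl | rfl | rfl | rfl <;> simp [vec]

theorem vec_inj {p q r t p' q' r' t' : A} (h : vec p q r t = vec p' q' r' t') :
    p = p' ∧ q = q' ∧ r = r' ∧ t = t' := by
  have h1 := congrFun h ∅
  have h2 := congrFun h {0}
  have h3 := congrFun h {1}
  have h4 := congrFun h {0, 1}
  simp only [vec_empty, vec_zero, vec_one, vec_univ] at h1 h2 h3 h4
  exact ⟨h1, h2, h3, h4⟩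

end Vec

section TwoRows

variable {A : Type} [CommRing A]

theorem vec_add (p q r t p' q' r' t' : A) :
    vec p q r t + vec p' q' r' t' = vec (p + p') (q + q') (r + r') (t + t') := by
  rw [eq_vec (vec p q r t + vec p' q' r' t')]
  simp [vec]

theorem vec_sub (p q r t p' q' r' t' : A) :
    vec p q r t - vec p' q' r' t' = vec (p - p') (q - q') (r - r') (t - t') := by
  rw [eq_vec (vec p q r t - vec p' q' r' t')]
  simp [vec]

theorem smul_vec (c p q r t : A) : c • vec p q r t = vec (c * p) (c * q) (c * r) (c * t) := by
  rw [eq_vec (c • vec p q r t)]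
  simp [vec]

theorem kosD_vec (row : Fin 2 → KRow A) (p q r t : A) : kosD row (vec p q r t) =
    vec ((row 0).a1 * q + (row 1).a1 * r) ((row 0).a0 * p - (row 1).a1 * t)
      ((row 1).a0 * p + (row 0).a1 * t) ((row 0).a0 * r - (row 1).a0 * q) := by
  have h01 : ({0, 1} : Finset (Fin 2)).erase 0 = {1} := by decide
  have h10 : ({0, 1} : Finset (Fin 2)).erase 1 = {0} := by decide
  have e01 : (insert 0 {1} : Finset (Fin 2)) = {0, 1} := by decide
  have e10 : (insert 1 {0} : Finset (Fin 2)) = {0, 1} := by decide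
  have f0 : (({0} : Finset (Fin 2)).filter fun j => j < 0) = ∅ := by decide
  have f1 : (({0} : Finset (Fin 2)).filter fun j => j < 1) = {0} := by decide
  have g0 : (({1} : Finset (Fin 2)).filter fun j => j < 0) = ∅ := by decide
  have g1 : (({1} : Finset (Fin 2)).filter fun j => j < 1) = ∅ := by decide
  have k0 : (({0, 1} : Finset (Fin 2)).filter fun j => j < 0) = ∅ := by decide
  have k1 : (({0, 1} : Finset (Fin 2)).filter fun j => j < 1) = {0} := by decide
  rw [eq_vec (kosD row (vec p q r t))]
  congr 1 <;> rw [kosD_apply, Fin.sum_univ_two]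
  · simp [vec]
  · rw [f0, f1]
    simp [vec]
    ring
  · rw [g0, g1]
    simp [vec]
    ring
  · rw [k0, k1, h01, h10]
    simp [vec]
    ring

theorem kosSgn_vec (p q r t : A) : kosSgn A 2 (vec p q r t) = vec p (-q) (-r) t := by
  rw [eq_vec (kosSgn A 2 (vec p q r t))]
  congr 1 <;> rw [kosSgn_apply] <;> simp [vec]

theorem vec_mem_zero {N : ℕ} {gr : ℤ × ℤ → AddSubgroup A} {row : Fin 2 → KRow A} {d : ℤ × ℤ}
    {p q r t : A} : vec p q r t ∈ kosHomog N gr row 0 d ↔ p ∈ gr d ∧ q = 0 ∧ r = 0 ∧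
      t ∈ gr (d - (((1, (N : ℤ) + 1) - (row 0).deg0) + ((1, (N : ℤ) + 1) - (row 1).deg0))) := by
  have h2 : ((2 : ℕ) : ZMod 2) = 0 := by decide
  rw [mem_kosHomog]
  constructor
  · intro h
    have h1 := h ∅
    have h2 := h {0}
    have h3 := h {1}
    have h4 := h {0, 1}
    rw [vec_empty] at h1
    rw [vec_zero] at h2
    rw [vec_one] at h3
    rw [vec_univ, Finset.card_pair (by decide), if_pos (by decide),
      Finset.sum_pair (by decide)] at h4
    simp only [Finset.card_empty, Nat.cast_zero, if_true, Finset.sum_empty, sub_zero] at h1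
    rw [Finset.card_singleton, if_neg (by decide)] at h2 h3
    exact ⟨h1, h2, h3, h4⟩
  · rintro ⟨h1, rfl, rfl, h4⟩ s
    rcases finset_two_cases s with rfl | rfl | rfl | rfl
    · simpa [vec_empty] using h1
    · simp [vec_zero]
    · simp [vec_one]
    · rw [vec_univ, Finset.card_pair (by decide), if_pos (by decide), Finset.sum_pair (by decide)]
      exact h4

theorem vec_mem_one {N : ℕ} {gr : ℤ × ℤ → AddSubgroup A} {row : Fin 2 → KRow A} {d : ℤ × ℤ}
    {p q r t : A} : vec p q r t ∈ kosHomog N gr row 1 d ↔ p = 0 ∧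
      q ∈ gr (d - ((1, (N : ℤ) + 1) - (row 0).deg0)) ∧
      r ∈ gr (d - ((1, (N : ℤ) + 1) - (row 1).deg0)) ∧ t = 0 := by
  rw [mem_kosHomog]
  constructor
  · intro h
    have h1 := h ∅
    have h2 := h {0}
    have h3 := h {1}
    have h4 := h {0, 1}
    rw [vec_empty, Finset.card_empty, if_neg (by decide)] at h1
    rw [vec_zero, Finset.card_singleton, if_pos (by decide), Finset.sum_singleton] at h2
    rw [vec_one, Finset.card_singleton, if_pos (by decide), Finset.sum_singleton] at h3
    rw [vec_univ, Finset.card_pair (by decide), if_neg (by decide)] at h4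
    exact ⟨h1, h2, h3, h4⟩
  · rintro ⟨rfl, h2, h3, rfl⟩ s
    rcases finset_two_cases s with rfl | rfl | rfl | rfl
    · simp [vec_empty]
    · rw [vec_zero, Finset.card_singleton, if_pos (by decide), Finset.sum_singleton]
      exact h2
    · rw [vec_one, Finset.card_singleton, if_pos (by decide), Finset.sum_singleton]
      exact h3
    · simp [vec_univ]

/-- The linear map with given even and odd blocks. -/
def blockMap (e f : Fin 2 → Fin 2 → A) : (Finset (Fin 2) → A) →ₗ[A] (Finset (Fin 2) → A) where
  toFun v := vec (e 0 0 * v ∅ + e 0 1 * v {0, 1}) (f 0 0 * v {0} + f 0 1 * v {1})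
    (f 1 0 * v {0} + f 1 1 * v {1}) (e 1 0 * v ∅ + e 1 1 * v {0, 1})
  map_add' v w := by
    rw [vec_add]
    simp only [Pi.add_apply]
    congr 1 <;> ring
  map_smul' c v := by
    rw [RingHom.id_apply, smul_vec]
    simp only [Pi.smul_apply, smul_eq_mul]
    congr 1 <;> ring

theorem blockMap_vec (e f : Fin 2 → Fin 2 → A) (p q r t : A) : blockMap e f (vec p q r t) =
    vec (e 0 0 * p + e 0 1 * t) (f 0 0 * q + f 0 1 * r) (f 1 0 * q + f 1 1 * r)
      (e 1 0 * p + e 1 1 * t) := by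
  change vec _ _ _ _ = _
  simp only [vec_empty, vec_zero, vec_one, vec_univ]

theorem blockMap_kosSgn (e f : Fin 2 → Fin 2 → A) (v : Finset (Fin 2) → A) :
    blockMap e f (kosSgn A 2 v) = kosSgn A 2 (blockMap e f v) := by
  rw [eq_vec v, kosSgn_vec, blockMap_vec, blockMap_vec, kosSgn_vec]
  congr 1 <;> ring

/-- The Koszul model of `χ⁰`. -/
def chiModel0 (x₁ x₂ k : A) : (Finset (Fin 2) → A) →ₗ[A] (Finset (Fin 2) → A) :=
  blockMap ![![x₂ - x₁, 0], ![k, -1]] ![![-x₁, x₂], ![1, -1]]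

/-- The Koszul model of `χ¹`. -/
def chiModel1 (x₁ x₂ k : A) : (Finset (Fin 2) → A) →ₗ[A] (Finset (Fin 2) → A) :=
  blockMap ![![1, 0], ![k, x₁ - x₂]] ![![1, x₂], ![1, x₁]]

theorem chiModel0_vec (x₁ x₂ k p q r t : A) : chiModel0 x₁ x₂ k (vec p q r t) =
    vec ((x₂ - x₁) * p) (-x₁ * q + x₂ * r) (q - r) (k * p - t) := by
  rw [chiModel0, blockMap_vec]
  simp [sub_eq_add_neg]

theorem chiModel1_vec (x₁ x₂ k p q r t : A) : chiModel1 x₁ x₂ k (vec p q r t) =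
    vec p (q + x₂ * r) (q + x₁ * r) (k * p + (x₁ - x₂) * t) := by
  rw [chiModel1, blockMap_vec]
  simp

/-- On odd parts `χ¹` is the matrix `(1, x₂; 1, x₁)` and `χ⁰` is minus its adjugate, so both
products are `x₂ - x₁`. On even parts the lower left entry `k` cancels in the products. -/
theorem chiModel1_chiModel0 (x₁ x₂ k : A) (v : Finset (Fin 2) → A) :
    chiModel1 x₁ x₂ k (chiModel0 x₁ x₂ k v) = (x₂ - x₁) • v := by
  rw [eq_vec v, chiModel0_vec, chiModel1_vec, smul_vec]
  congr 1 <;> ring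

theorem chiModel0_chiModel1 (x₁ x₂ k : A) (v : Finset (Fin 2) → A) :
    chiModel0 x₁ x₂ k (chiModel1 x₁ x₂ k v) = (x₂ - x₁) • v := by
  rw [eq_vec v, chiModel1_vec, chiModel0_vec, smul_vec]
  congr 1 <;> ring

/-- By `h0` and `h1` the second entries are related by the matrix `(1, 1; x₂, x₁)`. The first
entries satisfy the dual relation only up to the errors in `ht` and `hs`, which are multiples of the
second entries with the common factor `k`; this factor is what the even block has to absorb. -/
theorem chiModel0_kosD {rowP rowQ : Fin 2 → KRow A} {x₁ x₂ k : A}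
    (h0 : (rowQ 0).a1 = (rowP 0).a1 + (rowP 1).a1)
    (h1 : (rowQ 1).a1 = x₂ * (rowP 0).a1 + x₁ * (rowP 1).a1)
    (ht : (rowP 1).a1 * k = (rowP 0).a0 - (rowQ 0).a0 - x₂ * (rowQ 1).a0)
    (hs : (rowP 0).a1 * k = (rowQ 0).a0 + x₁ * (rowQ 1).a0 - (rowP 1).a0)
    (v : Finset (Fin 2) → A) :
    chiModel0 x₁ x₂ k (kosD rowP v) = kosD rowQ (chiModel0 x₁ x₂ k v) := by
  rw [eq_vec v, kosD_vec, chiModel0_vec, chiModel0_vec, kosD_vec, h0, h1]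
  congr 1
  · ring
  · linear_combination (v ∅) * (x₁ * ht + x₂ * hs)
  · linear_combination -(v ∅) * (ht + hs)
  · linear_combination (v {0}) * hs + (v {1}) * ht

theorem chiModel1_kosD {rowP rowQ : Fin 2 → KRow A} {x₁ x₂ k : A}
    (h0 : (rowQ 0).a1 = (rowP 0).a1 + (rowP 1).a1)
    (h1 : (rowQ 1).a1 = x₂ * (rowP 0).a1 + x₁ * (rowP 1).a1)
    (ht : (rowP 1).a1 * k = (rowP 0).a0 - (rowQ 0).a0 - x₂ * (rowQ 1).a0)
    (hs : (rowP 0).a1 * k = (rowQ 0).a0 + x₁ * (rowQ 1).a0 - (rowP 1).a0)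
    (v : Finset (Fin 2) → A) :
    chiModel1 x₁ x₂ k (kosD rowQ v) = kosD rowP (chiModel1 x₁ x₂ k v) := by
  rw [eq_vec v, kosD_vec, chiModel1_vec, chiModel1_vec, kosD_vec, h0, h1]
  congr 1
  · ring
  · linear_combination (v ∅) * ht
  · linear_combination -(v ∅) * hs
  · linear_combination (v {0}) * (hs + ht) + (v {1}) * (x₂ * hs + x₁ * ht)

end TwoRows

/-! ### Existence of the `χ`-morphisms -/

theorem GradedMF.Homotopic.symm {S : Type} [CommRing S] {P Q : GradedMF S}
    {f g : P.carrier →ₗ[S] Q.carrier} (h : GradedMF.Homotopic P Q f g) :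
    GradedMF.Homotopic P Q g f := by
  obtain ⟨h, h1, h2⟩ := h
  refine ⟨-h, by rw [LinearMap.neg_comp, h1, LinearMap.comp_neg], ?_⟩
  rw [← neg_sub, h2, LinearMap.comp_neg, LinearMap.neg_comp, neg_add]

theorem GradedMF.Homotopic.trans {S : Type} [CommRing S] {P Q : GradedMF S}
    {f g k : P.carrier →ₗ[S] Q.carrier} (h : GradedMF.Homotopic P Q f g)
    (h' : GradedMF.Homotopic P Q g k) : GradedMF.Homotopic P Q f k := by
  obtain ⟨h, h1, h2⟩ := h
  obtain ⟨h', h1', h2'⟩ := h'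
  refine ⟨h + h', ?_, ?_⟩
  · rw [LinearMap.add_comp, h1, h1', LinearMap.comp_add, neg_add]
  · rw [← sub_add_sub_cancel, h2, h2', LinearMap.comp_add, LinearMap.add_comp]
    abel

theorem GradedMF.Homotopic.comp_left {S : Type} [CommRing S] {P Q L : GradedMF S}
    {f g : P.carrier →ₗ[S] Q.carrier} (h : GradedMF.Homotopic P Q f g) {δ : ℤ × ℤ}
    {k : Q.carrier →ₗ[S] L.carrier} (hk : GradedMF.IsHomogMorphism Q L δ k) :
    GradedMF.Homotopic P L (k ∘ₗ f) (k ∘ₗ g) := by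
  obtain ⟨h, h1, h2⟩ := h
  refine ⟨k ∘ₗ h, ?_, ?_⟩
  · rw [LinearMap.comp_assoc, h1, LinearMap.comp_neg, ← LinearMap.comp_assoc, hk.sgn,
      LinearMap.comp_assoc]
  · rw [← LinearMap.comp_sub, h2, LinearMap.comp_add, ← LinearMap.comp_assoc, hk.comm,
      LinearMap.comp_assoc, LinearMap.comp_assoc]

theorem GradedMF.Homotopic.comp_right {S : Type} [CommRing S] {P Q L : GradedMF S}
    {f g : P.carrier →ₗ[S] Q.carrier} (h : GradedMF.Homotopic P Q f g) {δ : ℤ × ℤ}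
    {k : L.carrier →ₗ[S] P.carrier} (hk : GradedMF.IsHomogMorphism L P δ k) :
    GradedMF.Homotopic L Q (f ∘ₗ k) (g ∘ₗ k) := by
  obtain ⟨h, h1, h2⟩ := h
  refine ⟨h ∘ₗ k, ?_, ?_⟩
  · rw [LinearMap.comp_assoc, hk.sgn, ← LinearMap.comp_assoc, h1, LinearMap.neg_comp,
      LinearMap.comp_assoc]
  · rw [← LinearMap.sub_comp, h2, LinearMap.add_comp, LinearMap.comp_assoc, LinearMap.comp_assoc,
      LinearMap.comp_assoc, hk.comm]

/-- If multiplication by `s` on `P` is not null-homotopic, then morphisms whose compositions are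
homotopic to this multiplication are homotopically non-trivial. -/
def MorphismPair.ofNontrivial {S : Type} [CommRing S] {P Q : GradedMF S} {s : S}
    (hs : ¬ GradedMF.Homotopic P P (s • LinearMap.id) 0)
    {χ₀ : P.carrier →ₗ[S] Q.carrier} {χ₁ : Q.carrier →ₗ[S] P.carrier}
    (h₀ : GradedMF.IsHomogMorphism P Q (0, 1) χ₀) (h₁ : GradedMF.IsHomogMorphism Q P (0, 1) χ₁)
    (h10 : GradedMF.Homotopic P P (χ₁ ∘ₗ χ₀) (s • LinearMap.id))
    (h01 : GradedMF.Homotopic Q Q (χ₀ ∘ₗ χ₁) (s • LinearMap.id)) : MorphismPair P Q s where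
  chi0 := χ₀
  chi1 := χ₁
  morphism0 := h₀
  morphism1 := h₁
  nontrivial0 h := by
    have := h.comp_left h₁
    rw [LinearMap.comp_zero] at this
    exact hs (h10.symm.trans this)
  nontrivial1 h := by
    have := h.comp_right h₀
    rw [LinearMap.zero_comp] at this
    exact hs (h10.symm.trans this)
  comp10 := h10
  comp01 := h01

theorem GradedMF.Homotopic.of_eq {S : Type} [CommRing S] {P Q : GradedMF S}
    {f g : P.carrier →ₗ[S] Q.carrier} (h : f = g) : GradedMF.Homotopic P Q f g :=
  ⟨0, by simp, by simp [h]⟩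

/-- Extension of a pair of morphisms along a contraction. -/
def MorphismPair.ofContraction {S : Type} [CommRing S] {P Q K : GradedMF S} {s : S}
    (c : Contraction Q K) (hs : ¬ GradedMF.Homotopic P P (s • LinearMap.id) 0)
    {χ₀ : P.carrier →ₗ[S] K.carrier} {χ₁ : K.carrier →ₗ[S] P.carrier}
    (h₀ : GradedMF.IsHomogMorphism P K (0, 1) χ₀) (h₁ : GradedMF.IsHomogMorphism K P (0, 1) χ₁)
    (h10 : χ₁ ∘ₗ χ₀ = s • LinearMap.id) (h01 : χ₀ ∘ₗ χ₁ = s • LinearMap.id) :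
    MorphismPair P Q s :=
  MorphismPair.ofNontrivial hs (χ₀ := c.i ∘ₗ χ₀) (χ₁ := χ₁ ∘ₗ c.p)
    (by simpa using c.i_hom.comp h₀) (by simpa using h₁.comp c.p_hom)
    (GradedMF.Homotopic.of_eq (by
      rw [← h10]
      ext x
      simp [c.p_i]))
    (by
      have h : GradedMF.Homotopic Q Q (s • (c.i ∘ₗ c.p)) (s • LinearMap.id) := by
        refine ⟨-(s • c.h), ?_, ?_⟩
        · ext x
          simp [c.h_sgn]
        · ext x
          have := c.homotopy x
          simp only [LinearMap.sub_apply, LinearMap.smul_apply, LinearMap.comp_apply,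
            LinearMap.id_apply, LinearMap.add_apply, LinearMap.neg_apply, map_neg, map_smul]
          rw [← neg_add, ← smul_add, ← this, ← smul_sub, ← smul_neg, neg_sub]
      have e : (c.i ∘ₗ χ₀) ∘ₗ (χ₁ ∘ₗ c.p) = s • (c.i ∘ₗ c.p) := by
        ext x
        have := LinearMap.congr_fun h01 (c.p x)
        simp only [LinearMap.comp_apply, LinearMap.smul_apply, LinearMap.id_apply] at this ⊢
        rw [this, map_smul]
      rw [e]
      exact h)

/-- The rows of the resolution with two arcs. -/
def arcRows (N : ℕ) : Fin 2 → KRow BdryRing :=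
  ![arcRow N (aElt _) (bv 0) (bv 3), arcRow N (aElt _) (bv 1) (bv 2)]

/-- At a point where `a`, `x₁ - y₂` and `y₁ - x₂` vanish the differential is zero, so every
null-homotopic map vanishes there. The points with `x₁ ≠ x₂` among these exclude multiplication by
`x₂ - x₁`. -/
theorem resolution0_not_homotopic (N : ℕ) : ¬ GradedMF.Homotopic (resolution0 N) (resolution0 N)
    ((bv 2 - bv 0 : BdryRing) • LinearMap.id) 0 := by
  rintro ⟨h, -, h2⟩
  obtain ⟨h, rfl⟩ : ∃ h' : (Finset (Fin 2) → BdryRing) →ₗ[BdryRing] (Finset (Fin 2) → BdryRing),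
    h' = h := ⟨h, rfl⟩
  have h3 : ∀ v : Finset (Fin 2) → BdryRing,
      (bv 2 - bv 0) • v - 0 = kosD (arcRows N) (h v) + h (kosD (arcRows N) v) :=
    fun v => LinearMap.congr_fun h2 v
  have h4 := congrFun (h3 (vec 1 0 0 0)) ∅
  rw [eq_vec (h (vec 1 0 0 0)), kosD_vec, kosD_vec] at h4
  -- The differential of the even generator is `a` times a vector, and `a` can be pulled out of the
  -- linear map `h`.
  have h5 : h (vec ((arcRows N 0).a1 * 0 + (arcRows N 1).a1 * 0)
      ((arcRows N 0).a0 * 1 - (arcRows N 1).a1 * 0) ((arcRows N 1).a0 * 1 + (arcRows N 0).a1 * 0)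
      ((arcRows N 0).a0 * 0 - (arcRows N 1).a0 * 0)) =
      aElt (Fin 4) • h (vec 0 (hSum N (bv 0) (bv 3)) (hSum N (bv 1) (bv 2)) 0) := by
    rw [← map_smul, smul_vec]
    simp [arcRows, arcRow]
  rw [h5] at h4
  simp only [Pi.sub_apply, Pi.smul_apply, Pi.add_apply, Pi.zero_apply, vec_empty, smul_eq_mul] at h4
  -- The point `a = 0`, `(x₁, y₁, x₂, y₂) = (0, 1, 1, 0)`, where `x₂ - x₁ = 1`.
  let φ : BdryRing →+* ℚ := MvPolynomial.eval₂Hom (Polynomial.evalRingHom 0) ![0, 1, 1, 0]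
  have hφ : ∀ i, φ (bv i) = ![(0 : ℚ), 1, 1, 0] i := fun i => MvPolynomial.eval₂Hom_X' _ _ i
  have hφa : φ (aElt _) = 0 := by
    rw [aElt]
    refine (MvPolynomial.eval₂Hom_C _ _ _).trans ?_
    simp
  have h6 := congrArg φ h4
  simp only [map_sub, map_mul, map_add, hφ, hφa, arcRows, arcRow, Matrix.cons_val_zero,
    Matrix.cons_val_one, map_one, map_zero] at h6
  simp at h6

theorem isRow_arcRows (N : ℕ) (i : Fin 2) : IsRow N (markGr (Fin 4)) (arcRows N i) := by
  fin_cases i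
  · exact isRow_arcRow (markGr_isGr _) (aElt_mem_markGr _) (bv_mem 0) (bv_mem 3) N
  · exact isRow_arcRow (markGr_isGr _) (aElt_mem_markGr _) (bv_mem 1) (bv_mem 2) N

theorem isRow_smallRows (N : ℕ) (i : Fin 2) : IsRow N (markGr (Fin 4)) (smallRows N i) :=
  isRow_vertexRows (markGr_isGr _) (aElt_mem_markGr _) (bv_add_mem 0 1) (bv_mul_mem 0 1)
    (bv_add_mem 2 3) (bv_mul_mem 2 3) N i

theorem sum_arcRows (N : ℕ) :
    (arcRows N 0).a0 * (arcRows N 0).a1 + (arcRows N 1).a0 * (arcRows N 1).a1 =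
      (smallRows N 0).a0 * (smallRows N 0).a1 + (smallRows N 1).a0 * (smallRows N 1).a1 := by
  have h := sum_vertexRows N (aElt _) (bv 0 + bv 1) (bv 0 * bv 1) (bv 2 + bv 3) (bv 2 * bv 3)
  rw [Fin.sum_univ_two, pow2_spec, pow2_spec] at h
  refine Eq.trans ?_ h.symm
  simp only [arcRows, arcRow, Matrix.cons_val_zero, Matrix.cons_val_one]
  linear_combination (aElt (Fin 4)) *
    (hSum_spec N (bv 0) (bv 3) + hSum_spec N (bv 1) (bv 2))

/-- The substitution of `x₂` for `y₁`. -/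
def substY (V : Type) [DecidableEq V] (i j : V) : MarkRing V →ₐ[ℚ[X]] MarkRing V :=
  MvPolynomial.aeval fun l => if l = i then MvPolynomial.X j else MvPolynomial.X l

theorem substY_X {V : Type} [DecidableEq V] (i j l : V) :
    substY V i j (MvPolynomial.X l) = if l = i then MvPolynomial.X j else MvPolynomial.X l :=
  MvPolynomial.aeval_X _ _

/-- The factor theorem for the root `X i = X j`, with a homogeneous quotient. -/
theorem exists_mul_eq_of_substY {V : Type} [DecidableEq V] {i j : V} {d : ℤ × ℤ} {f : MarkRing V}
    (hf : f ∈ markGr V d) (h : substY V i j f = 0) :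
    ∃ c ∈ markGr V (d - (0, 2)), (MvPolynomial.X i - MvPolynomial.X j) * c = f := by
  have := exists_mul_eq_sub_of_mem baseGr_isGr (substY V i j).toRingHom
    (MvPolynomial.X i - MvPolynomial.X j) (0, 2) (by intro r; simp) (by
      intro l
      change substY V i j (MvPolynomial.X l) ∈ _
      rw [substY_X]
      split_ifs <;> exact X_mem_markGr _) (by
      intro l
      by_cases hl : l = i
      · refine ⟨1, mem_congr (markGr_isGr V).one (by simp), ?_⟩
        subst hl
        simp [substY]
      · exact ⟨0, zero_mem _, by simp [substY, hl]⟩) hf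
  obtain ⟨c, hc, h1⟩ := this
  refine ⟨c, hc, h1.trans ?_⟩
  change f - substY V i j f = f
  rw [h, sub_zero]

theorem bv_sub_ne_zero {i j : Fin 4} (h : i ≠ j) : bv i - bv j ≠ 0 := by
  intro h'
  exact h (MvPolynomial.X_injective (sub_eq_zero.1 h'))

/-- The two resolutions have the same potential. Setting `y₁ = x₂` in this equality and cancelling
`x₁ - y₂` shows that the right-hand side of the first equation vanishes at `y₁ = x₂`, so `k` exists
by the factor theorem. The second equation follows from the first and the equality of potentials
after cancelling `y₁ - x₂`. -/
theorem exists_chiCorrection (N : ℕ) : ∃ k ∈ markGr (Fin 4) (2, 2 * (N : ℤ) - 2),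
    (bv 1 - bv 2) * k = (arcRows N 0).a0 - (smallRows N 0).a0 - bv 2 * (smallRows N 1).a0 ∧
    (bv 0 - bv 3) * k = (smallRows N 0).a0 + bv 0 * (smallRows N 1).a0 - (arcRows N 1).a0 := by
  have hmem : (arcRows N 0).a0 - (smallRows N 0).a0 - bv 2 * (smallRows N 1).a0 ∈
      markGr (Fin 4) (2, 2 * (N : ℤ)) :=
    sub_mem (sub_mem (isRow_arcRows N 0).1 (isRow_smallRows N 0).1)
      (mem_congr ((markGr_isGr _).mul (bv_mem 2) (isRow_smallRows N 1).1)
        (by ext <;> simp [smallRows, vertexRows]))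
  have hpot := sum_arcRows N
  have ea0 : (arcRows N 0).a1 = bv 0 - bv 3 := rfl
  have ea1 : (arcRows N 1).a1 = bv 1 - bv 2 := rfl
  have es0 : (smallRows N 0).a1 = bv 0 + bv 1 - (bv 2 + bv 3) := rfl
  have es1 : (smallRows N 1).a1 = bv 0 * bv 1 - bv 2 * bv 3 := rfl
  rw [ea0, ea1, es0, es1] at hpot
  have hE : substY (Fin 4) 1 2
      ((arcRows N 0).a0 - (smallRows N 0).a0 - bv 2 * (smallRows N 1).a0) = 0 := by
    have b0 : substY (Fin 4) 1 2 (bv 0) = bv 0 := substY_X _ _ _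
    have b1 : substY (Fin 4) 1 2 (bv 1) = bv 2 := substY_X _ _ _
    have b2 : substY (Fin 4) 1 2 (bv 2) = bv 2 := substY_X _ _ _
    have b3 : substY (Fin 4) 1 2 (bv 3) = bv 3 := substY_X _ _ _
    have h := congrArg (substY (Fin 4) 1 2) hpot
    simp only [map_add, map_mul, map_sub, b0, b1, b2, b3] at h ⊢
    apply mul_left_cancel₀ (bv_sub_ne_zero (show (0 : Fin 4) ≠ 3 by decide))
    linear_combination h
  obtain ⟨k, hk, h1⟩ := exists_mul_eq_of_substY hmem hE
  change (bv 1 - bv 2) * k = _ at h1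
  refine ⟨k, mem_congr hk (by ext <;> simp), h1, ?_⟩
  apply mul_left_cancel₀ (bv_sub_ne_zero (show (1 : Fin 4) ≠ 2 by decide))
  linear_combination (bv 0 - bv 3) * h1 + hpot

theorem kosHomog_cases {A : Type} [CommRing A] {N : ℕ} {gr gr' : ℤ × ℤ → AddSubgroup A}
    {row row' : Fin 2 → KRow A} {d d' : ℤ × ℤ}
    {f : (Finset (Fin 2) → A) →ₗ[A] (Finset (Fin 2) → A)}
    (h0 : ∀ p t, vec p 0 0 t ∈ kosHomog N gr row 0 d → f (vec p 0 0 t) ∈ kosHomog N gr' row' 0 d')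
    (h1 : ∀ q r, vec 0 q r 0 ∈ kosHomog N gr row 1 d → f (vec 0 q r 0) ∈ kosHomog N gr' row' 1 d')
    (ε : ZMod 2) (x : Finset (Fin 2) → A) (hx : x ∈ kosHomog N gr row ε d) :
    f x ∈ kosHomog N gr' row' ε d' := by
  have hε : ε = 0 ∨ ε = 1 := by clear hx; revert ε; decide
  rw [eq_vec x] at hx ⊢
  rcases hε with rfl | rfl
  · have := vec_mem_zero.1 hx
    rw [this.2.1, this.2.2.1] at hx ⊢
    exact h0 _ _ hx
  · have := vec_mem_one.1 hx
    rw [this.1, this.2.2.2] at hx ⊢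
    exact h1 _ _ hx

/-! ### Bidegrees of the Koszul models of `χ⁰` and `χ¹` -/

section Degrees

variable {A : Type} [CommRing A] {N : ℕ} {gr : ℤ × ℤ → AddSubgroup A} {rowP rowQ : Fin 2 → KRow A}
  {x₁ x₂ k : A}

/-- Between the unshifted Koszul factorizations this map has `x`-degree `2`; subtracting `(0, -1)`
accounts for the shift of the wide-edge resolution, which leaves degree `1`. -/
theorem chiModel0_mem (hg : IsGr gr) (hx₁ : x₁ ∈ gr (0, 2)) (hx₂ : x₂ ∈ gr (0, 2))
    (hk : k ∈ gr (2, 2 * (N : ℤ) - 2)) (dP0 : (rowP 0).deg0 = (2, 2 * (N : ℤ)))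
    (dP1 : (rowP 1).deg0 = (2, 2 * (N : ℤ))) (dQ0 : (rowQ 0).deg0 = (2, 2 * (N : ℤ)))
    (dQ1 : (rowQ 1).deg0 = (2, 2 * (N : ℤ) - 2)) (ε : ZMod 2) (d : ℤ × ℤ)
    (x : Finset (Fin 2) → A) (hx : x ∈ kosHomog N gr rowP ε d) :
    chiModel0 x₁ x₂ k x ∈ kosHomog N gr rowQ ε (d + (0, 1) - (0, -1)) := by
  refine kosHomog_cases ?_ ?_ ε x hx
  · intro p t h
    rw [vec_mem_zero, dP0, dP1] at h
    rw [chiModel0_vec, vec_mem_zero, dQ0, dQ1]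
    refine ⟨mem_congr (hg.mul (sub_mem hx₂ hx₁) h.1) ?_, by ring, by ring,
      sub_mem (mem_congr (hg.mul hk h.1) ?_) (mem_congr h.2.2.2 ?_)⟩ <;>
      ext <;> simp <;> ring
  · intro q r h
    rw [vec_mem_one, dP0, dP1] at h
    rw [chiModel0_vec, vec_mem_one, dQ0, dQ1]
    refine ⟨by ring, add_mem (mem_congr (hg.mul (neg_mem hx₁) h.2.1) ?_)
      (mem_congr (hg.mul hx₂ h.2.2.1) ?_),
      mem_congr (sub_mem h.2.1 h.2.2.1) ?_, by ring⟩ <;> ext <;> simp <;> ring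

/-- Here the unshifted `x`-degree is `0`, and the shift of the source raises it to `1`. -/
theorem chiModel1_mem (hg : IsGr gr) (hx₁ : x₁ ∈ gr (0, 2)) (hx₂ : x₂ ∈ gr (0, 2))
    (hk : k ∈ gr (2, 2 * (N : ℤ) - 2)) (dP0 : (rowP 0).deg0 = (2, 2 * (N : ℤ)))
    (dP1 : (rowP 1).deg0 = (2, 2 * (N : ℤ))) (dQ0 : (rowQ 0).deg0 = (2, 2 * (N : ℤ)))
    (dQ1 : (rowQ 1).deg0 = (2, 2 * (N : ℤ) - 2)) (ε : ZMod 2) (d : ℤ × ℤ)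
    (x : Finset (Fin 2) → A) (hx : x ∈ kosHomog N gr rowQ ε (d - (0, -1))) :
    chiModel1 x₁ x₂ k x ∈ kosHomog N gr rowP ε (d + (0, 1)) := by
  refine kosHomog_cases ?_ ?_ ε x hx
  · intro p t h
    rw [vec_mem_zero, dQ0, dQ1] at h
    rw [chiModel1_vec, vec_mem_zero, dP0, dP1]
    refine ⟨mem_congr h.1 ?_, by ring, by ring,
      add_mem (mem_congr (hg.mul hk h.1) ?_)
      (mem_congr (hg.mul (sub_mem hx₁ hx₂) h.2.2.2) ?_)⟩ <;>
      ext <;> simp <;> ring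
  · intro q r h
    rw [vec_mem_one, dQ0, dQ1] at h
    rw [chiModel1_vec, vec_mem_one, dP0, dP1]
    refine ⟨by ring, add_mem (mem_congr h.2.1 ?_)
      (mem_congr (hg.mul hx₂ h.2.2.1) ?_), add_mem (mem_congr h.2.1 ?_)
      (mem_congr (hg.mul hx₁ h.2.2.1) ?_), by ring⟩ <;> ext <;> simp <;> ring

end Degrees

theorem smallRows_zero_a1 (N : ℕ) :
    (smallRows N 0).a1 = (arcRows N 0).a1 + (arcRows N 1).a1 := by
  change bv 0 + bv 1 - (bv 2 + bv 3) = (bv 0 - bv 3) + (bv 1 - bv 2)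
  ring

theorem smallRows_one_a1 (N : ℕ) :
    (smallRows N 1).a1 = bv 2 * (arcRows N 0).a1 + bv 0 * (arcRows N 1).a1 := by
  change bv 0 * bv 1 - bv 2 * bv 3 = bv 2 * (bv 0 - bv 3) + bv 0 * (bv 1 - bv 2)
  ring

theorem arcRows_zero_deg0 (N : ℕ) : (arcRows N 0).deg0 = (2, 2 * (N : ℤ)) := rfl

theorem arcRows_one_deg0 (N : ℕ) : (arcRows N 1).deg0 = (2, 2 * (N : ℤ)) := rfl

theorem smallRows_zero_deg0 (N : ℕ) : (smallRows N 0).deg0 = (2, 2 * (N : ℤ)) := rfl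

theorem smallRows_one_deg0 (N : ℕ) : (smallRows N 1).deg0 = (2, 2 * (N : ℤ) - 2) := rfl

section

variable {A : Type} [CommRing A] {N : ℕ} {gr : ℤ × ℤ → AddSubgroup A} {rowP rowQ : Fin 2 → KRow A}
  {x₁ x₂ k : A}

theorem chiModel0_isHomogMorphism (hg : IsGr gr) (hx₁ : x₁ ∈ gr (0, 2)) (hx₂ : x₂ ∈ gr (0, 2))
    (hk : k ∈ gr (2, 2 * (N : ℤ) - 2)) (dP0 : (rowP 0).deg0 = (2, 2 * (N : ℤ)))
    (dP1 : (rowP 1).deg0 = (2, 2 * (N : ℤ))) (dQ0 : (rowQ 0).deg0 = (2, 2 * (N : ℤ)))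
    (dQ1 : (rowQ 1).deg0 = (2, 2 * (N : ℤ) - 2))
    (h0 : (rowQ 0).a1 = (rowP 0).a1 + (rowP 1).a1)
    (h1 : (rowQ 1).a1 = x₂ * (rowP 0).a1 + x₁ * (rowP 1).a1)
    (ht : (rowP 1).a1 * k = (rowP 0).a0 - (rowQ 0).a0 - x₂ * (rowQ 1).a0)
    (hs : (rowP 0).a1 * k = (rowQ 0).a0 + x₁ * (rowQ 1).a0 - (rowP 1).a0) :
    GradedMF.IsHomogMorphism (koszul A N gr rowP) ((koszul A N gr rowQ).shift 0 (-1)) (0, 1)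
      (chiModel0 x₁ x₂ k) where
  comm := LinearMap.ext fun v => chiModel0_kosD h0 h1 ht hs v
  sgn := LinearMap.ext fun v => blockMap_kosSgn _ _ v
  degree := chiModel0_mem hg hx₁ hx₂ hk dP0 dP1 dQ0 dQ1

theorem chiModel1_isHomogMorphism (hg : IsGr gr) (hx₁ : x₁ ∈ gr (0, 2)) (hx₂ : x₂ ∈ gr (0, 2))
    (hk : k ∈ gr (2, 2 * (N : ℤ) - 2)) (dP0 : (rowP 0).deg0 = (2, 2 * (N : ℤ)))
    (dP1 : (rowP 1).deg0 = (2, 2 * (N : ℤ))) (dQ0 : (rowQ 0).deg0 = (2, 2 * (N : ℤ)))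
    (dQ1 : (rowQ 1).deg0 = (2, 2 * (N : ℤ) - 2))
    (h0 : (rowQ 0).a1 = (rowP 0).a1 + (rowP 1).a1)
    (h1 : (rowQ 1).a1 = x₂ * (rowP 0).a1 + x₁ * (rowP 1).a1)
    (ht : (rowP 1).a1 * k = (rowP 0).a0 - (rowQ 0).a0 - x₂ * (rowQ 1).a0)
    (hs : (rowP 0).a1 * k = (rowQ 0).a0 + x₁ * (rowQ 1).a0 - (rowP 1).a0) :
    GradedMF.IsHomogMorphism ((koszul A N gr rowQ).shift 0 (-1)) (koszul A N gr rowP) (0, 1)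
      (chiModel1 x₁ x₂ k) where
  comm := LinearMap.ext fun v => chiModel1_kosD h0 h1 ht hs v
  sgn := LinearMap.ext fun v => blockMap_kosSgn _ _ v
  degree := chiModel1_mem hg hx₁ hx₂ hk dP0 dP1 dQ0 dQ1

end

theorem nonempty_chiPair (N : ℕ) : Nonempty (ChiPair N) := by
  obtain ⟨k, hk, ht, hs⟩ := exists_chiCorrection N
  have h0 := chiModel0_isHomogMorphism (rowP := arcRows N) (rowQ := smallRows N)
    (markGr_isGr (Fin 4)) (bv_mem 0) (bv_mem 2) hk (arcRows_zero_deg0 N)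
    (arcRows_one_deg0 N) (smallRows_zero_deg0 N) (smallRows_one_deg0 N) (smallRows_zero_a1 N)
    (smallRows_one_a1 N) ht hs
  have h1 := chiModel1_isHomogMorphism (rowP := arcRows N) (rowQ := smallRows N)
    (markGr_isGr (Fin 4)) (bv_mem 0) (bv_mem 2) hk (arcRows_zero_deg0 N)
    (arcRows_one_deg0 N) (smallRows_zero_deg0 N) (smallRows_one_deg0 N) (smallRows_zero_a1 N)
    (smallRows_one_a1 N) ht hs
  exact ⟨MorphismPair.ofContraction (contractionRes1 N) (resolution0_not_homotopic N) h0 h1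
    (LinearMap.ext fun v => chiModel1_chiModel0 (bv 0) (bv 2) k v)
    (LinearMap.ext fun v => chiModel0_chiModel1 (bv 0) (bv 2) k v)⟩

/-! ### Cycles and boundaries for the iterated homology -/

namespace MFComplex

variable {S : Type} [CommRing S] (C : MFComplex S)

/-- The elements that represent classes in `H(H(C, dmf), dchi)`. -/
def cyc : Submodule S C.carrier := LinearMap.ker C.dmf ⊓ (LinearMap.range C.dmf).comap C.dchi

/-- The elements that represent zero in `H(H(C, dmf), dchi)`. -/
def bd : Submodule S C.carrier := LinearMap.range C.dmf ⊔ (LinearMap.ker C.dmf).map C.dchi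

variable {C}

theorem mem_cyc {x : C.carrier} : x ∈ C.cyc ↔ C.dmf x = 0 ∧ ∃ y, C.dmf y = C.dchi x := by
  simp [cyc]

theorem mem_bd {x : C.carrier} :
    x ∈ C.bd ↔ ∃ y z, C.dmf z = 0 ∧ C.dmf y + C.dchi z = x := by
  rw [bd, Submodule.mem_sup]
  constructor
  · rintro ⟨_, ⟨y, rfl⟩, _, ⟨z, hz, rfl⟩, h⟩
    exact ⟨y, z, hz, h⟩
  · rintro ⟨y, z, hz, h⟩
    exact ⟨_, ⟨y, rfl⟩, _, ⟨z, hz, rfl⟩, h⟩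

variable (C)

theorem dchiH_mk (x : LinearMap.ker C.dmf) :
    C.dchiH (Submodule.Quotient.mk x) = Submodule.Quotient.mk
      ⟨C.dchi x, by
        have := LinearMap.congr_fun C.dchi_dmf x
        simp only [LinearMap.comp_apply, LinearMap.mem_ker.1 x.2, map_zero] at this
        exact this.symm⟩ := rfl

theorem dchiH_mk_eq_zero (x : LinearMap.ker C.dmf) :
    C.dchiH (Submodule.Quotient.mk x) = 0 ↔ ∃ y, C.dmf y = C.dchi x := by
  rw [dchiH_mk, Submodule.Quotient.mk_eq_zero]
  rfl

/-- The class of a cycle in `H(H(C, dmf), dchi)`. -/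
def cls : C.cyc →ₗ[S] C.H₂ :=
  (Submodule.mkQ _).comp
    (LinearMap.codRestrict (LinearMap.ker C.dchiH)
      ((Submodule.mkQ ((LinearMap.range C.dmf).submoduleOf (LinearMap.ker C.dmf))).comp
        (Submodule.inclusion inf_le_left))
      fun x => (C.dchiH_mk_eq_zero _).2 (mem_cyc.1 x.2).2)

/-- Together with `mem_homogH`, this replaces the two nested quotients by the single subquotient
`cyc / bd`, so that homology is computed with elements of the complex itself. -/
theorem cls_eq_zero (x : C.cyc) : C.cls x = 0 ↔ (x : C.carrier) ∈ C.bd := by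
  have h1 : C.cls x = 0 ↔ ∃ η : C.H₁, C.dchiH η =
      Submodule.Quotient.mk ⟨(x : C.carrier), (mem_cyc.1 x.2).1⟩ := by
    refine (Submodule.Quotient.mk_eq_zero _).trans ?_
    rfl
  rw [h1, mem_bd]
  constructor
  · rintro ⟨η, h⟩
    obtain ⟨z, rfl⟩ := Submodule.Quotient.mk_surjective _ η
    rw [dchiH_mk] at h
    obtain ⟨y, hy⟩ := (Submodule.Quotient.eq _).1 h.symm
    refine ⟨y, z, z.2, ?_⟩
    have hy' : C.dmf y = x - C.dchi z := hy
    rw [hy', sub_add_cancel]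
  · rintro ⟨y, z, hz, h⟩
    refine ⟨Submodule.Quotient.mk ⟨z, hz⟩, ?_⟩
    rw [dchiH_mk]
    refine ((Submodule.Quotient.eq _).2 ?_).symm
    change ∃ y, C.dmf y = x - C.dchi z
    exact ⟨y, by rw [← h, add_sub_cancel_right]⟩

theorem mem_homogH {ε : ZMod 2} {i : ℤ} {d : ℤ × ℤ} {ξ : C.H₂} :
    ξ ∈ C.homogH ε i d ↔ ∃ x : C.cyc, (x : C.carrier) ∈ C.homog ε i d ∧ C.cls x = ξ := by
  constructor
  · rintro ⟨η, ⟨x, hx, h⟩, rfl⟩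
    have hη : C.dchiH (Submodule.Quotient.mk x) = 0 := by
      have h' : Submodule.Quotient.mk x = (η : C.H₁) := h
      rw [h']
      exact η.2
    refine ⟨⟨x, x.2, (C.dchiH_mk_eq_zero x).1 hη⟩, hx, ?_⟩
    change Submodule.Quotient.mk _ = Submodule.Quotient.mk η
    congr 1
    exact Subtype.ext h
  · rintro ⟨x, hx, rfl⟩
    exact ⟨⟨Submodule.Quotient.mk ⟨x, x.2.1⟩, (C.dchiH_mk_eq_zero _).2 (mem_cyc.1 x.2).2⟩,
      ⟨⟨x, x.2.1⟩, hx, rfl⟩, rfl⟩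

variable [Algebra ℚ[X] S]

/-- The part of `H(H(C, dmf), dchi)` of `ℤ₂`-degree `ε` and homological degree `i`, as a bigraded
`ℚ[a]`-module. -/
def homologyGr (ε : ZMod 2) (i : ℤ) : GrMod :=
  letI : Module ℚ[X] (C.partH ε i) := Module.compHom _ (algebraMap ℚ[X] S)
  { carrier := C.partH ε i
    homog := fun d => (C.homogH ε i d).comap (C.partH ε i).subtype.toAddMonoidHom }

theorem homologyGr_iso_zero {ε : ZMod 2} {i : ℤ}
    (h : ∀ d x, x ∈ C.cyc → x ∈ C.homog ε i d → x ∈ C.bd) :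
    GrMod.Iso (C.homologyGr ε i) GrMod.zero := by
  have h1 : C.partH ε i = ⊥ := by
    rw [partH, Submodule.span_eq_bot]
    intro ξ hξ
    simp only [Set.mem_iUnion, SetLike.mem_coe] at hξ
    obtain ⟨d, hξ⟩ := hξ
    obtain ⟨x, hx, rfl⟩ := (C.mem_homogH).1 hξ
    exact (C.cls_eq_zero x).2 (h d x x.2 hx)
  have h2 : Subsingleton (C.homologyGr ε i).carrier := by
    change Subsingleton (C.partH ε i)
    rw [h1]
    infer_instance
  refine ⟨{ toFun := fun _ => PUnit.unit
            map_add' := fun _ _ => rfl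
            map_smul' := fun _ _ => rfl
            invFun := fun _ => 0
            left_inv := fun x => Subsingleton.elim _ _
            right_inv := fun _ => rfl }, fun d x => ?_⟩
  rw [Subsingleton.elim x 0]
  exact ⟨fun _ => trivial, fun _ => zero_mem _⟩

/-- The part of `H(H(C, dmf), dchi)` of `ℤ₂`-degree `ε` and homological degree `i` is generated by
the class of the cycle `g` of bidegree `d₀`, with `f • g` nullhomologous if and only if
`κ f = 0`. -/
structure IsGenerator (ε : ZMod 2) (i : ℤ) (gr : ℤ × ℤ → AddSubgroup S) (d₀ : ℤ × ℤ) {T : GrMod}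
    (κ : S →ₗ[ℚ[X]] T.carrier) (g : C.carrier) : Prop where
  surjective : Function.Surjective κ
  cyc : g ∈ C.cyc
  homog : ∀ d f, f ∈ gr d → f • g ∈ C.homog ε i (d + d₀)
  one_mem : (1 : S) ∈ gr 0
  bd_iff : ∀ f, f • g ∈ C.bd ↔ κ f = 0
  mem_iff : ∀ d t, t ∈ T.homog d ↔ ∃ f ∈ gr (d - d₀), κ f = t
  exists_sub : ∀ d x, x ∈ C.cyc → x ∈ C.homog ε i d → ∃ f ∈ gr (d - d₀), x - f • g ∈ C.bd

/-- The part of the homology and `T` are both quotients of `S`, by `f ↦ [f • g]` and by `κ`, with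
the same kernel. In either one the component of degree `d` is the image of `gr (d - d₀)`, so the
induced isomorphism respects the gradings. -/
theorem IsGenerator.iso {ε : ZMod 2} {i : ℤ} {gr : ℤ × ℤ → AddSubgroup S} {d₀ : ℤ × ℤ} {T : GrMod}
    {κ : S →ₗ[ℚ[X]] T.carrier} {g : C.carrier} (h : C.IsGenerator ε i gr d₀ κ g) :
    GrMod.Iso (C.homologyGr ε i) T := by
  let e : S →ₗ[S] C.H₂ := C.cls ∘ₗ LinearMap.toSpanSingleton S C.cyc ⟨g, h.cyc⟩
  have he : ∀ f, e f = C.cls ⟨f • g, C.cyc.smul_mem f h.cyc⟩ := fun f => rfl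
  have he0 : ∀ f, e f = 0 ↔ κ f = 0 := fun f => by
    rw [he, C.cls_eq_zero, ← h.bd_iff]
  have hsub : ∀ f f', e f = e f' ↔ κ f = κ f' := fun f f' => by
    rw [← sub_eq_zero, ← map_sub, he0, map_sub, sub_eq_zero]
  have hmem : ∀ d ξ, ξ ∈ C.homogH ε i d ↔ ∃ f ∈ gr (d - d₀), e f = ξ := by
    intro d ξ
    rw [C.mem_homogH]
    constructor
    · rintro ⟨x, hx, rfl⟩
      obtain ⟨f, hf, hb⟩ := h.exists_sub d x x.2 hx
      refine ⟨f, hf, ?_⟩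
      rw [eq_comm, ← sub_eq_zero, he, ← map_sub, C.cls_eq_zero]
      exact hb
    · rintro ⟨f, hf, rfl⟩
      refine ⟨⟨f • g, C.cyc.smul_mem f h.cyc⟩, ?_, rfl⟩
      have := h.homog _ f hf
      rwa [sub_add_cancel] at this
  have hrange : C.partH ε i = LinearMap.range e := by
    apply le_antisymm
    · rw [partH, Submodule.span_le]
      intro ξ hξ
      simp only [Set.mem_iUnion, SetLike.mem_coe] at hξ
      obtain ⟨d, hξ⟩ := hξ
      obtain ⟨f, -, rfl⟩ := (hmem d ξ).1 hξ
      exact ⟨f, rfl⟩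
    · rintro _ ⟨f, rfl⟩
      -- Multiples of `g` by inhomogeneous `f` also lie in the span, because `[g]` itself is
      -- homogeneous and the span is an `S`-submodule.
      have h1 : e 1 ∈ C.homogH ε i d₀ := (hmem _ _).2 ⟨1, by rw [sub_self]; exact h.one_mem, rfl⟩
      have h2 : e 1 ∈ C.partH ε i := Submodule.subset_span (Set.mem_iUnion.2 ⟨d₀, h1⟩)
      have h3 := (C.partH ε i).smul_mem f h2
      rwa [← map_smul, smul_eq_mul, mul_one] at h3
  let e' : S →ₗ[ℚ[X]] (C.homologyGr ε i).carrier :=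
    { toFun := fun f => (⟨e f, by rw [hrange]; exact ⟨f, rfl⟩⟩ : C.partH ε i)
      map_add' := fun f f' => Subtype.ext (map_add e f f')
      map_smul' := fun p f => Subtype.ext
        ((congrArg e (Algebra.smul_def p f)).trans (e.map_smul (algebraMap ℚ[X] S p) f)) }
  have hsurj : Function.Surjective e' := by
    rintro ⟨ξ, hξ⟩
    have h1 := hξ
    rw [hrange] at h1
    obtain ⟨f, rfl⟩ := h1
    exact ⟨f, rfl⟩
  have hker : LinearMap.ker e' = LinearMap.ker κ := by
    ext f
    rw [LinearMap.mem_ker, LinearMap.mem_ker, ← he0]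
    exact Subtype.ext_iff
  let Φ : (C.homologyGr ε i).carrier ≃ₗ[ℚ[X]] T.carrier :=
    (e'.quotKerEquivOfSurjective hsurj).symm ≪≫ₗ Submodule.quotEquivOfEq _ _ hker ≪≫ₗ
      κ.quotKerEquivOfSurjective h.surjective
  have hΦ : ∀ f, Φ (e' f) = κ f := by
    intro f
    have h1 : (e'.quotKerEquivOfSurjective hsurj).symm (e' f) = Submodule.Quotient.mk f := by
      rw [LinearEquiv.symm_apply_eq]
      rfl
    change κ.quotKerEquivOfSurjective h.surjective (Submodule.quotEquivOfEq _ _ hker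
      ((e'.quotKerEquivOfSurjective hsurj).symm (e' f))) = κ f
    rw [h1]
    rfl
  refine ⟨Φ, fun d x => ?_⟩
  obtain ⟨f, rfl⟩ := hsurj x
  rw [hΦ, h.mem_iff]
  refine Iff.trans (show _ ↔ e f ∈ C.homogH ε i d from Iff.rfl) ?_
  rw [hmem]
  simp only [hsub]

end MFComplex

/-! ### Comparison of complexes -/

/-- A homotopy equivalence with respect to `dmf` of complexes of matrix factorizations, compatible
with `dchi` up to homotopy. -/
structure WeakEquiv {S : Type} [CommRing S] (C D : MFComplex S) where
  φ : C.carrier →ₗ[S] D.carrier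
  ψ : D.carrier →ₗ[S] C.carrier
  φ_dmf : φ ∘ₗ C.dmf = D.dmf ∘ₗ φ
  ψ_dmf : ψ ∘ₗ D.dmf = C.dmf ∘ₗ ψ
  φ_dchi : ∃ h : C.carrier →ₗ[S] D.carrier,
    φ ∘ₗ C.dchi = D.dchi ∘ₗ φ + (D.dmf ∘ₗ h + h ∘ₗ C.dmf)
  ψ_dchi : ∃ h : D.carrier →ₗ[S] C.carrier,
    ψ ∘ₗ D.dchi = C.dchi ∘ₗ ψ + (C.dmf ∘ₗ h + h ∘ₗ D.dmf)
  ψ_φ : ∃ h : C.carrier →ₗ[S] C.carrier,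
    ψ ∘ₗ φ = LinearMap.id + (C.dmf ∘ₗ h + h ∘ₗ C.dmf)
  φ_ψ : ∃ h : D.carrier →ₗ[S] D.carrier,
    φ ∘ₗ ψ = LinearMap.id + (D.dmf ∘ₗ h + h ∘ₗ D.dmf)
  φ_homog : ∀ ε i d x, x ∈ C.homog ε i d → φ x ∈ D.homog ε i d
  ψ_homog : ∀ ε i d x, x ∈ D.homog ε i d → ψ x ∈ C.homog ε i d

namespace WeakEquiv

variable {S : Type} [CommRing S] {C D : MFComplex S}

/-- The inverse equivalence. -/
def symm (w : WeakEquiv C D) : WeakEquiv D C where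
  φ := w.ψ
  ψ := w.φ
  φ_dmf := w.ψ_dmf
  ψ_dmf := w.φ_dmf
  φ_dchi := w.ψ_dchi
  ψ_dchi := w.φ_dchi
  ψ_φ := w.φ_ψ
  φ_ψ := w.ψ_φ
  φ_homog := w.ψ_homog
  ψ_homog := w.φ_homog

/-- On a `dmf`-cycle the homotopy in `φ_dchi` contributes only a `dmf`-boundary, so commuting with
`dchi` up to homotopy is enough. -/
theorem map_cyc (w : WeakEquiv C D) {x : C.carrier} (hx : x ∈ C.cyc) : w.φ x ∈ D.cyc := by
  rw [MFComplex.mem_cyc] at *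
  obtain ⟨h0, y, hy⟩ := hx
  obtain ⟨h, hh⟩ := w.φ_dchi
  have h1 := LinearMap.congr_fun w.φ_dmf x
  have h2 := LinearMap.congr_fun w.φ_dmf y
  have h3 := LinearMap.congr_fun hh x
  simp only [LinearMap.comp_apply, LinearMap.add_apply, h0, hy, map_zero, add_zero] at h1 h2 h3
  exact ⟨h1.symm, w.φ y - h x, by rw [map_sub, ← h2, h3, add_sub_cancel_right]⟩

theorem map_bd (w : WeakEquiv C D) {x : C.carrier} (hx : x ∈ C.bd) : w.φ x ∈ D.bd := by
  rw [MFComplex.mem_bd] at *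
  obtain ⟨y, z, hz, rfl⟩ := hx
  obtain ⟨h, hh⟩ := w.φ_dchi
  have h1 := LinearMap.congr_fun w.φ_dmf z
  have h2 := LinearMap.congr_fun w.φ_dmf y
  have h3 := LinearMap.congr_fun hh z
  simp only [LinearMap.comp_apply, LinearMap.add_apply, hz, map_zero, add_zero] at h1 h2 h3
  refine ⟨w.φ y + h z, w.φ z, h1.symm, ?_⟩
  rw [map_add, map_add, h2, h3]
  abel

/-- On a `dmf`-cycle the homotopy `ψ φ ≃ 1` leaves a `dmf`-boundary. With `map_cyc` and `map_bd`
this makes `φ` and `ψ` inverse to each other on `cyc / bd`. -/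
theorem sub_mem_bd (w : WeakEquiv C D) {x : C.carrier} (hx : x ∈ C.cyc) :
    w.ψ (w.φ x) - x ∈ C.bd := by
  rw [MFComplex.mem_cyc] at hx
  obtain ⟨h, hh⟩ := w.ψ_φ
  have h1 := LinearMap.congr_fun hh x
  simp only [LinearMap.comp_apply, LinearMap.add_apply, hx.1, map_zero, add_zero,
    LinearMap.id_apply] at h1
  rw [h1, add_sub_cancel_left]
  exact MFComplex.mem_bd.2 ⟨h x, 0, map_zero _, by simp⟩

theorem isGenerator [Algebra ℚ[X] S] (w : WeakEquiv C D) {ε : ZMod 2} {i : ℤ}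
    {gr : ℤ × ℤ → AddSubgroup S} {d₀ : ℤ × ℤ} {T : GrMod} {κ : S →ₗ[ℚ[X]] T.carrier}
    {g : D.carrier} (h : D.IsGenerator ε i gr d₀ κ g) : C.IsGenerator ε i gr d₀ κ (w.ψ g) where
  surjective := h.surjective
  cyc := w.symm.map_cyc h.cyc
  homog d f hf := by
    rw [← map_smul]
    exact w.ψ_homog _ _ _ _ (h.homog d f hf)
  one_mem := h.one_mem
  bd_iff f := by
    rw [← h.bd_iff, ← map_smul]
    constructor
    · intro hb
      have h1 := w.map_bd hb
      have h2 := w.symm.sub_mem_bd (D.cyc.smul_mem f h.cyc)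
      have h3 := sub_mem h1 h2
      change w.φ (w.ψ (f • g)) - (w.φ (w.ψ (f • g)) - f • g) ∈ D.bd at h3
      rwa [sub_sub_cancel] at h3
    · exact w.symm.map_bd
  mem_iff := h.mem_iff
  exists_sub d x hx hxd := by
    obtain ⟨f, hf, hb⟩ := h.exists_sub d (w.φ x) (w.map_cyc hx) (w.φ_homog _ _ _ _ hxd)
    refine ⟨f, hf, ?_⟩
    have h1 : w.ψ (w.φ x - f • g) ∈ C.bd := w.symm.map_bd hb
    have h2 := sub_mem h1 (w.sub_mem_bd hx)
    rw [map_sub, map_smul] at h2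
    convert h2 using 1
    abel

theorem mem_bd_of_forall (w : WeakEquiv C D) {ε : ZMod 2} {i : ℤ}
    (h : ∀ d x, x ∈ D.cyc → x ∈ D.homog ε i d → x ∈ D.bd) (d : ℤ × ℤ) (x : C.carrier)
    (hx : x ∈ C.cyc) (hxd : x ∈ C.homog ε i d) : x ∈ C.bd := by
  have h1 : w.ψ (w.φ x) ∈ C.bd :=
    w.symm.map_bd (h d _ (w.map_cyc hx) (w.φ_homog _ _ _ _ hxd))
  have h2 := sub_mem h1 (w.sub_mem_bd hx)
  rwa [sub_sub_cancel] at h2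

end WeakEquiv

/-! ### Extension of scalars of matrix factorizations -/

section BaseChange

variable {R S : Type} [CommRing R] [CommRing S] [Algebra R S]

/-- The homogeneous components of the extension of scalars of a matrix factorization. -/
def bcHomog (gr : ℤ × ℤ → AddSubgroup S) (M : GradedMF R) (ε : ZMod 2) (d : ℤ × ℤ) :
    AddSubgroup (S ⊗[R] M.carrier) :=
  AddSubgroup.closure
    {z | ∃ d₁ d₂ s m, d₁ + d₂ = d ∧ s ∈ gr d₁ ∧ m ∈ M.homog ε d₂ ∧ z = s ⊗ₜ[R] m}

theorem bcHomog_shift (gr : ℤ × ℤ → AddSubgroup S) (M : GradedMF R) (q r : ℤ) (ε : ZMod 2)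
    (d : ℤ × ℤ) : bcHomog gr (M.shift q r) ε d = bcHomog gr M ε (d - (q, r)) := by
  refine congrArg AddSubgroup.closure (Set.ext fun z => ⟨?_, ?_⟩)
  · rintro ⟨d₁, d₂, s, m, rfl, hs, hm, rfl⟩
    exact ⟨d₁, d₂ - (q, r), s, m, by abel, hs, hm, rfl⟩
  · rintro ⟨d₁, d₂, s, m, h, hs, hm, rfl⟩
    refine ⟨d₁, d₂ + (q, r), s, m, by rw [← add_assoc, h, sub_add_cancel], hs, ?_, rfl⟩
    change m ∈ M.homog ε (d₂ + (q, r) - (q, r))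
    rwa [add_sub_cancel_right]

/-- An identification of `M'` with the extension of scalars of the matrix factorization `M`. -/
structure BCIso (gr : ℤ × ℤ → AddSubgroup S) (M : GradedMF R) (M' : GradedMF S) where
  e : (S ⊗[R] M.carrier) ≃ₗ[S] M'.carrier
  d : ∀ z, e (M.d.baseChange S z) = M'.d (e z)
  sgn : ∀ z, e (M.sgn.baseChange S z) = M'.sgn (e z)
  homog : ∀ ε d z, z ∈ bcHomog gr M ε d ↔ e z ∈ M'.homog ε d

namespace BCIso

variable {gr : ℤ × ℤ → AddSubgroup S} {M K L : GradedMF R} {M' K' L' : GradedMF S}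

/-- Extension of scalars is compatible with shifts. -/
def shift (b : BCIso gr M M') (q r : ℤ) : BCIso gr (M.shift q r) (M'.shift q r) where
  e := b.e
  d := b.d
  sgn := b.sgn
  homog ε d z := by
    rw [bcHomog_shift]
    exact b.homog ε _ z

/-- Extension of scalars is compatible with the exchange of the even and the odd part. -/
def flip (b : BCIso gr M M') : BCIso gr M.flip M'.flip where
  e := b.e
  d := b.d
  sgn z := by
    have h : (M.flip.sgn.baseChange S) z = -(M.sgn.baseChange S z) :=
      LinearMap.congr_fun (LinearMap.baseChange_neg (A := S) M.sgn) z
    exact (congrArg b.e h).trans ((b.e.map_neg _).trans (congrArg (fun x => -x) (b.sgn z)))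
  homog ε d z := b.homog (ε + 1) d z

/-- Extension of scalars of a linear map. -/
def map (b : BCIso gr M M') (c : BCIso gr K K') (f : M.carrier →ₗ[R] K.carrier) :
    M'.carrier →ₗ[S] K'.carrier :=
  c.e.toLinearMap ∘ₗ f.baseChange S ∘ₗ b.e.symm.toLinearMap

theorem map_apply (b : BCIso gr M M') (c : BCIso gr K K') (f : M.carrier →ₗ[R] K.carrier)
    (z : S ⊗[R] M.carrier) : b.map c f (b.e z) = c.e (f.baseChange S z) := by
  simp [map]

theorem map_comp (b : BCIso gr M M') (c : BCIso gr K K') (l : BCIso gr L L')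
    (f : M.carrier →ₗ[R] K.carrier) (g : K.carrier →ₗ[R] L.carrier) :
    c.map l g ∘ₗ b.map c f = b.map l (g ∘ₗ f) := by
  ext x
  obtain ⟨z, rfl⟩ := b.e.surjective x
  rw [LinearMap.comp_apply, map_apply, map_apply, map_apply, LinearMap.baseChange_comp]
  rfl

theorem map_add (b : BCIso gr M M') (c : BCIso gr K K') (f g : M.carrier →ₗ[R] K.carrier) :
    b.map c (f + g) = b.map c f + b.map c g := by
  ext x
  obtain ⟨z, rfl⟩ := b.e.surjective x
  rw [LinearMap.add_apply, map_apply, map_apply, map_apply, LinearMap.baseChange_add,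
    LinearMap.add_apply, _root_.map_add]

theorem map_neg (b : BCIso gr M M') (c : BCIso gr K K') (f : M.carrier →ₗ[R] K.carrier) :
    b.map c (-f) = -b.map c f := by
  ext x
  obtain ⟨z, rfl⟩ := b.e.surjective x
  rw [LinearMap.neg_apply, map_apply, map_apply, LinearMap.baseChange_neg, LinearMap.neg_apply,
    _root_.map_neg]

theorem map_smul_id (b : BCIso gr M M') (s : R) :
    b.map b (s • LinearMap.id) = algebraMap R S s • LinearMap.id := by
  ext x
  obtain ⟨z, rfl⟩ := b.e.surjective x
  rw [map_apply, LinearMap.baseChange_smul, LinearMap.baseChange_id, LinearMap.smul_apply,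
    LinearMap.smul_apply, LinearMap.id_apply, LinearMap.id_apply, ← _root_.map_smul,
    algebraMap_smul]

theorem map_d (b : BCIso gr M M') : b.map b M.d = M'.d := by
  ext x
  obtain ⟨z, rfl⟩ := b.e.surjective x
  rw [map_apply, b.d]

theorem map_sgn (b : BCIso gr M M') : b.map b M.sgn = M'.sgn := by
  ext x
  obtain ⟨z, rfl⟩ := b.e.surjective x
  rw [map_apply, b.sgn]

theorem isHomogMorphism (b : BCIso gr M M') (c : BCIso gr K K') {δ : ℤ × ℤ}
    {f : M.carrier →ₗ[R] K.carrier} (hf : GradedMF.IsHomogMorphism M K δ f) :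
    GradedMF.IsHomogMorphism M' K' δ (b.map c f) where
  comm := by
    conv_lhs => rw [← b.map_d]
    conv_rhs => rw [← c.map_d]
    rw [map_comp, map_comp, hf.comm]
  sgn := by
    conv_lhs => rw [← b.map_sgn]
    conv_rhs => rw [← c.map_sgn]
    rw [map_comp, map_comp, hf.sgn]
  degree ε d x hx := by
    obtain ⟨z, rfl⟩ := b.e.surjective x
    rw [map_apply, ← c.homog]
    rw [← b.homog] at hx
    refine AddSubgroup.closure_induction ?_ ?_ ?_ ?_ hx
    · rintro _ ⟨d₁, d₂, s, m, rfl, hs, hm, rfl⟩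
      exact AddSubgroup.subset_closure
        ⟨d₁, d₂ + δ, s, f m, (add_assoc _ _ _).symm, hs, hf.degree _ _ _ hm,
          LinearMap.baseChange_tmul _ _ _⟩
    · rw [map_zero]
      exact zero_mem _
    · intro x y _ _ hx hy
      rw [_root_.map_add]
      exact add_mem hx hy
    · intro x _ hx
      rw [_root_.map_neg]
      exact neg_mem hx

theorem homotopic (b : BCIso gr M M') (c : BCIso gr K K') {f g : M.carrier →ₗ[R] K.carrier}
    (h : GradedMF.Homotopic M K f g) :
    GradedMF.Homotopic M' K' (b.map c f) (b.map c g) := by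
  obtain ⟨h, hs, hh⟩ := h
  refine ⟨b.map c h, ?_, ?_⟩
  · conv_lhs => rw [← b.map_sgn]
    conv_rhs => rw [← c.map_sgn]
    rw [map_comp, map_comp, ← map_neg, hs]
  · conv_rhs => rw [← b.map_d, ← c.map_d]
    rw [map_comp, map_comp, ← map_add, ← hh, sub_eq_add_neg f, map_add, map_neg, ← sub_eq_add_neg]

end BCIso

theorem piScalarRight_tmul {ι : Type} [Fintype ι] [DecidableEq ι] (s : S) (f : ι → R) :
    TensorProduct.piScalarRight R S S ι (s ⊗ₜ f) = s • (algebraMap R S ∘ f) := by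
  ext i
  simp [Algebra.smul_def, mul_comm]

theorem piScalarRight_baseChange {ι : Type} [Fintype ι] [DecidableEq ι]
    {D : (ι → R) →ₗ[R] (ι → R)} {D' : (ι → S) →ₗ[S] (ι → S)}
    (h : ∀ f, D' (algebraMap R S ∘ f) = algebraMap R S ∘ D f) (z : S ⊗[R] (ι → R)) :
    TensorProduct.piScalarRight R S S ι (D.baseChange S z) =
      D' (TensorProduct.piScalarRight R S S ι z) := by
  induction z using TensorProduct.induction_on with
  | zero => rw [map_zero, map_zero, map_zero]
  | add x y hx hy => rw [map_add, map_add, map_add, map_add, hx, hy]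
  | tmul s f =>
    rw [LinearMap.baseChange_tmul, piScalarRight_tmul, piScalarRight_tmul, map_smul, h]

theorem eq_sum_tmul_single {ι : Type} [Fintype ι] [DecidableEq ι] (z : S ⊗[R] (ι → R)) :
    z = ∑ t : ι, TensorProduct.piScalarRight R S S ι z t ⊗ₜ[R] (Pi.single t 1 : ι → R) := by
  apply (TensorProduct.piScalarRight R S S ι).injective
  rw [map_sum]
  simp only [piScalarRight_tmul]
  ext t
  rw [Finset.sum_apply, Finset.sum_eq_single t]
  · simp
  · intro t' _ h
    simp [Pi.single_eq_of_ne h.symm]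
  · simp

theorem map_mem_kosHomog {grR : ℤ × ℤ → AddSubgroup R} {gr : ℤ × ℤ → AddSubgroup S} 
    (hgr : ∀ d r, r ∈ grR d → algebraMap R S r ∈ gr d) {N n : ℕ} {row : Fin n → KRow R}
    {row' : Fin n → KRow S}
    (hd : ∀ i, (row' i).deg0 = (row i).deg0) {ε : ZMod 2} {d : ℤ × ℤ} {f : Finset (Fin n) → R}
    (hf : f ∈ kosHomog N grR row ε d) : algebraMap R S ∘ f ∈ kosHomog N gr row' ε d := by
  rw [mem_kosHomog] at *
  intro t
  have := hf t
  simp only [hd, Function.comp_apply]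
  split_ifs with h
  · rw [if_pos h] at this
    exact hgr _ _ this
  · rw [if_neg h, AddSubgroup.mem_bot] at this
    rw [this, map_zero]
    exact zero_mem _

/-- Extension of scalars of a Koszul matrix factorization. -/
def koszulBCIso {grR : ℤ × ℤ → AddSubgroup R} {gr : ℤ × ℤ → AddSubgroup S} (hR : IsGr grR)
    (hS : IsGr gr) (hgr : ∀ d r, r ∈ grR d → algebraMap R S r ∈ gr d) (N : ℕ) {n : ℕ}
    (row : Fin n → KRow R) (row' : Fin n → KRow S)
    (h0 : ∀ i, (row' i).a0 = algebraMap R S (row i).a0)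
    (h1 : ∀ i, (row' i).a1 = algebraMap R S (row i).a1)
    (hd : ∀ i, (row' i).deg0 = (row i).deg0) :
    BCIso gr (koszul R N grR row) (koszul S N gr row') where
  e := TensorProduct.piScalarRight R S S (Finset (Fin n))
  d := piScalarRight_baseChange (D := kosD row) (D' := kosD row')
    (kosD_map (algebraMap R S) row row' h0 h1)
  sgn := piScalarRight_baseChange (D := kosSgn R n) (D' := kosSgn S n)
    (kosSgn_map (algebraMap R S))
  homog ε d z := by
    constructor
    · intro hz
      refine AddSubgroup.closure_induction (p := fun z _ =>
        (TensorProduct.piScalarRight R S S (Finset (Fin n))) z ∈ kosHomog N gr row' ε d)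
        ?_ ?_ ?_ ?_ hz
      · rintro _ ⟨d₁, d₂, s, m, rfl, hs, hm, rfl⟩
        refine (congrArg (· ∈ kosHomog N gr row' ε (d₁ + d₂)) (piScalarRight_tmul s m)).mpr ?_
        exact smul_mem_kosHomog hS hs
          (map_mem_kosHomog (grR := grR) (row := row) hgr hd (f := m) hm)
      · rw [map_zero]
        exact zero_mem _
      · intro x y _ _ hx hy
        exact (congrArg (· ∈ kosHomog N gr row' ε d)
          ((TensorProduct.piScalarRight R S S (Finset (Fin n))).map_add x y)).mpr (add_mem hx hy)
      · intro x _ hx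
        exact (congrArg (· ∈ kosHomog N gr row' ε d)
          ((TensorProduct.piScalarRight R S S (Finset (Fin n))).map_neg x)).mpr (neg_mem hx)
    · intro hz
      have hz' : (TensorProduct.piScalarRight R S S (Finset (Fin n))) z ∈ kosHomog N gr row' ε d :=
        hz
      rw [mem_kosHomog] at hz'
      -- Expand in the standard basis: the coordinate at `t` is homogeneous of degree `d` minus that
      -- of the generator of `t`, and vanishes when the parity of `t` is wrong.
      refine (congrArg (· ∈ bcHomog gr (koszul R N grR row) ε d) (eq_sum_tmul_single z)).mpr ?_
      refine sum_mem fun t _ => ?_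
      have ht := hz' t
      simp only [hd] at ht
      split_ifs at ht with h
      · refine AddSubgroup.subset_closure ⟨_, _, _, _, sub_add_cancel _ _, ht, ?_, rfl⟩
        change Pi.single t 1 ∈ kosHomog N grR row ε _
        rw [mem_kosHomog]
        intro t'
        by_cases htt : t' = t
        · subst htt
          rw [if_pos h, Pi.single_eq_same, sub_self]
          exact hR.one
        · rw [Pi.single_eq_of_ne htt]
          exact zero_mem _
      · rw [AddSubgroup.mem_bot] at ht
        rw [ht, TensorProduct.zero_tmul]
        exact zero_mem _

end BaseChange

/-! ### Simplification of complexes with two terms -/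

/-- Contractions are compatible with the exchange of the even and the odd part. -/
def Contraction.flip {R : Type} [CommRing R] {C K : GradedMF R} (c : Contraction C K) :
    Contraction C.flip K.flip where
  p := c.p
  i := c.i
  h := c.h
  p_hom := ⟨c.p_hom.comm, LinearMap.ext fun x =>
    (c.p.map_neg _).trans (congrArg (fun x => -x) (c.p_sgn x)),
    fun ε d x hx => c.p_hom.degree (ε + 1) d x hx⟩
  i_hom := ⟨c.i_hom.comm, LinearMap.ext fun x =>
    (c.i.map_neg _).trans (congrArg (fun x => -x) (c.i_sgn x)),
    fun ε d x hx => c.i_hom.degree (ε + 1) d x hx⟩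
  p_i := c.p_i
  h_sgn x := (c.h.map_neg _).trans (congrArg (fun x => -x) (c.h_sgn x))
  homotopy := c.homotopy

section TwoTerm

variable {R : Type} [CommRing R]

theorem mem_twoTerm {P Q : GradedMF R} {i₀ : ℤ} {f : P.carrier →ₗ[R] Q.carrier}
    {hf : f ∘ₗ P.d = Q.d ∘ₗ f} {hs : f ∘ₗ P.sgn = Q.sgn ∘ₗ f} {ε : ZMod 2} {i : ℤ} {d : ℤ × ℤ}
    {x : P.carrier} {y : Q.carrier} :
    (x, y) ∈ (MFComplex.twoTerm i₀ P Q f hf hs).homog ε i d ↔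
      (if i = i₀ then x ∈ P.homog ε d else x = 0) ∧
        (if i = i₀ + 1 then y ∈ Q.homog ε d else y = 0) := by
  change (x, y) ∈ (if i = i₀ then (P.homog ε d).prod ⊥
    else if i = i₀ + 1 then (⊥ : AddSubgroup P.carrier).prod (Q.homog ε d) else ⊥) ↔ _
  by_cases h : i = i₀
  · rw [if_pos h, if_pos h, if_neg (by omega), AddSubgroup.mem_prod, AddSubgroup.mem_bot]
  · rw [if_neg h, if_neg h]
    by_cases h' : i = i₀ + 1
    · rw [if_pos h', if_pos h', AddSubgroup.mem_prod, AddSubgroup.mem_bot]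
    · rw [if_neg h', if_neg h', AddSubgroup.mem_bot, Prod.mk_eq_zero]

/-- A contraction of the second term of a complex with two terms. -/
def WeakEquiv.twoTerm {P Q K : GradedMF R} (i₀ : ℤ) (f : P.carrier →ₗ[R] Q.carrier)
    (hf : f ∘ₗ P.d = Q.d ∘ₗ f) (hs : f ∘ₗ P.sgn = Q.sgn ∘ₗ f) (c : Contraction Q K)
    (hf' : (c.p ∘ₗ f) ∘ₗ P.d = K.d ∘ₗ (c.p ∘ₗ f))
    (hs' : (c.p ∘ₗ f) ∘ₗ P.sgn = K.sgn ∘ₗ (c.p ∘ₗ f)) :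
    WeakEquiv (MFComplex.twoTerm i₀ P Q f hf hs)
      (MFComplex.twoTerm i₀ P K (c.p ∘ₗ f) hf' hs') where
  φ := LinearMap.id.prodMap c.p
  ψ := LinearMap.id.prodMap c.i
  φ_dmf := LinearMap.ext fun x => Prod.ext rfl (c.p_d x.2)
  ψ_dmf := LinearMap.ext fun x => Prod.ext rfl (c.i_d x.2)
  φ_dchi := ⟨0, LinearMap.ext fun x => Prod.ext
    (show (0 : P.carrier) = 0 + (P.d 0 + 0) by simp)
    (show c.p (f x.1) = c.p (f x.1) + (K.d 0 + 0) by simp)⟩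
  ψ_dchi := ⟨LinearMap.inr R P.carrier Q.carrier ∘ₗ (-(c.h ∘ₗ f)) ∘ₗ
      LinearMap.fst R P.carrier K.carrier, LinearMap.ext fun x => Prod.ext
    (show (0 : P.carrier) = 0 + (P.d 0 + 0) by simp)
    -- The inclusion of the contraction commutes with `dchi` only up to homotopy: `i p f - f` is
    -- bounded by `-h f`, which is why `WeakEquiv` asks for no more.
    (show c.i (c.p (f x.1)) = f x.1 + (Q.d (-c.h (f x.1)) + -c.h (f (P.d x.1))) by
      rw [show f (P.d x.1) = Q.d (f x.1) from LinearMap.congr_fun hf x.1, map_neg, ← neg_add,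
        ← c.homotopy]
      abel)⟩
  ψ_φ := ⟨LinearMap.inr R P.carrier Q.carrier ∘ₗ (-c.h) ∘ₗ
      LinearMap.snd R P.carrier Q.carrier, LinearMap.ext fun x => Prod.ext
    (show x.1 = x.1 + (P.d 0 + 0) by simp)
    (show c.i (c.p x.2) = x.2 + (Q.d (-c.h x.2) + -c.h (Q.d x.2)) by
      rw [map_neg, ← neg_add, ← c.homotopy]
      abel)⟩
  φ_ψ := ⟨0, LinearMap.ext fun x => Prod.ext
    (show x.1 = x.1 + (P.d 0 + 0) by simp)
    (show c.p (c.i x.2) = x.2 + (K.d 0 + 0) by simp [c.p_i])⟩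
  φ_homog ε i d x hx := by
    obtain ⟨x, y⟩ := x
    have hx := mem_twoTerm.1 hx
    refine mem_twoTerm.2 ⟨hx.1, ?_⟩
    have h := hx.2
    split_ifs at h ⊢
    · have := c.p_hom.degree _ _ _ h
      rwa [add_zero] at this
    · change c.p y = 0
      rw [h, map_zero]
  ψ_homog ε i d x hx := by
    obtain ⟨x, y⟩ := x
    have hx := mem_twoTerm.1 hx
    refine mem_twoTerm.2 ⟨hx.1, ?_⟩
    have h := hx.2
    split_ifs at h ⊢
    · have := c.i_hom.degree _ _ _ h
      rwa [add_zero] at this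
    · change c.i y = 0
      rw [h, map_zero]

variable {S : Type} [CommRing S] [Algebra R S]

theorem baseChange_mem_homog {C D : MFComplex R} {gr : ℤ × ℤ → AddSubgroup S}
    {φ : C.carrier →ₗ[R] D.carrier} (h : ∀ ε i d x, x ∈ C.homog ε i d → φ x ∈ D.homog ε i d)
    (ε : ZMod 2) (i : ℤ) (d : ℤ × ℤ) (x : (C.baseChange gr).carrier)
    (hx : x ∈ (C.baseChange gr).homog ε i d) :
    φ.baseChange S x ∈ (D.baseChange gr).homog ε i d := by
  refine (AddSubgroup.closure_le
    (((D.baseChange gr).homog ε i d).comap (φ.baseChange S).toAddMonoidHom)).2 ?_ hx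
  rintro _ ⟨d₁, d₂, s, m, rfl, hs, hm, rfl⟩
  exact AddSubgroup.subset_closure
    ⟨d₁, d₂, s, φ m, rfl, hs, h _ _ _ _ hm, LinearMap.baseChange_tmul _ _ _⟩

/-- Extension of scalars of an equivalence of complexes. -/
def WeakEquiv.baseChange {C D : MFComplex R} (w : WeakEquiv C D) (gr : ℤ × ℤ → AddSubgroup S) :
    WeakEquiv (C.baseChange gr) (D.baseChange gr) where
  φ := w.φ.baseChange S
  ψ := w.ψ.baseChange S
  φ_dmf := by
    refine (LinearMap.baseChange_comp (A := S) _ _).symm.trans ?_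
    rw [w.φ_dmf]
    exact LinearMap.baseChange_comp _ _
  ψ_dmf := by
    refine (LinearMap.baseChange_comp (A := S) _ _).symm.trans ?_
    rw [w.ψ_dmf]
    exact LinearMap.baseChange_comp _ _
  φ_dchi := by
    obtain ⟨h, hh⟩ := w.φ_dchi
    refine ⟨h.baseChange S, (LinearMap.baseChange_comp (A := S) _ _).symm.trans ?_⟩
    rw [hh, LinearMap.baseChange_add, LinearMap.baseChange_add, LinearMap.baseChange_comp,
      LinearMap.baseChange_comp, LinearMap.baseChange_comp]
    rfl
  ψ_dchi := by
    obtain ⟨h, hh⟩ := w.ψ_dchi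
    refine ⟨h.baseChange S, (LinearMap.baseChange_comp (A := S) _ _).symm.trans ?_⟩
    rw [hh, LinearMap.baseChange_add, LinearMap.baseChange_add, LinearMap.baseChange_comp,
      LinearMap.baseChange_comp, LinearMap.baseChange_comp]
    rfl
  ψ_φ := by
    obtain ⟨h, hh⟩ := w.ψ_φ
    refine ⟨h.baseChange S, (LinearMap.baseChange_comp (A := S) _ _).symm.trans ?_⟩
    rw [hh, LinearMap.baseChange_add, LinearMap.baseChange_add, LinearMap.baseChange_comp,
      LinearMap.baseChange_comp, LinearMap.baseChange_id]
    rfl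
  φ_ψ := by
    obtain ⟨h, hh⟩ := w.φ_ψ
    refine ⟨h.baseChange S, (LinearMap.baseChange_comp (A := S) _ _).symm.trans ?_⟩
    rw [hh, LinearMap.baseChange_add, LinearMap.baseChange_add, LinearMap.baseChange_comp,
      LinearMap.baseChange_comp, LinearMap.baseChange_id]
    rfl
  φ_homog := baseChange_mem_homog w.φ_homog
  ψ_homog := baseChange_mem_homog w.ψ_homog

/-- Extension of scalars of a complex with two terms. -/
def WeakEquiv.twoTermBaseChange {gr : ℤ × ℤ → AddSubgroup S} {P Q : GradedMF R}
    {P' Q' : GradedMF S} (b : BCIso gr P P') (c : BCIso gr Q Q') (i₀ : ℤ)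
    (f : P.carrier →ₗ[R] Q.carrier)
    (hf : f ∘ₗ P.d = Q.d ∘ₗ f) (hs : f ∘ₗ P.sgn = Q.sgn ∘ₗ f)
    (hf' : b.map c f ∘ₗ P'.d = Q'.d ∘ₗ b.map c f)
    (hs' : b.map c f ∘ₗ P'.sgn = Q'.sgn ∘ₗ b.map c f) :
    WeakEquiv ((MFComplex.twoTerm i₀ P Q f hf hs).baseChange gr)
      (MFComplex.twoTerm i₀ P' Q' (b.map c f) hf' hs') :=
  let e : S ⊗[R] (P.carrier × Q.carrier) ≃ₗ[S] P'.carrier × Q'.carrier :=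
    TensorProduct.prodRight R S S P.carrier Q.carrier ≪≫ₗ b.e.prodCongr c.e
  have he : ∀ s x y, e (s ⊗ₜ (x, y)) = (b.e (s ⊗ₜ x), c.e (s ⊗ₜ y)) := fun s x y => rfl
  have h1 : ∀ z, e (((P.d.prodMap Q.d).baseChange S) z) = P'.d.prodMap Q'.d (e z) := fun z => by
    induction z using TensorProduct.induction_on with
    | zero => rw [map_zero, map_zero, map_zero]
    | add x y hx hy => rw [map_add, map_add, map_add, map_add, hx, hy]
    | tmul s x =>
      obtain ⟨x, y⟩ := x
      have h1 := b.d (s ⊗ₜ x)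
      have h2 := c.d (s ⊗ₜ y)
      rw [LinearMap.baseChange_tmul] at h1 h2 ⊢
      rw [he, LinearMap.prodMap_apply, LinearMap.prodMap_apply, he, h1, h2]
  have h2 : ∀ z, e (((LinearMap.inr R P.carrier Q.carrier ∘ₗ f ∘ₗ
      LinearMap.fst R P.carrier Q.carrier).baseChange S) z) =
      (LinearMap.inr S P'.carrier Q'.carrier ∘ₗ (b.map c f) ∘ₗ
        LinearMap.fst S P'.carrier Q'.carrier) (e z) := fun z => by
    induction z using TensorProduct.induction_on with
    | zero => rw [map_zero, map_zero, map_zero]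
    | add x y hx hy => rw [map_add, map_add, map_add, map_add, hx, hy]
    | tmul s x =>
      obtain ⟨x, y⟩ := x
      have h1 := b.map_apply c f (s ⊗ₜ x)
      rw [LinearMap.baseChange_tmul] at h1 ⊢
      rw [he]
      refine (he s 0 (f x)).trans (Prod.ext ?_ h1.symm)
      rw [TensorProduct.tmul_zero, map_zero]
      rfl
  { φ := e.toLinearMap
    ψ := e.symm.toLinearMap
    φ_dmf := LinearMap.ext h1
    ψ_dmf := LinearMap.ext fun x => by
      obtain ⟨z, rfl⟩ := e.surjective x
      refine e.injective ((e.apply_symm_apply _).trans ((h1 z).symm.trans ?_))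
      exact congrArg e (congrArg _ (e.symm_apply_apply z).symm)
    φ_dchi := ⟨0, LinearMap.ext fun z => (h2 z).trans (by
      rw [LinearMap.comp_zero, LinearMap.zero_comp, add_zero, add_zero]
      rfl)⟩
    ψ_dchi := ⟨0, LinearMap.ext fun x => by
      obtain ⟨z, rfl⟩ := e.surjective x
      rw [LinearMap.comp_zero, LinearMap.zero_comp, add_zero, add_zero]
      refine e.injective ((e.apply_symm_apply _).trans ((h2 z).symm.trans ?_))
      exact congrArg e (congrArg _ (e.symm_apply_apply z).symm)⟩
    ψ_φ := ⟨0, LinearMap.ext fun z => by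
      rw [LinearMap.comp_zero, LinearMap.zero_comp, add_zero, add_zero]
      exact e.symm_apply_apply z⟩
    φ_ψ := ⟨0, LinearMap.ext fun x => by
      rw [LinearMap.comp_zero, LinearMap.zero_comp, add_zero, add_zero]
      exact e.apply_symm_apply x⟩
    φ_homog := fun ε i d z hz => by
      refine (AddSubgroup.closure_le
        (((MFComplex.twoTerm i₀ P' Q' (b.map c f) hf' hs').homog ε i d).comap
          e.toLinearMap.toAddMonoidHom)).2 ?_ hz
      rintro _ ⟨d₁, d₂, s, ⟨x, y⟩, rfl, hs, hm, rfl⟩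
      have hm := mem_twoTerm.1 hm
      refine mem_twoTerm.2 ?_
      obtain ⟨hx, hy⟩ := hm
      constructor
      · split_ifs at hx ⊢ with h
        · exact (b.homog _ _ _).1 (AddSubgroup.subset_closure ⟨d₁, d₂, s, x, rfl, hs, hx, rfl⟩)
        · rw [hx]
          exact (congrArg b.e (TensorProduct.tmul_zero _ _)).trans (map_zero _)
      · split_ifs at hy ⊢ with h
        · exact (c.homog _ _ _).1 (AddSubgroup.subset_closure ⟨d₁, d₂, s, y, rfl, hs, hy, rfl⟩)
        · rw [hy]
          exact (congrArg c.e (TensorProduct.tmul_zero _ _)).trans (map_zero _)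
    ψ_homog := fun ε i d x hx => by
      obtain ⟨x, y⟩ := x
      obtain ⟨u, rfl⟩ := b.e.surjective x
      obtain ⟨v, rfl⟩ := c.e.surjective y
      -- Homogeneity of a preimage is checked on the two summands separately, so the preimage is
      -- split along the inclusions of `P` and `Q`.
      have huv : e.symm (b.e u, c.e v) = (LinearMap.inl R P.carrier Q.carrier).baseChange S u +
          (LinearMap.inr R P.carrier Q.carrier).baseChange S v := by
        rw [LinearEquiv.symm_apply_eq, map_add]
        have hu : ∀ u, e ((LinearMap.inl R P.carrier Q.carrier).baseChange S u) = (b.e u, 0) := by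
          intro u
          induction u using TensorProduct.induction_on with
          | zero => rw [map_zero, map_zero, map_zero]; rfl
          | add x y hx hy => rw [map_add, map_add, map_add, hx, hy, Prod.mk_add_mk, add_zero]
          | tmul s x =>
            rw [LinearMap.baseChange_tmul]
            refine (he s x 0).trans ?_
            rw [TensorProduct.tmul_zero, map_zero]
        have hv : ∀ v, e ((LinearMap.inr R P.carrier Q.carrier).baseChange S v) = (0, c.e v) := by
          intro v
          induction v using TensorProduct.induction_on with
          | zero => rw [map_zero, map_zero, map_zero]; rfl
          | add x y hx hy => rw [map_add, map_add, map_add, hx, hy, Prod.mk_add_mk, add_zero]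
          | tmul s x =>
            rw [LinearMap.baseChange_tmul]
            refine (he s 0 x).trans ?_
            rw [TensorProduct.tmul_zero, map_zero]
        rw [hu, hv, Prod.mk_add_mk, add_zero, zero_add]
      refine (congrArg (· ∈ ((MFComplex.twoTerm i₀ P Q f hf hs).baseChange gr).homog ε i d)
        huv).mpr ?_
      obtain ⟨hx, hy⟩ := mem_twoTerm.1 hx
      refine add_mem ?_ ?_
      · split_ifs at hx with h
        · refine (AddSubgroup.closure_le
            (((((MFComplex.twoTerm i₀ P Q f hf hs).baseChange gr).homog ε i d)).comap
              ((LinearMap.inl R P.carrier Q.carrier).baseChange S).toAddMonoidHom)).2 ?_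
            ((b.homog _ _ _).2 hx)
          rintro _ ⟨d₁, d₂, s, m, rfl, hs, hm, rfl⟩
          refine AddSubgroup.subset_closure ⟨d₁, d₂, s, (m, 0), rfl, hs, mem_twoTerm.2 ⟨?_, ?_⟩,
            LinearMap.baseChange_tmul _ _ _⟩
          · rwa [if_pos h]
          · rw [if_neg (by omega)]
        · rw [(map_eq_zero_iff _ b.e.injective).1 hx, map_zero]
          exact zero_mem _
      · split_ifs at hy with h
        · refine (AddSubgroup.closure_le
            (((((MFComplex.twoTerm i₀ P Q f hf hs).baseChange gr).homog ε i d)).comap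
              ((LinearMap.inr R P.carrier Q.carrier).baseChange S).toAddMonoidHom)).2 ?_
            ((c.homog _ _ _).2 hy)
          rintro _ ⟨d₁, d₂, s, m, rfl, hs, hm, rfl⟩
          refine AddSubgroup.subset_closure ⟨d₁, d₂, s, (0, m), rfl, hs, mem_twoTerm.2 ⟨?_, ?_⟩,
            LinearMap.baseChange_tmul _ _ _⟩
          · rw [if_neg (by omega)]
          · rwa [if_pos h]
        · rw [(map_eq_zero_iff _ c.e.injective).1 hy, map_zero]
          exact zero_mem _ }

end TwoTerm

/-! ### Complete symmetric polynomials in two indeterminates -/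

section HSum

variable {A : Type} [CommRing A]

theorem hSum_zero (x y : A) : hSum 0 x y = 1 := by simp [hSum]

theorem hSum_succ (n : ℕ) (x y : A) : hSum (n + 1) x y = x ^ (n + 1) + y * hSum n x y := by
  rw [hSum, Finset.sum_range_succ, Nat.sub_self, pow_zero, mul_one, add_comm, hSum, Finset.mul_sum]
  congr 1
  refine Finset.sum_congr rfl fun i hi => ?_
  rw [Nat.succ_sub (by simpa [Nat.lt_succ_iff] using hi), pow_succ]
  ring

theorem hSum_succ' (n : ℕ) (x y : A) : hSum (n + 1) x y = y ^ (n + 1) + x * hSum n x y := by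
  linear_combination hSum_succ n x y - hSum_spec n x y

theorem hSum_self (n : ℕ) (x : A) : hSum n x x = ((n : A) + 1) * x ^ n := by
  induction n with
  | zero => simp [hSum]
  | succ n ih =>
    rw [hSum_succ, ih]
    push_cast
    ring

/-- This is Newton's recurrence `p_{n+3} = X₁ p_{n+2} - X₂ p_{n+1}` differentiated with respect to
`X₁`, in the form `∂p_{m+1}/∂X₁ = (m+1) h_m`. -/
theorem hSum_recurrence (n : ℕ) (x y : A) : ((n : A) + 3) * hSum (n + 2) x y =
    (x + y) * (((n : A) + 2) * hSum (n + 1) x y) + (x ^ (n + 2) + y ^ (n + 2)) -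
      x * y * (((n : A) + 1) * hSum n x y) := by
  rw [hSum_succ (n + 1), hSum_succ' n]
  have h := hSum_spec n x y
  linear_combination (-(n : A) - 2) * x * h

/-- On the diagonal the difference quotient is the derivative `∂p_{n+1}/∂X₁`, and it satisfies the
same recurrence as `(n+1) h_n`. -/
theorem quot1_self (x y : A) : ∀ n : ℕ,
    quot1 (x + y) (x * y) (x + y) (n + 1) = ((n : A) + 1) * hSum n x y
  | 0 => by simp [quot1, hSum]
  | 1 => by simp [quot1, pow2, hSum, Finset.sum_range_succ]; ring
  | n + 2 => by
    rw [quot1, quot1_self x y (n + 1), quot1_self x y n, pow2_spec]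
    push_cast
    linear_combination -hSum_recurrence n x y

/-- Likewise the derivative `∂p_{n+2}/∂X₂ = -(n+2) h_n`. -/
theorem quot2_self (x y : A) : ∀ n : ℕ,
    quot2 (x * y) (x + y) (x * y) (n + 2) = -(((n : A) + 2) * hSum n x y)
  | 0 => by simp [quot2, pow2, hSum]
  | 1 => by simp [quot2, pow2, hSum, Finset.sum_range_succ]; ring
  | n + 2 => by
    rw [quot2, quot2_self x y (n + 1), quot2_self x y n, pow2_spec]
    push_cast
    linear_combination hSum_recurrence n x y + hSum_succ (n + 1) x y - x * hSum_succ n x y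

end HSum

/-! ### Coprime pairs -/

section Coprime

variable {A : Type} [CommRing A]

/-- The syzygies of `(α, β)` are the multiples of the obvious one. -/
def Coprimal (α β : A) : Prop := ∀ q r, α * r = β * q → ∃ p, q = α * p ∧ r = β * p

theorem coprimal_pow [IsDomain A] {x y : A} (hx : Prime x) (hxy : ¬x ∣ y) (n : ℕ) :
    Coprimal (x ^ n) (y ^ n) := by
  intro q r h
  have h1 : x ^ n ∣ y ^ n * q := ⟨r, h.symm⟩
  obtain ⟨p, rfl⟩ := hx.pow_dvd_of_dvd_mul_left n (fun h => hxy (hx.dvd_of_dvd_pow h)) h1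
  refine ⟨p, rfl, mul_left_cancel₀ (pow_ne_zero n hx.ne_zero) ?_⟩
  rw [h]
  ring

/-- Modulo `x` the polynomial `h_n` is `y^n`. -/
theorem not_dvd_hSum {x y : A} (hx : Prime x) (hxy : ¬x ∣ y) (n : ℕ) : ¬x ∣ hSum n x y := by
  cases n with
  | zero =>
    rw [hSum_zero]
    exact fun h => hx.not_isUnit (isUnit_of_dvd_one h)
  | succ n =>
    rw [hSum_succ']
    intro h
    exact hxy (hx.dvd_of_dvd_pow ((dvd_add_left (dvd_mul_right x _)).1 h))

theorem coprimal_pow_hSum [IsDomain A] {x y : A} (hx : Prime x) (hxy : ¬x ∣ y) (n m : ℕ) :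
    Coprimal (x ^ n) (hSum m x y) := by
  intro q r h
  have h1 : x ^ n ∣ hSum m x y * q := ⟨r, h.symm⟩
  obtain ⟨p, rfl⟩ := hx.pow_dvd_of_dvd_mul_left n (not_dvd_hSum hx hxy m) h1
  refine ⟨p, rfl, mul_left_cancel₀ (pow_ne_zero n hx.ne_zero) ?_⟩
  rw [h]
  ring

/-- Since `h_{n+1} = x^{n+1} + y h_n`, a change of basis reduces the syzygies to those of `(x^{n+1},
h_n)`, and `x` is a prime not dividing `h_n`. -/
theorem coprimal_hSum [IsDomain A] {x y : A} (hx : Prime x) (hxy : ¬x ∣ y) (n : ℕ) :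
    Coprimal (hSum (n + 1) x y) (-hSum n x y) := by
  intro q r h
  rw [hSum_succ] at h ⊢
  obtain ⟨p, h1, h2⟩ := coprimal_pow_hSum hx hxy (n + 1) n (-(q + y * r)) r
    (by linear_combination h)
  exact ⟨-p, by linear_combination -h1 - y * h2, by linear_combination h2⟩

theorem Coprimal.smul {α β u : A} (h : Coprimal α β) (hu : IsUnit u) :
    Coprimal (u * α) (u * β) := by
  intro q r hqr
  obtain ⟨p, rfl, rfl⟩ := h q r (hu.mul_left_cancel (by linear_combination hqr))
  obtain ⟨v, rfl⟩ := hu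
  refine ⟨↑v⁻¹ * p, ?_, ?_⟩ <;> linear_combination (-_ * p) * v.mul_inv

end Coprime

theorem GrProj.mem_of_mul_mem {A : Type} [CommRing A] [IsDomain A] {gr : ℤ × ℤ → AddSubgroup A}
    (P : GrProj gr) {d e : ℤ × ℤ} {r f : A} (hr0 : r ≠ 0) (hr : r ∈ gr e) (h : r * f ∈ gr d) :
    f ∈ gr (d - e) := by
  have h1 := P.mul d f hr
  rw [P.eq_self h] at h1
  rw [mul_left_cancel₀ hr0 h1]
  exact P.mem _ _

/-- Projecting a relation `t = r f + r' g` to the degree of `t` replaces the coefficients by their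
components of matching degree. -/
theorem GrProj.exists_mem {A : Type} [CommRing A] {gr : ℤ × ℤ → AddSubgroup A}
    (P : GrProj gr) {d e e' : ℤ × ℤ} {r r' t f g : A} (hr : r ∈ gr e) (hr' : r' ∈ gr e')
    (ht : t ∈ gr d) (h : t = r * f + r' * g) : ∃ f' ∈ gr (d - e), ∃ g', t = r * f' + r' * g' := by
  refine ⟨P.pr (d - e) f, P.mem _ _, P.pr (d - e') g, ?_⟩
  rw [← P.mul d f hr, ← P.mul d g hr', ← map_add, ← h, P.eq_self ht]

/-! ### Koszul matrix factorizations with rows `(a α, 0)` and `(a β, 0)` -/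

section Diagonal

variable {A : Type} [CommRing A]

/-- The rows `(a α, 0)` and `(a β, 0)`. -/
def diagRows (a α β : A) (d₀ d₁ : ℤ × ℤ) : Fin 2 → KRow A := ![⟨a * α, 0, d₀⟩, ⟨a * β, 0, d₁⟩]

theorem kosD_diagRows (a α β : A) (d₀ d₁ : ℤ × ℤ) (p q r t : A) :
    kosD (diagRows a α β d₀ d₁) (vec p q r t) =
      vec 0 (a * (α * p)) (a * (β * p)) (a * (α * r - β * q)) := by
  rw [kosD_vec]
  simp only [diagRows, Matrix.cons_val_zero, Matrix.cons_val_one]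
  congr 1 <;> ring

theorem vec_zero_eq : vec 0 0 0 0 = (0 : Finset (Fin 2) → A) := by
  rw [eq_vec (0 : Finset (Fin 2) → A)]
  rfl

variable [IsDomain A]

/-- The even components force `p = 0`. The top component is the syzygy condition `α r = β q`, solved
by coprimality. The coordinate `t` remains free. -/
theorem kosD_diagRows_eq_zero {a α β : A} (ha : a ≠ 0) (hα : α ≠ 0) (hc : Coprimal α β)
    {d₀ d₁ : ℤ × ℤ} {p q r t : A} :
    kosD (diagRows a α β d₀ d₁) (vec p q r t) = 0 ↔
      p = 0 ∧ ∃ k, q = α * k ∧ r = β * k := by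
  rw [kosD_diagRows, ← vec_zero_eq]
  constructor
  · intro h
    obtain ⟨-, h1, -, h2⟩ := vec_inj h
    refine ⟨?_, hc q r ?_⟩
    · simpa [ha, hα] using h1
    · simpa [ha, sub_eq_zero] using h2
  · rintro ⟨rfl, k, rfl, rfl⟩
    congr 1 <;> ring

/-- The bidegree of the top generator of a Koszul matrix factorization with two rows. -/
def topDeg (N : ℕ) (d₀ d₁ : ℤ × ℤ) : ℤ × ℤ := ((1, (N : ℤ) + 1) - d₀) + ((1, (N : ℤ) + 1) - d₁)

variable {gr : ℤ × ℤ → AddSubgroup A} {a α β α' β' : A} {d₀ d₁ d₀' d₁' δ : ℤ × ℤ} {N : ℕ}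
  {f : (Finset (Fin 2) → A) →ₗ[A] (Finset (Fin 2) → A)}

/-- The top generator is an even cycle, and every even cycle of the target is a multiple of its top
generator; the degrees prescribe that of the factor. -/
theorem map_top (hg : IsGr gr) (ha : a ≠ 0) (hα' : α' ≠ 0) (hc' : Coprimal α' β')
    (hf : ∀ v, f (kosD (diagRows a α β d₀ d₁) v) = kosD (diagRows a α' β' d₀' d₁') (f v))
    (hd : ∀ ε d v, v ∈ kosHomog N gr (diagRows a α β d₀ d₁) ε d →
      f v ∈ kosHomog N gr (diagRows a α' β' d₀' d₁') ε (d + δ)) :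
    ∃ c ∈ gr (topDeg N d₀ d₁ + δ - topDeg N d₀' d₁'), ∀ t, f (vec 0 0 0 t) = vec 0 0 0 (c * t) := by
  have h1 : vec 0 0 0 1 ∈ kosHomog N gr (diagRows a α β d₀ d₁) 0 (topDeg N d₀ d₁) := by
    rw [vec_mem_zero]
    exact ⟨zero_mem _, rfl, rfl, mem_congr hg.one (sub_self (topDeg N d₀ d₁)).symm⟩
  have h2 := hd _ _ _ h1
  have h3 := hf (vec 0 0 0 1)
  rw [eq_vec (f (vec 0 0 0 1))] at h2 h3
  rw [vec_mem_zero] at h2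
  have h4 : kosD (diagRows a α β d₀ d₁) (vec 0 0 0 1) = 0 := by
    rw [kosD_diagRows, ← vec_zero_eq]
    congr 1 <;> ring
  rw [h4, map_zero] at h3
  have h5 := ((kosD_diagRows_eq_zero ha hα' hc').1 h3.symm).1
  refine ⟨f (vec 0 0 0 1) {0, 1}, h2.2.2.2, fun t => ?_⟩
  have h6 : f (vec 0 0 0 1) = vec 0 0 0 (f (vec 0 0 0 1) {0, 1}) := by
    conv_lhs => rw [eq_vec (f (vec 0 0 0 1)), h5, h2.2.1, h2.2.2.1]
  have h7 : vec 0 0 0 t = t • vec 0 0 0 (1 : A) := by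
    rw [smul_vec]
    congr 1 <;> ring
  rw [h7, map_smul, h6, smul_vec, vec_univ]
  congr 1 <;> ring

/-- The syzygy `(α, β)` is an odd cycle, homogeneous because of `he`, and the odd cycles of the
target are the multiples of `(α', β')`. -/
theorem map_syzygy (P : GrProj gr) (ha : a ≠ 0) (hα' : α' ≠ 0)
    (hc' : Coprimal α' β') {e₀ e₁ e₀' : ℤ × ℤ}
    (h₀ : α ∈ gr e₀) (h₁ : β ∈ gr e₁) (he : e₀ - d₀ = e₁ - d₁) (h₀' : α' ∈ gr e₀')
    (hf : ∀ v, f (kosD (diagRows a α β d₀ d₁) v) = kosD (diagRows a α' β' d₀' d₁') (f v))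
    (hd : ∀ ε d v, v ∈ kosHomog N gr (diagRows a α β d₀ d₁) ε d →
      f v ∈ kosHomog N gr (diagRows a α' β' d₀' d₁') ε (d + δ)) :
    ∃ c ∈ gr (e₀ - d₀ + δ - (e₀' - d₀')), ∀ k, f (vec 0 (α * k) (β * k) 0) =
      vec 0 (α' * (c * k)) (β' * (c * k)) 0 := by
  have h1 : vec 0 α β 0 ∈ kosHomog N gr (diagRows a α β d₀ d₁) 1
      (e₀ + ((1, (N : ℤ) + 1) - d₀)) := by
    rw [vec_mem_one]
    refine ⟨rfl, mem_congr h₀ (add_sub_cancel_right _ _).symm, mem_congr h₁ ?_, rfl⟩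
    change e₁ = e₀ + ((1, (N : ℤ) + 1) - d₀) - ((1, (N : ℤ) + 1) - d₁)
    rw [show e₀ + ((1, (N : ℤ) + 1) - d₀) - ((1, (N : ℤ) + 1) - d₁) = e₀ - d₀ + d₁ by abel, he,
      sub_add_cancel]
  have h2 := hd _ _ _ h1
  have h3 := hf (vec 0 α β 0)
  rw [eq_vec (f (vec 0 α β 0))] at h2 h3
  rw [vec_mem_one] at h2
  have h4 : kosD (diagRows a α β d₀ d₁) (vec 0 α β 0) = 0 := by
    rw [kosD_diagRows, ← vec_zero_eq]
    congr 1 <;> ring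
  rw [h4, map_zero] at h3
  obtain ⟨h5, c, hc1, hc2⟩ := (kosD_diagRows_eq_zero ha hα' hc').1 h3.symm
  obtain ⟨g1, g2, -, g4⟩ := h2
  refine ⟨c, ?_, fun k => ?_⟩
  · rw [hc1] at g2
    refine mem_congr (P.mem_of_mul_mem hα' h₀' g2) ?_
    change e₀ + ((1, (N : ℤ) + 1) - d₀) + δ - ((1, (N : ℤ) + 1) - d₀') - e₀' =
      e₀ - d₀ + δ - (e₀' - d₀')
    abel
  · have h6 : f (vec 0 α β 0) = vec 0 (α' * c) (β' * c) 0 := by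
      conv_lhs => rw [eq_vec (f (vec 0 α β 0)), g1, hc1, hc2, g4]
    have h7 : vec 0 (α * k) (β * k) 0 = k • vec 0 α β 0 := by
      rw [smul_vec]
      congr 1 <;> ring
    rw [h7, map_smul, h6, smul_vec]
    congr 1 <;> ring

end Diagonal

/-! ### The maps of the negative stabilization -/

/-- The properties of the ring `ℚ[a, x, y]` that determine the homology of the negative
stabilization of the unknot. -/
structure TwoVar (A : Type) [CommRing A] where
  gr : ℤ × ℤ → AddSubgroup A
  a : A
  x : A
  y : A
  isGr : IsGr gr
  proj : GrProj gr
  a_mem : a ∈ gr (2, 0)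
  x_mem : x ∈ gr (0, 2)
  y_mem : y ∈ gr (0, 2)
  prime_a : Prime a
  prime_x : Prime x
  not_x_dvd : ¬x ∣ y
  not_a_dvd : ¬a ∣ y - x
  isUnit_of_mem : ∀ c ∈ gr 0, c = 0 ∨ IsUnit c
  isUnit_natCast : ∀ n : ℕ, IsUnit ((n : A) + 2)

namespace TwoVar

variable {A : Type} [CommRing A] (T : TwoVar A) (M : ℕ)

/-- The rows of the closure of the resolution with two arcs. -/
def rows0 : Fin 2 → KRow A :=
  diagRows T.a (((M : A) + 2) * T.x ^ (M + 1)) (((M : A) + 2) * T.y ^ (M + 1))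
    (2, 2 * ((M + 1 : ℕ) : ℤ)) (2, 2 * ((M + 1 : ℕ) : ℤ))

/-- The rows of the closure of the resolution with a wide edge. -/
def rows1 : Fin 2 → KRow A :=
  diagRows T.a (((M : A) + 2) * hSum (M + 1) T.x T.y) (((M : A) + 2) * -hSum M T.x T.y)
    (2, 2 * ((M + 1 : ℕ) : ℤ)) (2, 2 * ((M + 1 : ℕ) : ℤ) - 2)

theorem natCast_add_two_mem : (M : A) + 2 ∈ T.gr 0 := by
  have := natCast_mem T.isGr (M + 2)
  push_cast at this
  exact this

theorem mul_mem_of_zero {c f : A} {d : ℤ × ℤ} (hc : c ∈ T.gr 0) (hf : f ∈ T.gr d) :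
    c * f ∈ T.gr d := mem_congr (T.isGr.mul hc hf) (zero_add d)

theorem α₀_mem : ((M : A) + 2) * T.x ^ (M + 1) ∈ T.gr (0, 2 * (M + 1 : ℕ)) :=
  T.mul_mem_of_zero (T.natCast_add_two_mem M)
    (mem_congr (T.isGr.pow T.x_mem (M + 1)) (by ext <;> simp [mul_comm]))

theorem β₀_mem : ((M : A) + 2) * T.y ^ (M + 1) ∈ T.gr (0, 2 * (M + 1 : ℕ)) :=
  T.mul_mem_of_zero (T.natCast_add_two_mem M)
    (mem_congr (T.isGr.pow T.y_mem (M + 1)) (by ext <;> simp [mul_comm]))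

theorem α₁_mem : ((M : A) + 2) * hSum (M + 1) T.x T.y ∈ T.gr (0, 2 * (M + 1 : ℕ)) :=
  T.mul_mem_of_zero (T.natCast_add_two_mem M) (hSum_mem T.isGr T.x_mem T.y_mem (M + 1))

theorem β₁_mem : ((M : A) + 2) * -hSum M T.x T.y ∈ T.gr (0, 2 * M) :=
  T.mul_mem_of_zero (T.natCast_add_two_mem M) (neg_mem (hSum_mem T.isGr T.x_mem T.y_mem M))

variable [IsDomain A]

theorem α₀_ne_zero : ((M : A) + 2) * T.x ^ (M + 1) ≠ 0 :=
  mul_ne_zero (T.isUnit_natCast M).ne_zero (pow_ne_zero _ T.prime_x.ne_zero)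

theorem α₁_ne_zero : ((M : A) + 2) * hSum (M + 1) T.x T.y ≠ 0 :=
  mul_ne_zero (T.isUnit_natCast M).ne_zero
    fun h => not_dvd_hSum T.prime_x T.not_x_dvd (M + 1) (h ▸ dvd_zero _)

theorem coprimal₀ : Coprimal (((M : A) + 2) * T.x ^ (M + 1)) (((M : A) + 2) * T.y ^ (M + 1)) :=
  (coprimal_pow T.prime_x T.not_x_dvd (M + 1)).smul (T.isUnit_natCast M)

theorem coprimal₁ :
    Coprimal (((M : A) + 2) * hSum (M + 1) T.x T.y) (((M : A) + 2) * -hSum M T.x T.y) :=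
  (coprimal_hSum T.prime_x T.not_x_dvd M).smul (T.isUnit_natCast M)

end TwoVar

/-- The small model of the closure of a pair of `χ`-morphisms. -/
structure ChiModel {A : Type} [CommRing A] (T : TwoVar A) (M : ℕ) where
  f₀ : (Finset (Fin 2) → A) →ₗ[A] (Finset (Fin 2) → A)
  f₁ : (Finset (Fin 2) → A) →ₗ[A] (Finset (Fin 2) → A)
  h : (Finset (Fin 2) → A) →ₗ[A] (Finset (Fin 2) → A)
  f₀_d : ∀ v, f₀ (kosD (T.rows0 M) v) = kosD (T.rows1 M) (f₀ v)
  f₀_sgn : ∀ v, f₀ (kosSgn A 2 v) = kosSgn A 2 (f₀ v)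
  f₀_mem : ∀ ε d v, v ∈ kosHomog (M + 1) T.gr (T.rows0 M) ε d →
    f₀ v ∈ kosHomog (M + 1) T.gr (T.rows1 M) ε (d + (0, 2))
  f₁_d : ∀ v, f₁ (kosD (T.rows1 M) v) = kosD (T.rows0 M) (f₁ v)
  f₁_mem : ∀ ε d v, v ∈ kosHomog (M + 1) T.gr (T.rows1 M) ε d →
    f₁ v ∈ kosHomog (M + 1) T.gr (T.rows0 M) ε (d + 0)
  homotopy : ∀ v, f₁ (f₀ v) - (T.y - T.x) • v =
    kosD (T.rows0 M) (h v) + h (kosD (T.rows0 M) v)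

namespace ChiModel

variable {A : Type} [CommRing A] [IsDomain A] {T : TwoVar A} {M : ℕ} (χ : ChiModel T M)

/-- The factor has bidegree `0`, hence is zero or a unit. If it were zero, the homotopy applied to
the top generator would exhibit `y - x` as a multiple of `a`. -/
theorem exists_map_top :
    ∃ c, IsUnit c ∧ ∀ t, χ.f₀ (vec 0 0 0 t) = vec 0 0 0 (c * t) := by
  obtain ⟨c, hc, hc'⟩ := map_top T.isGr T.prime_a.ne_zero (T.α₁_ne_zero M) (T.coprimal₁ M)
    χ.f₀_d χ.f₀_mem
  refine ⟨c, (T.isUnit_of_mem c (mem_congr hc ?_)).resolve_left ?_, hc'⟩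
  · simp only [topDeg]
    ext <;> simp; ring
  · rintro rfl
    have h1 := χ.homotopy (vec 0 0 0 1)
    have h2 : kosD (T.rows0 M) (vec 0 0 0 1) = 0 :=
      (kosD_diagRows_eq_zero T.prime_a.ne_zero (T.α₀_ne_zero M) (T.coprimal₀ M)).2
        ⟨rfl, 0, (mul_zero _).symm, (mul_zero _).symm⟩
    rw [hc', h2, zero_mul, vec_zero_eq, map_zero, map_zero, add_zero, zero_sub,
      eq_vec (χ.h (vec 0 0 0 1)), TwoVar.rows0, kosD_diagRows] at h1
    have h3 := congrFun h1 {0, 1}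
    rw [vec_univ, Pi.neg_apply, Pi.smul_apply, vec_univ, smul_eq_mul, mul_one] at h3
    exact T.not_a_dvd (dvd_neg.1 ⟨_, h3⟩)

/-- On syzygies it is the factor `c` of `f₁` that has bidegree `0`. The homotopy gives `c l = y - x`
modulo `a`; since `a` does not divide `y - x`, `c` is a unit and `l` is `y - x` up to a unit modulo
`a`. -/
theorem exists_map_syzygy :
    ∃ c l p, IsUnit c ∧ c * l = T.y - T.x + T.a * p ∧
      ∀ k, χ.f₀ (vec 0 (((M : A) + 2) * T.x ^ (M + 1) * k) (((M : A) + 2) * T.y ^ (M + 1) * k) 0) =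
        vec 0 (((M : A) + 2) * hSum (M + 1) T.x T.y * (l * k))
          (((M : A) + 2) * -hSum M T.x T.y * (l * k)) 0 := by
  obtain ⟨l, -, hl⟩ := map_syzygy T.proj T.prime_a.ne_zero (T.α₁_ne_zero M)
    (T.coprimal₁ M) (T.α₀_mem M) (T.β₀_mem M) rfl (T.α₁_mem M) χ.f₀_d χ.f₀_mem
  obtain ⟨c, hc, hc'⟩ := map_syzygy T.proj T.prime_a.ne_zero (T.α₀_ne_zero M)
    (T.coprimal₀ M) (T.α₁_mem M) (T.β₁_mem M) (by ext <;> simp; ring) (T.α₀_mem M) χ.f₁_d χ.f₁_mem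
  have h1 := χ.homotopy (vec 0 (((M : A) + 2) * T.x ^ (M + 1) * 1)
    (((M : A) + 2) * T.y ^ (M + 1) * 1) 0)
  have h2 : kosD (T.rows0 M) (vec 0 (((M : A) + 2) * T.x ^ (M + 1) * 1)
      (((M : A) + 2) * T.y ^ (M + 1) * 1) 0) = 0 :=
    (kosD_diagRows_eq_zero T.prime_a.ne_zero (T.α₀_ne_zero M) (T.coprimal₀ M)).2
      ⟨rfl, 1, rfl, rfl⟩
  rw [h2, hl, hc', map_zero, add_zero, smul_vec, vec_sub, eq_vec (χ.h _), TwoVar.rows0,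
    kosD_diagRows] at h1
  have h3 := congrFun h1 {0}
  rw [vec_zero, vec_zero] at h3
  generalize χ.h (vec _ _ _ _) ∅ = p at h3
  -- In this component every term is a multiple of the first entry of the syzygy, which can be
  -- cancelled.
  have h4 : ∃ p, c * l = T.y - T.x + T.a * p :=
    ⟨p, mul_left_cancel₀ (T.α₀_ne_zero M) (by linear_combination h3)⟩
  obtain ⟨p, hp⟩ := h4
  refine ⟨c, l, p, (T.isUnit_of_mem c (mem_congr hc ?_)).resolve_left ?_, hp, hl⟩
  · ext <;> simp
  · rintro rfl
    exact T.not_a_dvd ⟨-p, by linear_combination -hp⟩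

end ChiModel

/-! ### The homology of the negative stabilization -/

section TwoTerm

variable {R : Type} [CommRing R] {P Q : GradedMF R} {i₀ : ℤ} {f : P.carrier →ₗ[R] Q.carrier}
  {hf : f ∘ₗ P.d = Q.d ∘ₗ f} {hs : f ∘ₗ P.sgn = Q.sgn ∘ₗ f} {x : P.carrier} {y : Q.carrier}

theorem mem_cyc_twoTerm : (x, y) ∈ (MFComplex.twoTerm i₀ P Q f hf hs).cyc ↔
    P.d x = 0 ∧ Q.d y = 0 ∧ ∃ z, Q.d z = f x := by
  refine MFComplex.mem_cyc.trans ?_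
  constructor
  · rintro ⟨h1, ⟨u, z⟩, h2⟩
    exact ⟨(Prod.ext_iff.1 h1).1, (Prod.ext_iff.1 h1).2, z, (Prod.ext_iff.1 h2).2⟩
  · rintro ⟨h1, h2, z, h3⟩
    exact ⟨Prod.ext h1 h2, (0, z), Prod.ext (map_zero P.d) h3⟩

theorem mem_bd_twoTerm : (x, y) ∈ (MFComplex.twoTerm i₀ P Q f hf hs).bd ↔
    (∃ u, P.d u = x) ∧ ∃ w z, P.d z = 0 ∧ Q.d w + f z = y := by
  refine MFComplex.mem_bd.trans ?_
  constructor
  · rintro ⟨⟨u, w⟩, ⟨z, t⟩, h1, h2⟩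
    refine ⟨⟨u, ?_⟩, w, z, (Prod.ext_iff.1 h1).1, (Prod.ext_iff.1 h2).2⟩
    exact (add_zero _).symm.trans (Prod.ext_iff.1 h2).1
  · rintro ⟨⟨u, h1⟩, w, z, h2, h3⟩
    exact ⟨(u, w), (z, 0), Prod.ext h2 (map_zero Q.d),
      Prod.ext ((add_zero _).trans h1) h3⟩

end TwoTerm

namespace ChiModel

variable {A : Type} [CommRing A] {T : TwoVar A} {M : ℕ} (χ : ChiModel T M)

/-- The small model of the complex of the closure of a negative crossing. -/
def complex : MFComplex A :=
  MFComplex.twoTerm 0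
    (((koszul A (M + 1) T.gr (T.rows0 M)).flip).shift (-1) (-((M + 1 : ℕ) : ℤ) + 1))
    ((((koszul A (M + 1) T.gr (T.rows1 M)).shift 0 (-1)).flip).shift (-1) (-((M + 1 : ℕ) : ℤ)))
    χ.f₀ (LinearMap.ext χ.f₀_d) (LinearMap.ext fun v =>
      (χ.f₀.map_neg _).trans (congrArg (fun v => -v) (χ.f₀_sgn v)))

/-- The element of the complex with the components `v` and `w`. -/
def pair (v w : Finset (Fin 2) → A) : χ.complex.carrier := (v, w)

theorem exists_pair (z : χ.complex.carrier) : ∃ v w, z = χ.pair v w := ⟨z.1, z.2, rfl⟩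

theorem smul_pair (r : A) (v w : Finset (Fin 2) → A) :
    r • χ.pair v w = χ.pair (r • v) (r • w) := rfl

theorem pair_sub (v w v' w' : Finset (Fin 2) → A) :
    χ.pair v w - χ.pair v' w' = χ.pair (v - v') (w - w') := rfl

variable {χ}

theorem mem_cyc {v w : Finset (Fin 2) → A} : χ.pair v w ∈ χ.complex.cyc ↔
    kosD (T.rows0 M) v = 0 ∧ kosD (T.rows1 M) w = 0 ∧ ∃ z, kosD (T.rows1 M) z = χ.f₀ v :=
  mem_cyc_twoTerm

theorem mem_bd {v w : Finset (Fin 2) → A} : χ.pair v w ∈ χ.complex.bd ↔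
    (∃ u, kosD (T.rows0 M) u = v) ∧
      ∃ u z, kosD (T.rows0 M) z = 0 ∧ kosD (T.rows1 M) u + χ.f₀ z = w :=
  mem_bd_twoTerm

theorem mem_homog {ε : ZMod 2} {i : ℤ} {d : ℤ × ℤ} {v w : Finset (Fin 2) → A} :
    χ.pair v w ∈ χ.complex.homog ε i d ↔
      (if i = 0 then v ∈ kosHomog (M + 1) T.gr (T.rows0 M) (ε + 1)
          (d - (-1, -((M + 1 : ℕ) : ℤ) + 1))
        else v = 0) ∧
      (if i = 0 + 1 then w ∈ kosHomog (M + 1) T.gr (T.rows1 M) (ε + 1)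
        (d - (-1, -((M + 1 : ℕ) : ℤ)) - (0, -1)) else w = 0) :=
  mem_twoTerm

theorem exists_vec_of_mem_zero {N : ℕ} {gr : ℤ × ℤ → AddSubgroup A} {row : Fin 2 → KRow A}
    {d : ℤ × ℤ} {v : Finset (Fin 2) → A} (h : v ∈ kosHomog N gr row 0 d) :
    ∃ p t, v = vec p 0 0 t ∧ p ∈ gr d ∧
      t ∈ gr (d - (((1, (N : ℤ) + 1) - (row 0).deg0) + ((1, (N : ℤ) + 1) - (row 1).deg0))) := by
  rw [eq_vec v] at h
  rw [vec_mem_zero] at h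
  exact ⟨v ∅, v {0, 1}, by conv_lhs => rw [eq_vec v, h.2.1, h.2.2.1], h.1, h.2.2.2⟩

theorem exists_vec_of_mem_one {N : ℕ} {gr : ℤ × ℤ → AddSubgroup A} {row : Fin 2 → KRow A}
    {d : ℤ × ℤ} {v : Finset (Fin 2) → A} (h : v ∈ kosHomog N gr row 1 d) :
    ∃ q r, v = vec 0 q r 0 ∧ q ∈ gr (d - ((1, (N : ℤ) + 1) - (row 0).deg0)) ∧
      r ∈ gr (d - ((1, (N : ℤ) + 1) - (row 1).deg0)) := by
  rw [eq_vec v] at h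
  rw [vec_mem_one] at h
  exact ⟨v {0}, v {1}, by conv_lhs => rw [eq_vec v, h.1, h.2.2.2], h.2.1, h.2.2.1⟩

variable [IsDomain A]

theorem kosD_rows0_eq_zero {p q r t : A} : kosD (T.rows0 M) (vec p q r t) = 0 ↔
    p = 0 ∧ ∃ k, q = ((M : A) + 2) * T.x ^ (M + 1) * k ∧ r = ((M : A) + 2) * T.y ^ (M + 1) * k :=
  kosD_diagRows_eq_zero T.prime_a.ne_zero (T.α₀_ne_zero M) (T.coprimal₀ M)

theorem kosD_rows1_eq_zero {p q r t : A} : kosD (T.rows1 M) (vec p q r t) = 0 ↔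
    p = 0 ∧ ∃ k, q = ((M : A) + 2) * hSum (M + 1) T.x T.y * k ∧
      r = ((M : A) + 2) * -hSum M T.x T.y * k :=
  kosD_diagRows_eq_zero T.prime_a.ne_zero (T.α₁_ne_zero M) (T.coprimal₁ M)

/-- In the bidegree-free indices `(ε, i)`, two cases are not formal: `(0, 0)`, where multiplication
by `y - x` on `A/(a)` is injective, and `(1, 1)`, where `f₀` is surjective on top generators. -/
theorem mem_bd_of_ne {ε : ZMod 2} {i : ℤ} (h1 : ¬(ε = 1 ∧ i = 0)) (h2 : ¬(ε = 0 ∧ i = 1))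
    (d : ℤ × ℤ) (z : χ.complex.carrier) (hz : z ∈ χ.complex.cyc)
    (hzd : z ∈ χ.complex.homog ε i d) : z ∈ χ.complex.bd := by
  obtain ⟨v, w, rfl⟩ := χ.exists_pair z
  replace hz := mem_cyc.1 hz
  replace hzd := mem_homog.1 hzd
  refine mem_bd.2 ?_
  obtain ⟨hv, hw, z, hz⟩ := hz
  obtain ⟨hdv, hdw⟩ := hzd
  have hε : ε = 0 ∨ ε = 1 := by
    clear h1 h2 hdv hdw
    revert ε
    decide
  by_cases hi : i = 0
  · subst hi
    have hε : ε = 0 := hε.resolve_right fun h => h1 ⟨h, rfl⟩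
    subst hε
    rw [if_pos rfl] at hdv
    rw [if_neg (by norm_num)] at hdw
    subst hdw
    obtain ⟨q, r, rfl, -, -⟩ := exists_vec_of_mem_one hdv
    obtain ⟨-, k, rfl, rfl⟩ := kosD_rows0_eq_zero.1 hv
    obtain ⟨c, l, p, hc, hl, hf⟩ := χ.exists_map_syzygy
    rw [hf, eq_vec z, TwoVar.rows1, kosD_diagRows] at hz
    have h3 := (vec_inj hz).2.1
    have h4 : l * k = T.a * z ∅ :=
      mul_left_cancel₀ (T.α₁_ne_zero M) (by linear_combination -h3)
    -- Multiply `l k = a z` by `c` and use `c l = y - x + a p`. As `a` is prime and does not divide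
    -- `y - x`, it divides `k`.
    have h5 : T.a ∣ (T.y - T.x) * k := ⟨c * z ∅ - p * k, by linear_combination c * h4 - k * hl⟩
    obtain ⟨m, rfl⟩ := (T.prime_a.dvd_or_dvd h5).resolve_left T.not_a_dvd
    refine ⟨⟨vec m 0 0 0, ?_⟩, 0, 0, map_zero _, by rw [map_zero, map_zero, add_zero]⟩
    rw [TwoVar.rows0, kosD_diagRows]
    congr 1 <;> ring
  · rw [if_neg hi] at hdv
    subst hdv
    refine ⟨⟨0, map_zero _⟩, ?_⟩
    by_cases hi' : i = 1
    · subst hi'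
      have hε : ε = 1 := hε.resolve_left fun h => h2 ⟨h, rfl⟩
      subst hε
      rw [if_pos (by norm_num)] at hdw
      obtain ⟨p, t, rfl, -, -⟩ := exists_vec_of_mem_zero hdw
      obtain ⟨rfl, -⟩ := kosD_rows1_eq_zero.1 hw
      obtain ⟨c, hc, hf⟩ := χ.exists_map_top
      -- The cycle `t` on the top generator is the image under `f₀` of `s = t / c`.
      obtain ⟨s, rfl⟩ : c ∣ t := hc.dvd
      exact ⟨0, vec 0 0 0 s, kosD_rows0_eq_zero.2 ⟨rfl, 0, by ring, by ring⟩, by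
        rw [map_zero, zero_add, hf]⟩
    · rw [if_neg (by omega)] at hdw
      subst hdw
      exact ⟨0, 0, map_zero _, by rw [map_zero, map_zero, add_zero]⟩

variable [Algebra ℚ[X] A]

/-- On syzygies `f₀` is multiplication by `y - x`, up to a unit and modulo `a`, so the cokernel in
homological degree `1` is `A/(a, y - x)`, generated by the syzygy of the wide-edge rows. -/
theorem isGenerator_one (χ : ChiModel T M) {S : GrMod} (κ : A →ₗ[ℚ[X]] S.carrier)
    (hκ : Function.Surjective κ)
    (hκ' : ∀ f, κ f = 0 ↔ ∃ p k, f = T.a * p + (T.y - T.x) * k)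
    (hκd : ∀ d t, t ∈ S.homog d ↔ ∃ f ∈ T.gr (d - (-2, 0)), κ f = t) :
    χ.complex.IsGenerator 0 1 T.gr (-2, 0) κ
      (χ.pair 0
        (vec 0 (((M : A) + 2) * hSum (M + 1) T.x T.y) (((M : A) + 2) * -hSum M T.x T.y) 0)) where
  surjective := hκ
  cyc := mem_cyc.2 ⟨map_zero _, kosD_rows1_eq_zero.2 ⟨rfl, 1, by ring, by ring⟩, 0, by
    rw [map_zero, map_zero]⟩
  homog d f hf := by
    rw [smul_pair, smul_zero, smul_vec]
    refine mem_homog.2 ⟨?_, ?_⟩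
    · rw [if_neg one_ne_zero]
    · rw [if_pos (by norm_num)]
      refine vec_mem_one.2 ⟨mul_zero f, mem_congr (T.isGr.mul hf (T.α₁_mem M)) ?_,
        mem_congr (T.isGr.mul hf (T.β₁_mem M)) ?_, mul_zero f⟩ <;>
      ext <;> simp [TwoVar.rows1, diagRows] <;> ring
  one_mem := T.isGr.one
  bd_iff f := by
    obtain ⟨c, l, p, hc, hl, hf⟩ := χ.exists_map_syzygy
    obtain ⟨c', hc', hf'⟩ := χ.exists_map_top
    obtain ⟨e, he⟩ := hc.exists_left_inv
    rw [hκ', smul_pair, smul_zero, smul_vec]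
    refine mem_bd.trans ?_
    constructor
    · rintro ⟨-, u, z, hz, h⟩
      rw [eq_vec z] at hz h
      obtain ⟨h0, k, h1, h2⟩ := kosD_rows0_eq_zero.1 hz
      rw [h0, h1, h2] at h
      -- A cycle is a syzygy plus a multiple of the top generator, and `f₀` is known on each of the
      -- two.
      rw [show vec 0 (((M : A) + 2) * T.x ^ (M + 1) * k) (((M : A) + 2) * T.y ^ (M + 1) * k)
        (z {0, 1}) =
          vec 0 (((M : A) + 2) * T.x ^ (M + 1) * k) (((M : A) + 2) * T.y ^ (M + 1) * k) 0 +
          vec 0 0 0 (z {0, 1}) by rw [vec_add]; congr 1 <;> ring, map_add, hf, hf', eq_vec u,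
        TwoVar.rows1, kosD_diagRows, vec_add, vec_add] at h
      have h3 := (vec_inj h).2.1
      have h4 : f = T.a * u ∅ + l * k :=
        mul_left_cancel₀ (T.α₁_ne_zero M) (by linear_combination -h3)
      -- Substitute `l = e (y - x + a p)`, where `e` is the inverse of `c`, into `f = a u + l k`.
      exact ⟨u ∅ + e * p * k, e * k, by linear_combination h4 + e * k * hl - l * k * he⟩
    · rintro ⟨p', k', rfl⟩
      -- The syzygy with coefficient `c k'` maps to `(y - x) k' + a p k'`; the first vector corrects
      -- the error term `a p k'`.
      refine ⟨⟨0, map_zero _⟩, vec (p' - p * k') 0 0 0,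
        vec 0 (((M : A) + 2) * T.x ^ (M + 1) * (c * k'))
          (((M : A) + 2) * T.y ^ (M + 1) * (c * k')) 0,
        kosD_rows0_eq_zero.2 ⟨rfl, _, rfl, rfl⟩, ?_⟩
      rw [hf, TwoVar.rows1, kosD_diagRows, vec_add]
      congr 1
      · ring
      · linear_combination ((M : A) + 2) * hSum (M + 1) T.x T.y * k' * hl
      · linear_combination ((M : A) + 2) * -hSum M T.x T.y * k' * hl
      · ring
  mem_iff := hκd
  exists_sub d x hx hxd := by
    obtain ⟨v, w, rfl⟩ := χ.exists_pair x
    replace hx := mem_cyc.1 hx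
    replace hxd := mem_homog.1 hxd
    obtain ⟨hdv, hdw⟩ := hxd
    rw [if_neg one_ne_zero] at hdv
    rw [if_pos (by norm_num)] at hdw
    subst hdv
    obtain ⟨q, r, rfl, hq, -⟩ := exists_vec_of_mem_one hdw
    obtain ⟨-, k, rfl, rfl⟩ := kosD_rows1_eq_zero.1 hx.2.1
    refine ⟨k, ?_, ?_⟩
    · refine mem_congr (T.proj.mem_of_mul_mem (T.α₁_ne_zero M) (T.α₁_mem M) hq) ?_
      ext <;> simp [TwoVar.rows1, diagRows] <;> ring
    · rw [smul_pair, pair_sub, smul_zero, sub_zero, smul_vec, vec_sub]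
      refine mem_bd.2 ⟨⟨0, map_zero _⟩, 0, 0, map_zero _, ?_⟩
      rw [map_zero, map_zero, add_zero, ← vec_zero_eq]
      congr 1 <;> ring

/-- On top generators `f₀` is, up to a unit, the projection from `A/(a x^{M+1}, a y^{M+1})` to `A/(a
h_{M+1}, a h_M)`. Because `h_{M+1} = x^{M+1} + y h_M`, its kernel is generated by `a h_M`, whose
annihilator is the ideal quotient appearing in `hκ'`. -/
theorem isGenerator_zero (χ : ChiModel T M) {S : GrMod} (κ : A →ₗ[ℚ[X]] S.carrier)
    (hκ : Function.Surjective κ)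
    (hκ' : ∀ f, κ f = 0 ↔ ∃ p k, f * hSum M T.x T.y = T.x ^ (M + 1) * p + T.y ^ (M + 1) * k)
    (hκd : ∀ d t, t ∈ S.homog d ↔ ∃ f ∈ T.gr (d - (-1, -((M + 1 : ℕ) : ℤ) + 1)), κ f = t) :
    χ.complex.IsGenerator 1 0 T.gr (-1, -((M + 1 : ℕ) : ℤ) + 1) κ
      (χ.pair (vec 0 0 0 (T.a * hSum M T.x T.y)) 0) where
  surjective := hκ
  cyc := by
    obtain ⟨c, hc, hf⟩ := χ.exists_map_top
    obtain ⟨e, he⟩ := (T.isUnit_natCast M).exists_left_inv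
    -- The image `c a h_M` of the generator is a boundary: the second wide-edge row contributes
    -- `(M+2) a h_M q`, so `q = c / (M+2)` works.
    refine mem_cyc.2 ⟨kosD_rows0_eq_zero.2 ⟨rfl, 0, by ring, by ring⟩, map_zero _,
      vec 0 (c * e) 0 0, ?_⟩
    rw [hf, TwoVar.rows1, kosD_diagRows]
    congr 1
    · ring
    · ring
    · linear_combination T.a * hSum M T.x T.y * c * he
  homog d f hf := by
    rw [smul_pair, smul_zero, smul_vec]
    refine mem_homog.2 ⟨?_, ?_⟩
    · rw [if_pos rfl]
      refine vec_mem_zero.2 ⟨by rw [mul_zero]; exact zero_mem _, mul_zero f, mul_zero f,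
        mem_congr (T.isGr.mul hf (T.isGr.mul T.a_mem (hSum_mem T.isGr T.x_mem T.y_mem M))) ?_⟩
      ext <;> simp [TwoVar.rows0, diagRows]; ring
    · rw [if_neg (by norm_num)]
  one_mem := T.isGr.one
  bd_iff f := by
    obtain ⟨e, he⟩ := (T.isUnit_natCast M).exists_left_inv
    rw [hκ', smul_pair, smul_zero, smul_vec]
    refine mem_bd.trans ?_
    constructor
    · rintro ⟨⟨u, hu⟩, -⟩
      rw [eq_vec u, TwoVar.rows0, kosD_diagRows] at hu
      have h3 := (vec_inj hu).2.2.2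
      exact ⟨((M : A) + 2) * u {1}, -(((M : A) + 2) * u {0}),
        mul_left_cancel₀ T.prime_a.ne_zero (by linear_combination -h3)⟩
    · rintro ⟨p, k, h⟩
      refine ⟨⟨vec 0 (-(e * k)) (e * p) 0, ?_⟩, 0, 0, map_zero _, by
        rw [map_zero, map_zero, add_zero]⟩
      rw [TwoVar.rows0, kosD_diagRows]
      congr 1
      · ring
      · ring
      · ring
      · linear_combination -T.a * h + T.a * (T.x ^ (M + 1) * p + T.y ^ (M + 1) * k) * he
  mem_iff := hκd
  exists_sub d z hz hzd := by
    obtain ⟨v, w, rfl⟩ := χ.exists_pair z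
    obtain ⟨hv, -, u, hu⟩ := mem_cyc.1 hz
    obtain ⟨hdv, hdw⟩ := mem_homog.1 hzd
    rw [if_pos rfl] at hdv
    rw [if_neg (by norm_num)] at hdw
    subst hdw
    obtain ⟨p, t, rfl, -, ht⟩ := exists_vec_of_mem_zero hdv
    obtain ⟨rfl, -⟩ := kosD_rows0_eq_zero.1 hv
    obtain ⟨c, hc, hf⟩ := χ.exists_map_top
    obtain ⟨e, he⟩ := hc.exists_left_inv
    obtain ⟨e', he'⟩ := (T.isUnit_natCast M).exists_left_inv
    rw [hf, eq_vec u, TwoVar.rows1, kosD_diagRows] at hu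
    have h1 := (vec_inj hu).2.2.2
    -- Expanding `h_{M+1}` writes `t` as a multiple of `a h_M` plus a multiple of `a x^{M+1}`, and
    -- the latter is already a boundary.
    have h2 : t = T.a * hSum M T.x T.y * (((M : A) + 2) * e * (u {0} + T.y * u {1})) +
        T.a * T.x ^ (M + 1) * (((M : A) + 2) * e * u {1}) := by
      rw [hSum_succ] at h1
      linear_combination -e * h1 - t * he
    have hah := T.isGr.mul T.a_mem (hSum_mem T.isGr T.x_mem T.y_mem M)
    have hax := T.isGr.mul T.a_mem (T.isGr.pow T.x_mem (M + 1))
    -- The coefficients found so far need not be homogeneous; the projections make the coefficient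
    -- of the generator homogeneous.
    obtain ⟨f, hf, g, h3⟩ := T.proj.exists_mem hah hax ht h2
    refine ⟨f, mem_congr hf ?_, ?_⟩
    · ext <;> simp [TwoVar.rows0, diagRows]; ring
    · rw [smul_pair, pair_sub, smul_zero, sub_zero, smul_vec, vec_sub, h3]
      refine mem_bd.2 ⟨⟨vec 0 0 (e' * g) 0, ?_⟩, 0, 0, map_zero _, by
        rw [map_zero, map_zero, add_zero]⟩
      rw [TwoVar.rows0, kosD_diagRows]
      congr 1
      · ring
      · ring
      · ring
      · linear_combination T.a * T.x ^ (M + 1) * g * he'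

end ChiModel

/-! ### Direct sums of graded modules as quotients of `ℚ[a][t]` -/

/-- The homogeneous components of `ℚ[a][t]`, where `deg t = (0, 2)`. -/
def varGr (d : ℤ × ℤ) : AddSubgroup ℚ[X][X] :=
  ⨅ n : ℕ, (baseGr (d - n • (0, 2))).comap (Polynomial.lcoeff ℚ[X] n).toAddMonoidHom

theorem mem_varGr {d : ℤ × ℤ} {P : ℚ[X][X]} :
    P ∈ varGr d ↔ ∀ n : ℕ, P.coeff n ∈ baseGr (d - n • (0, 2)) := by
  simp only [varGr, AddSubgroup.mem_iInf]
  rfl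

theorem varGr_isGr : IsGr varGr where
  one := by
    rw [mem_varGr]
    intro n
    rw [Polynomial.coeff_one]
    split_ifs with h
    · subst h
      exact mem_congr baseGr_isGr.one (by simp)
    · exact zero_mem _
  mul {d e f g} hf hg := by
    rw [mem_varGr] at *
    intro n
    rw [Polynomial.coeff_mul]
    refine sum_mem fun x hx => mem_congr (baseGr_isGr.mul (hf x.1) (hg x.2)) ?_
    rw [← Finset.HasAntidiagonal.mem_antidiagonal.1 hx, add_smul]
    abel

/-- The projections of a direct sum. -/
def GrMod.proj {ι : Type} (M : ι → GrMod) (i : ι) :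
    (GrMod.dsum M).carrier →ₗ[ℚ[X]] (M i).carrier :=
  DirectSum.component ℚ[X] ι (fun i => (M i).carrier) i

theorem GrMod.ext_proj {ι : Type} {M : ι → GrMod} {t t' : (GrMod.dsum M).carrier}
    (h : ∀ i, GrMod.proj M i t = GrMod.proj M i t') : t = t' := DirectSum.ext_component ℚ[X] h

/-- The identification of the summands of a direct sum with quotients of coefficients of
polynomials. -/
structure CoeffData {ι : Type} [DecidableEq ι] (M : ι → GrMod) (d₀ : ℤ × ℤ) where
  idx : ι → ℕ
  inv : ℕ → Option ι
  inv_eq_some : ∀ n i, inv n = some i ↔ n = idx i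
  q : ∀ i, ℚ[X] →ₗ[ℚ[X]] (M i).carrier
  mem : ∀ i d p, p ∈ baseGr (d - d₀ - idx i • (0, 2)) → q i p ∈ (M i).homog d
  lift : ∀ i d m, ∃ p, q i p = m ∧ (m ∈ (M i).homog d → p ∈ baseGr (d - d₀ - idx i • (0, 2)))

namespace CoeffData

variable {ι : Type} [DecidableEq ι] {M : ι → GrMod} {d₀ : ℤ × ℤ} (K : CoeffData M d₀)

/-- The quotient map from `ℚ[a][t]` to the direct sum. -/
def map : ℚ[X][X] →ₗ[ℚ[X]] (GrMod.dsum M).carrier :=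
  Polynomial.lsum fun n => match K.inv n with
    | none => 0
    | some i => DirectSum.lof ℚ[X] ι (fun i => (M i).carrier) i ∘ₗ K.q i

theorem component_map (i : ι) (P : ℚ[X][X]) :
    GrMod.proj M i (K.map P) = K.q i (P.coeff (K.idx i)) := by
  have h : GrMod.proj M i ∘ₗ K.map =
      K.q i ∘ₗ Polynomial.lcoeff ℚ[X] (K.idx i) := by
    refine Polynomial.lhom_ext' fun n => LinearMap.ext fun r => ?_
    rw [LinearMap.comp_apply, LinearMap.comp_apply, LinearMap.comp_apply, LinearMap.comp_apply,
      map, Polynomial.lsum_apply, Polynomial.sum_monomial_index r _ (LinearMap.map_zero _),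
      Polynomial.lcoeff_apply, Polynomial.coeff_monomial]
    cases hn : K.inv n with
    | none =>
      have h1 : n ≠ K.idx i := fun h => by
        rw [(K.inv_eq_some n i).2 h] at hn
        cases hn
      rw [if_neg h1, map_zero]
      exact map_zero _
    | some j =>
      have h1 := (K.inv_eq_some n j).1 hn
      refine (DirectSum.component.of ℚ[X] (M := fun i => (M i).carrier) i j (K.q j r)).trans ?_
      by_cases hij : j = i
      · subst hij
        rw [dif_pos rfl, if_pos h1]
      · rw [dif_neg hij, if_neg, map_zero]
        intro h2
        have h3 := (K.inv_eq_some n i).2 h2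
        rw [hn] at h3
        exact hij (Option.some.inj h3)
  exact LinearMap.congr_fun h P

theorem map_eq_zero (P : ℚ[X][X]) : K.map P = 0 ↔ ∀ i, K.q i (P.coeff (K.idx i)) = 0 := by
  constructor
  · intro h i
    rw [← K.component_map, h, _root_.map_zero]
  · intro h
    refine GrMod.ext_proj fun i => ?_
    rw [K.component_map, h, _root_.map_zero]

theorem map_mem {d : ℤ × ℤ} {P : ℚ[X][X]} (hP : P ∈ varGr (d - d₀)) :
    K.map P ∈ (GrMod.dsum M).homog d := by
  refine (AddSubgroup.mem_iInf).2 fun i => ?_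
  change GrMod.proj M i (K.map P) ∈ (M i).homog d
  rw [K.component_map]
  exact K.mem i d _ (mem_varGr.1 hP _)

/-- Lift each summand and place the result at its coefficient. That the other coefficients vanish is
recorded so that lifts for complementary ranges of coefficients can be added. -/
theorem exists_lift (d : ℤ × ℤ) (t : (GrMod.dsum M).carrier) :
    ∃ P, K.map P = t ∧ (∀ n, K.inv n = none → P.coeff n = 0) ∧
      (t ∈ (GrMod.dsum M).homog d → P ∈ varGr (d - d₀)) := by
  classical
  choose p hp hpd using fun i => K.lift i d
    (GrMod.proj M i t)
  let s : Finset ι := DFinsupp.support (β := fun i => (M i).carrier) t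
  have hcoeff : ∀ n, (∑ i ∈ s, Polynomial.monomial (K.idx i) (p i)).coeff n =
      ∑ i ∈ s, if K.idx i = n then p i else 0 := fun n => by
    rw [Polynomial.finsetSum_coeff]
    exact Finset.sum_congr rfl fun i _ => Polynomial.coeff_monomial
  have hinj : ∀ i j, K.idx i = K.idx j → i = j := fun i j h => by
    have h1 := (K.inv_eq_some (K.idx i) i).2 rfl
    rw [(K.inv_eq_some (K.idx i) j).2 h] at h1
    exact (Option.some.inj h1).symm
  refine ⟨∑ i ∈ s, Polynomial.monomial (K.idx i) (p i), ?_, fun n hn => ?_, fun ht => ?_⟩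
  · refine GrMod.ext_proj fun i => ?_
    rw [K.component_map, hcoeff, Finset.sum_congr rfl (g := fun j => if j = i then p j else 0)
      (fun j _ => if_congr ⟨hinj j i, fun h => by rw [h]⟩ rfl rfl), Finset.sum_ite_eq']
    split_ifs with h
    · exact hp i
    · rw [_root_.map_zero]
      exact (DFinsupp.notMem_support_iff.1 h).symm
  · rw [hcoeff]
    refine Finset.sum_eq_zero fun i _ => if_neg fun h => ?_
    rw [(K.inv_eq_some n i).2 h.symm] at hn
    cases hn
  · rw [mem_varGr]
    intro n
    rw [hcoeff]
    refine sum_mem fun i _ => ?_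
    split_ifs with h
    · subst h
      exact hpd i ((AddSubgroup.mem_iInf).1 ht i)
    · exact zero_mem _

end CoeffData

/-- The first `N` coefficients. -/
def lowCoeff (N : ℕ) : CoeffData (fun l : Fin N =>
    GrMod.free.shift (-1) (-(N : ℤ) + 1 + 2 * (l : ℕ))) (-1, -(N : ℤ) + 1) where
  idx l := l
  inv n := if h : n < N then some ⟨n, h⟩ else none
  inv_eq_some n l := by
    split_ifs with h
    · simp [Fin.ext_iff]
    · simp only [false_iff]
      rintro rfl
      exact h l.2
  q _ := LinearMap.id (M := ℚ[X])
  mem l d p hp := mem_congr hp (by ext <;> simp; ring)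
  lift l d m := ⟨m, rfl, fun hm => mem_congr (A := ℚ[X]) hm (by ext <;> simp; ring)⟩

/-- The coefficients from the `k`-th one on, modulo `a`. -/
def highCoeff (k : ℕ) (q r : ℤ) : CoeffData (fun m : ℕ =>
    GrMod.torsion.shift q (r + 2 * k + 2 * (m : ℕ))) (q, r) where
  idx m := k + m
  inv n := if k ≤ n then some (n - k) else none
  inv_eq_some n m := by
    split_ifs with h
    · simp
      omega
    · simp only [false_iff]
      omega
  q _ := Submodule.mkQ (Ideal.span {(Polynomial.X : ℚ[X])})
  mem m d p hp := ⟨p, mem_congr hp (by ext <;> simp; ring), rfl⟩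
  lift m d t := by
    by_cases ht : t ∈ (GrMod.torsion.shift q (r + 2 * k + 2 * (m : ℕ))).homog d
    · obtain ⟨p, hp, rfl⟩ := ht
      exact ⟨p, rfl, fun _ => mem_congr hp (by ext <;> simp; ring)⟩
    · obtain ⟨p, rfl⟩ := Submodule.Quotient.mk_surjective _ t
      exact ⟨p, rfl, fun h => absurd h ht⟩

theorem lowCoeff_map_eq_zero (N : ℕ) (P : ℚ[X][X]) :
    (lowCoeff N).map P = 0 ↔ Polynomial.X ^ N ∣ P := by
  rw [CoeffData.map_eq_zero, Polynomial.X_pow_dvd_iff]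
  exact ⟨fun h n hn => h ⟨n, hn⟩, fun h l => h l l.2⟩

theorem highCoeff_map_eq_zero (k : ℕ) (q r : ℤ) (P : ℚ[X][X]) :
    (highCoeff k q r).map P = 0 ↔ ∀ m, k ≤ m → Polynomial.X ∣ P.coeff m := by
  rw [CoeffData.map_eq_zero]
  have h : ∀ p : ℚ[X], Submodule.mkQ (Ideal.span {(Polynomial.X : ℚ[X])}) p = 0 ↔
      Polynomial.X ∣ p := fun p =>
    (Submodule.Quotient.mk_eq_zero _).trans Ideal.mem_span_singleton
  constructor
  · intro h1 m hm
    have := (h _).1 (h1 (m - k))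
    rwa [show (highCoeff k q r).idx (m - k) = m from Nat.add_sub_of_le hm] at this
  · exact fun h1 m => (h _).2 (h1 _ (Nat.le_add_right k m))

/-! ### Marking rings -/

section Diag

variable (V : Type)

/-- The substitution of one indeterminate for all markings. -/
def diag : MarkRing V →ₐ[ℚ[X]] ℚ[X][X] := MvPolynomial.aeval fun _ => Polynomial.X

variable {V}

/-- The substitution of a marking for the indeterminate. -/
def undiag (v : V) : ℚ[X][X] →ₐ[ℚ[X]] MarkRing V := Polynomial.aeval (MvPolynomial.X v)

theorem diag_X (v : V) : diag V (MvPolynomial.X v) = Polynomial.X := MvPolynomial.aeval_X _ _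

theorem diag_C (p : ℚ[X]) : diag V (MvPolynomial.C p) = Polynomial.C p :=
  MvPolynomial.algHom_C _ _

theorem diag_aElt : diag V (aElt V) = Polynomial.C Polynomial.X := diag_C _

theorem undiag_X (v : V) : undiag v Polynomial.X = MvPolynomial.X v := Polynomial.aeval_X _

theorem undiag_C (v : V) (p : ℚ[X]) : undiag v (Polynomial.C p) = MvPolynomial.C p :=
  Polynomial.aeval_C _ _

theorem diag_undiag (v : V) (P : ℚ[X][X]) : diag V (undiag v P) = P := by
  have h : (diag V).comp (undiag v) = AlgHom.id ℚ[X] ℚ[X][X] := by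
    refine Polynomial.algHom_ext ?_
    rw [AlgHom.comp_apply, undiag_X, diag_X, AlgHom.id_apply]
  exact DFunLike.congr_fun h P

theorem diag_mem {d : ℤ × ℤ} {f : MarkRing V} (hf : f ∈ markGr V d) : diag V f ∈ varGr d := by
  refine map_mem_of_mem_polyGr (A := ℚ[X]) baseGr_isGr varGr_isGr (diag V).toRingHom
    (fun d r hr => ?_) (fun v => ?_) hf
  · change diag V (MvPolynomial.C r) ∈ varGr d
    rw [diag_C, mem_varGr]
    intro n
    rw [Polynomial.coeff_C]
    split_ifs with h
    · subst h
      exact mem_congr hr (by simp)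
    · exact zero_mem _
  · change diag V (MvPolynomial.X v) ∈ varGr (0, 2)
    rw [diag_X, mem_varGr]
    intro n
    rw [Polynomial.coeff_X]
    split_ifs with h
    · subst h
      exact mem_congr baseGr_isGr.one (by simp)
    · exact zero_mem _

theorem undiag_mem (v : V) {d : ℤ × ℤ} {P : ℚ[X][X]} (hP : P ∈ varGr d) :
    undiag v P ∈ markGr V d := by
  rw [undiag, Polynomial.aeval_eq_sum_range]
  refine sum_mem fun n _ => ?_
  rw [MvPolynomial.smul_eq_C_mul]
  refine mem_congr ((markGr_isGr V).mul (C_mem_markGr (mem_varGr.1 hP n))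
    ((markGr_isGr V).pow (X_mem_markGr v) n)) ?_
  abel

/-- The kernel of the diagonal substitution is generated by the difference of the two markings.
Taking `v = w` covers the case of a single marking. -/
theorem exists_eq_undiag_add (v w : V) (h : ∀ u, u = v ∨ u = w) (f : MarkRing V) :
    ∃ k, f = undiag v (diag V f) + (MvPolynomial.X w - MvPolynomial.X v) * k := by
  obtain ⟨k, hk⟩ := exists_mul_eq_sub (A := ℚ[X]) ((undiag v).comp (diag V)).toRingHom
    (MvPolynomial.X w - MvPolynomial.X v)
    (fun r => by
      change undiag v (diag V (MvPolynomial.C r)) = _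
      rw [diag_C, undiag_C])
    (fun u => by
      change ∃ c, _ = _ - undiag v (diag V (MvPolynomial.X u))
      rw [diag_X, undiag_X]
      rcases h u with rfl | rfl
      · exact ⟨0, by ring⟩
      · exact ⟨1, by ring⟩) f
  refine ⟨k, ?_⟩
  rw [hk]
  exact (add_sub_cancel _ _).symm

theorem surjective_comp_diag [Nonempty V] {S : GrMod} {κ : ℚ[X][X] →ₗ[ℚ[X]] S.carrier}
    {d₀ : ℤ × ℤ}
    (hl : ∀ d t, ∃ P, κ P = t ∧ (t ∈ S.homog d → P ∈ varGr (d - d₀))) :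
    Function.Surjective (κ ∘ₗ (diag V).toLinearMap) := by
  intro t
  obtain ⟨P, rfl, -⟩ := hl 0 t
  obtain ⟨v⟩ := ‹Nonempty V›
  exact ⟨undiag v P, congrArg κ (diag_undiag v P)⟩

theorem mem_homog_iff_exists [Nonempty V] {S : GrMod} {κ : ℚ[X][X] →ₗ[ℚ[X]] S.carrier}
    {d₀ : ℤ × ℤ} (hm : ∀ d P, P ∈ varGr (d - d₀) → κ P ∈ S.homog d)
    (hl : ∀ d t, ∃ P, κ P = t ∧ (t ∈ S.homog d → P ∈ varGr (d - d₀))) (d : ℤ × ℤ)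
    (t : S.carrier) :
    t ∈ S.homog d ↔ ∃ f ∈ markGr V (d - d₀), (κ ∘ₗ (diag V).toLinearMap) f = t := by
  obtain ⟨v⟩ := ‹Nonempty V›
  constructor
  · intro ht
    obtain ⟨P, rfl, hP⟩ := hl d t
    exact ⟨undiag v P, undiag_mem v (hP ht), congrArg κ (diag_undiag v P)⟩
  · rintro ⟨f, hf, rfl⟩
    exact hm d _ (diag_mem hf)

end Diag

theorem wt_const {V : Type} (m : V →₀ ℕ) :
    wt (fun _ => (0, 2)) m = (0, 2 * ∑ i ∈ m.support, (m i : ℤ)) := by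
  rw [wt, Finsupp.sum, ← Finset.sum_smul, Finset.mul_sum]
  ext <;> simp [Finset.mul_sum, mul_comm]

/-- As `a` has bidegree `(2, 0)` and the markings `(0, 2)`, only rational constants have bidegree
`0`. -/
theorem isUnit_of_mem_markGr {V : Type} {c : MarkRing V} (hc : c ∈ markGr V 0) :
    c = 0 ∨ IsUnit c := by
  classical
  have h1 : ∀ m n, ¬(m = 0 ∧ n = 0) → (MvPolynomial.coeff m c).coeff n = 0 := by
    intro m n h
    refine mem_baseGr.1 (mem_polyGr.1 hc m) n fun h2 => h ?_
    have h3 := congrArg Prod.fst h2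
    have h4 := congrArg Prod.snd h2
    rw [wt_const, zero_sub] at h3 h4
    simp only [Prod.fst_neg, Prod.snd_neg, neg_zero] at h3 h4
    refine ⟨?_, by omega⟩
    have h6 : ∑ i ∈ m.support, (m i : ℤ) = 0 := by
      change -(2 * ∑ i ∈ m.support, (m i : ℤ)) = 0 at h4
      omega
    rw [Finset.sum_eq_zero_iff_of_nonneg (fun _ _ => by positivity)] at h6
    ext i
    by_contra hi
    exact hi (by exact_mod_cast h6 i (Finsupp.mem_support_iff.2 hi))
  have h2 : c = MvPolynomial.C (Polynomial.C ((MvPolynomial.coeff 0 c).coeff 0)) := by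
    refine MvPolynomial.ext _ _ fun m => Polynomial.ext fun n => ?_
    rw [MvPolynomial.coeff_C]
    by_cases hm : 0 = m
    · subst hm
      rw [if_pos rfl, Polynomial.coeff_C]
      split_ifs with hn
      · rw [hn]
      · exact h1 _ _ fun h => hn h.2
    · rw [if_neg hm, Polynomial.coeff_zero]
      exact h1 _ _ fun h => hm h.1.symm
  by_cases hq : (MvPolynomial.coeff 0 c).coeff 0 = 0
  · left
    rw [h2, hq, map_zero, map_zero]
  · right
    rw [h2]
    exact ((IsUnit.mk0 _ hq).map Polynomial.C).map MvPolynomial.C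

/-! ### Ideals of `ℚ[a, x, y]` through the diagonal substitution -/

section TwoMarkings

variable {V : Type} {v w : V}

/-- The ring `ℚ[a][V]` with two of its markings. -/
def twoVar (h : v ≠ w) : TwoVar (MarkRing V) where
  gr := markGr V
  a := aElt V
  x := MvPolynomial.X v
  y := MvPolynomial.X w
  isGr := markGr_isGr V
  proj := markProj V
  a_mem := aElt_mem_markGr V
  x_mem := X_mem_markGr v
  y_mem := X_mem_markGr w
  prime_a := (MvPolynomial.prime_C_iff V).2 Polynomial.prime_X
  prime_x := MvPolynomial.X_prime
  not_x_dvd hd := h (MvPolynomial.X_dvd_X.1 hd)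
  not_a_dvd hd := by
    classical
    -- The coefficient of `w` in `y - x` is `1`, which `a` does not divide.
    have h1 := (MvPolynomial.C_dvd_iff_dvd_coeff _ _).1 hd (Finsupp.single w 1)
    rw [MvPolynomial.coeff_sub, MvPolynomial.coeff_X, MvPolynomial.coeff_X, if_pos rfl, if_neg,
      sub_zero] at h1
    · exact Polynomial.prime_X.not_isUnit (isUnit_of_dvd_one h1)
    · intro h2
      exact h (Finsupp.single_left_injective one_ne_zero h2)
  isUnit_of_mem _ := isUnit_of_mem_markGr
  isUnit_natCast n := by
    have h1 : IsUnit ((n : ℚ) + 2) := by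
      have : (n : ℚ) + 2 ≠ 0 := by positivity
      exact this.isUnit
    have h2 := h1.map (algebraMap ℚ (MarkRing V))
    rwa [map_add, map_natCast, map_ofNat] at h2

theorem diag_eq_C_mul_iff (hV : ∀ u, u = v ∨ u = w) (f : MarkRing V) :
    Polynomial.C Polynomial.X ∣ diag V f ↔
      ∃ p k, f = aElt V * p + (MvPolynomial.X w - MvPolynomial.X v) * k := by
  constructor
  · rintro ⟨Q, hQ⟩
    obtain ⟨k, hk⟩ := exists_eq_undiag_add v w hV f
    rw [hQ, map_mul, undiag_C] at hk
    exact ⟨_, k, hk⟩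
  · rintro ⟨p, k, rfl⟩
    rw [map_add, map_mul, map_mul, map_sub, diag_X, diag_X, diag_aElt, sub_self, zero_mul, add_zero]
    exact dvd_mul_right _ _

/-- The annihilator of `h_M` modulo `(x^{M+1}, y^{M+1})` is `(y - x, x^{M+1})`. One inclusion is `(x
- y) h_M = x^{M+1} - y^{M+1}`; the other uses in addition that `x^{M+1}` and `h_M` are coprime. -/
theorem X_pow_dvd_diag_iff (hvw : v ≠ w) (hV : ∀ u, u = v ∨ u = w) (M : ℕ) (f : MarkRing V) :
    Polynomial.X ^ (M + 1) ∣ diag V f ↔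
      ∃ p k, f * hSum M (MvPolynomial.X v) (MvPolynomial.X w) =
        MvPolynomial.X v ^ (M + 1) * p + MvPolynomial.X w ^ (M + 1) * k := by
  have hs := hSum_spec M (MvPolynomial.X v : MarkRing V) (MvPolynomial.X w)
  constructor
  · rintro ⟨Q, hQ⟩
    obtain ⟨k, hk⟩ := exists_eq_undiag_add v w hV f
    rw [hQ, map_mul, map_pow, undiag_X] at hk
    refine ⟨undiag v Q * hSum M (MvPolynomial.X v) (MvPolynomial.X w) - k, k, ?_⟩
    linear_combination hk * hSum M (MvPolynomial.X v) (MvPolynomial.X w) - k * hs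
  · rintro ⟨p, k, h⟩
    -- Subtracting `(y - x) k` from `f` trades `y^{M+1} k` for `x^{M+1} k`, which leaves `(f - (y -
    -- x) k) h_M = x^{M+1} (p + k)`.
    obtain ⟨q, hq, -⟩ := coprimal_pow_hSum (A := MarkRing V) (MvPolynomial.X_prime (i := v))
      (fun h => hvw (MvPolynomial.X_dvd_X.1 h)) (M + 1) M
      (f - (MvPolynomial.X w - MvPolynomial.X v) * k) (p + k) (by linear_combination -h - k * hs)
    have h1 := congrArg (diag V) hq
    rw [map_sub, map_mul, map_mul, map_sub, map_pow, diag_X, diag_X, sub_self, zero_mul,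
      sub_zero] at h1
    rw [h1]
    exact dvd_mul_right _ _

end TwoMarkings

/-! ### Koszul matrix factorizations with one row -/

section OneRow

variable {A : Type}

/-- The element of a Koszul matrix factorization with one row with given components. -/
def vec1 (p q : A) (s : Finset (Fin 1)) : A := if 0 ∈ s then q else p

theorem finset_one_cases (s : Finset (Fin 1)) : s = ∅ ∨ s = {0} := by
  revert s
  decide

theorem vec1_empty (p q : A) : vec1 p q ∅ = p := by simp [vec1]

theorem vec1_zero (p q : A) : vec1 p q {0} = q := by simp [vec1]

theorem eq_vec1 (f : Finset (Fin 1) → A) : f = vec1 (f ∅) (f {0}) := by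
  ext s
  rcases finset_one_cases s with rfl | rfl <;> simp [vec1]

variable [CommRing A]

theorem kosD_vec1 (row : Fin 1 → KRow A) (p q : A) :
    kosD row (vec1 p q) = vec1 ((row 0).a1 * q) ((row 0).a0 * p) := by
  rw [eq_vec1 (kosD row (vec1 p q))]
  congr 1 <;> rw [kosD_apply, Fin.sum_univ_one] <;> simp [vec1]

theorem vec1_mem_zero {N : ℕ} {gr : ℤ × ℤ → AddSubgroup A} {row : Fin 1 → KRow A} {d : ℤ × ℤ}
    {p q : A} : vec1 p q ∈ kosHomog N gr row 0 d ↔ p ∈ gr d ∧ q = 0 := by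
  rw [mem_kosHomog]
  constructor
  · intro h
    have h1 := h ∅
    have h2 := h {0}
    rw [vec1_empty] at h1
    rw [vec1_zero, Finset.card_singleton, if_neg (by decide)] at h2
    simp only [Finset.card_empty, Nat.cast_zero, if_true, Finset.sum_empty, sub_zero] at h1
    exact ⟨h1, h2⟩
  · rintro ⟨h1, rfl⟩ s
    rcases finset_one_cases s with rfl | rfl
    · simpa [vec1_empty] using h1
    · rw [vec1_zero]
      exact zero_mem _

theorem vec1_mem_one {N : ℕ} {gr : ℤ × ℤ → AddSubgroup A} {row : Fin 1 → KRow A} {d : ℤ × ℤ}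
    {p q : A} : vec1 p q ∈ kosHomog N gr row 1 d ↔
      p = 0 ∧ q ∈ gr (d - ((1, (N : ℤ) + 1) - (row 0).deg0)) := by
  rw [mem_kosHomog]
  constructor
  · intro h
    have h1 := h ∅
    have h2 := h {0}
    rw [vec1_empty, Finset.card_empty, if_neg (by decide)] at h1
    rw [vec1_zero, Finset.card_singleton, if_pos (by decide), Finset.sum_singleton] at h2
    exact ⟨h1, h2⟩
  · rintro ⟨rfl, h2⟩ s
    rcases finset_one_cases s with rfl | rfl
    · rw [vec1_empty]
      exact zero_mem _
    · rw [vec1_zero, Finset.card_singleton, if_pos (by decide), Finset.sum_singleton]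
      exact h2

end OneRow

/-! ### The homology of a closed arc -/

section ClosedArc

variable {A : Type} [CommRing A] (N : ℕ) (gr : ℤ × ℤ → AddSubgroup A) (row : Fin 1 → KRow A)

/-- A Koszul matrix factorization with one row as a complex. -/
def rowComplex : MFComplex A := MFComplex.single (koszul A N gr row)

/-- An element of the complex of a Koszul matrix factorization. -/
def rowElt (v : Finset (Fin 1) → A) : (rowComplex N gr row).carrier := v

variable {N gr row}

theorem exists_rowElt (z : (rowComplex N gr row).carrier) : ∃ v, z = rowElt N gr row v := ⟨z, rfl⟩

theorem smul_rowElt (r : A) (v : Finset (Fin 1) → A) :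
    r • rowElt N gr row v = rowElt N gr row (r • v) := rfl

theorem rowElt_sub (v w : Finset (Fin 1) → A) :
    rowElt N gr row v - rowElt N gr row w = rowElt N gr row (v - w) := rfl

theorem rowElt_mem_cyc {v : Finset (Fin 1) → A} :
    rowElt N gr row v ∈ (rowComplex N gr row).cyc ↔ kosD row v = 0 := by
  refine MFComplex.mem_cyc.trans ?_
  exact ⟨fun h => h.1, fun h => ⟨h, 0, map_zero _⟩⟩

theorem rowElt_mem_bd {v : Finset (Fin 1) → A} :
    rowElt N gr row v ∈ (rowComplex N gr row).bd ↔ ∃ u, kosD row u = v := by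
  refine MFComplex.mem_bd.trans ?_
  constructor
  · rintro ⟨u, z, -, h⟩
    exact ⟨u, (add_zero _).symm.trans h⟩
  · rintro ⟨u, h⟩
    exact ⟨u, 0, map_zero _, (add_zero _).trans h⟩

theorem rowElt_mem_homog {ε : ZMod 2} {i : ℤ} {d : ℤ × ℤ} {v : Finset (Fin 1) → A} :
    rowElt N gr row v ∈ (rowComplex N gr row).homog ε i d ↔
      if i = 0 then v ∈ kosHomog N gr row ε d else v = 0 := by
  change v ∈ (if i = 0 then kosHomog N gr row ε d else ⊥) ↔ _
  split_ifs
  · exact Iff.rfl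
  · exact AddSubgroup.mem_bot

theorem rowComplex_mem_bd_of_ne [IsDomain A] (h0 : (row 0).a0 ≠ 0) {ε : ZMod 2} {i : ℤ}
    (h : ¬(ε = 1 ∧ i = 0)) (d : ℤ × ℤ) (z : (rowComplex N gr row).carrier)
    (hz : z ∈ (rowComplex N gr row).cyc) (hzd : z ∈ (rowComplex N gr row).homog ε i d) :
    z ∈ (rowComplex N gr row).bd := by
  obtain ⟨v, hv⟩ := exists_rowElt z
  rw [hv, rowElt_mem_cyc] at hz
  rw [hv, rowElt_mem_homog] at hzd
  rw [hv, rowElt_mem_bd]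
  refine ⟨0, ?_⟩
  rw [map_zero]
  by_cases hi : i = 0
  · have hε : ε = 0 := by
      have : ε = 0 ∨ ε = 1 := by
        clear h hzd
        revert ε
        decide
      exact this.resolve_right fun h' => h ⟨h', hi⟩
    subst hε
    rw [if_pos hi, eq_vec1 v, vec1_mem_zero] at hzd
    rw [eq_vec1 v, kosD_vec1] at hz
    have h1 := congrFun hz {0}
    rw [vec1_zero] at h1
    rw [eq_vec1 v, hzd.2, (mul_eq_zero.1 h1).resolve_left h0]
    ext s
    simp [vec1]
  · rw [if_neg hi] at hzd
    exact hzd.symm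

/-- For a row `(a₀, 0)` every odd element is a cycle and the boundaries are the multiples of `a₀`,
so the odd homology is `A/(a₀)`. -/
theorem rowComplex_isGenerator [Algebra ℚ[X] A] (hg : IsGr gr)
    (h1 : (row 0).a1 = 0) {d₀ : ℤ × ℤ} (hd₀ : (1, (N : ℤ) + 1) - (row 0).deg0 = d₀)
    {S : GrMod} (κ : A →ₗ[ℚ[X]] S.carrier) (hκ : Function.Surjective κ)
    (hκ' : ∀ f, κ f = 0 ↔ (row 0).a0 ∣ f)
    (hκd : ∀ d t, t ∈ S.homog d ↔ ∃ f ∈ gr (d - d₀), κ f = t) :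
    (rowComplex N gr row).IsGenerator 1 0 gr d₀ κ
      (rowElt N gr row (vec1 0 1)) where
  surjective := hκ
  cyc := by
    rw [rowElt_mem_cyc, kosD_vec1, h1]
    ext s
    simp [vec1]
  homog d f hf := by
    rw [smul_rowElt, rowElt_mem_homog, if_pos rfl, eq_vec1 (f • vec1 0 1)]
    refine vec1_mem_one.2 ⟨by simp [vec1], ?_⟩
    rw [Pi.smul_apply, vec1_zero, smul_eq_mul, mul_one]
    exact mem_congr hf (by rw [hd₀, add_sub_cancel_right])
  one_mem := hg.one
  bd_iff f := by
    rw [hκ', smul_rowElt, rowElt_mem_bd]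
    constructor
    · rintro ⟨u, hu⟩
      rw [eq_vec1 u, kosD_vec1] at hu
      have h2 := congrFun hu {0}
      rw [vec1_zero, Pi.smul_apply, vec1_zero, smul_eq_mul, mul_one] at h2
      exact ⟨_, h2.symm⟩
    · rintro ⟨p, rfl⟩
      refine ⟨vec1 p 0, ?_⟩
      rw [kosD_vec1]
      ext s
      simp [vec1]
  mem_iff := hκd
  exists_sub d z hz hzd := by
    obtain ⟨v, hv⟩ := exists_rowElt z
    rw [hv, rowElt_mem_homog, if_pos rfl, eq_vec1 v, vec1_mem_one] at hzd
    rw [hd₀] at hzd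
    refine ⟨v {0}, hzd.2, ?_⟩
    rw [hv]
    have h2 : v - v {0} • vec1 0 1 = 0 := by
      rw [sub_eq_zero]
      conv_lhs => rw [eq_vec1 v, hzd.1]
      ext s
      simp [vec1]
    rw [smul_rowElt, rowElt_sub, h2, rowElt_mem_bd]
    exact ⟨0, map_zero _⟩

end ClosedArc

/-! ### The closure of a negative crossing -/

/-- Equivalences of complexes compose. -/
def WeakEquiv.trans {S : Type} [CommRing S] {C D E : MFComplex S} (w : WeakEquiv C D)
    (w' : WeakEquiv D E) : WeakEquiv C E where
  φ := w'.φ ∘ₗ w.φ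
  ψ := w.ψ ∘ₗ w'.ψ
  φ_dmf := by rw [LinearMap.comp_assoc, w.φ_dmf, ← LinearMap.comp_assoc, w'.φ_dmf]; rfl
  ψ_dmf := by rw [LinearMap.comp_assoc, w'.ψ_dmf, ← LinearMap.comp_assoc, w.ψ_dmf]; rfl
  φ_dchi := by
    obtain ⟨h, hh⟩ := w.φ_dchi
    obtain ⟨h', hh'⟩ := w'.φ_dchi
    refine ⟨h' ∘ₗ w.φ + w'.φ ∘ₗ h, LinearMap.ext fun x => ?_⟩
    have h1 := LinearMap.congr_fun hh x
    have h2 := LinearMap.congr_fun hh' (w.φ x)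
    have h3 := LinearMap.congr_fun w'.φ_dmf (h x)
    have h4 := LinearMap.congr_fun w.φ_dmf x
    simp only [LinearMap.comp_apply, LinearMap.add_apply] at h1 h2 h3 h4 ⊢
    rw [h1, map_add, map_add, h2, h3, ← h4, map_add]
    abel
  ψ_dchi := by
    obtain ⟨h, hh⟩ := w'.ψ_dchi
    obtain ⟨h', hh'⟩ := w.ψ_dchi
    refine ⟨h' ∘ₗ w'.ψ + w.ψ ∘ₗ h, LinearMap.ext fun x => ?_⟩
    have h1 := LinearMap.congr_fun hh x
    have h2 := LinearMap.congr_fun hh' (w'.ψ x)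
    have h3 := LinearMap.congr_fun w.ψ_dmf (h x)
    have h4 := LinearMap.congr_fun w'.ψ_dmf x
    simp only [LinearMap.comp_apply, LinearMap.add_apply] at h1 h2 h3 h4 ⊢
    rw [h1, map_add, map_add, h2, h3, ← h4, map_add]
    abel
  ψ_φ := by
    obtain ⟨h, hh⟩ := w.ψ_φ
    obtain ⟨h', hh'⟩ := w'.ψ_φ
    refine ⟨h + w.ψ ∘ₗ h' ∘ₗ w.φ, LinearMap.ext fun x => ?_⟩
    have h1 := LinearMap.congr_fun hh x
    have h2 := LinearMap.congr_fun hh' (w.φ x)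
    have h3 := LinearMap.congr_fun w.ψ_dmf (h' (w.φ x))
    have h4 := LinearMap.congr_fun w.φ_dmf x
    simp only [LinearMap.comp_apply, LinearMap.add_apply, LinearMap.id_apply] at h1 h2 h3 h4 ⊢
    rw [h2, map_add, map_add, h1, h3, ← h4, map_add]
    abel
  φ_ψ := by
    obtain ⟨h, hh⟩ := w'.φ_ψ
    obtain ⟨h', hh'⟩ := w.φ_ψ
    refine ⟨h + w'.φ ∘ₗ h' ∘ₗ w'.ψ, LinearMap.ext fun x => ?_⟩
    have h1 := LinearMap.congr_fun hh x
    have h2 := LinearMap.congr_fun hh' (w'.ψ x)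
    have h3 := LinearMap.congr_fun w'.φ_dmf (h' (w'.ψ x))
    have h4 := LinearMap.congr_fun w'.ψ_dmf x
    simp only [LinearMap.comp_apply, LinearMap.add_apply, LinearMap.id_apply] at h1 h2 h3 h4 ⊢
    rw [h2, map_add, map_add, h1, h3, ← h4, map_add]
    abel
  φ_homog ε i d x hx := w'.φ_homog ε i d _ (w.φ_homog ε i d x hx)
  ψ_homog ε i d x hx := w.ψ_homog ε i d _ (w'.ψ_homog ε i d x hx)

/-- Extension of scalars of a complex with two terms, after a contraction of its second term. -/
def WeakEquiv.twoTermContraction {R S : Type} [CommRing R] [CommRing S] [Algebra R S]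
    {gr : ℤ × ℤ → AddSubgroup S} {P Q K : GradedMF R} {P' K' : GradedMF S}
    {f : P.carrier →ₗ[R] Q.carrier} (c : Contraction Q K) (b : BCIso gr P P') (b' : BCIso gr K K')
    (i₀ : ℤ) (hf : f ∘ₗ P.d = Q.d ∘ₗ f) (hs : f ∘ₗ P.sgn = Q.sgn ∘ₗ f)
    (hf' : b.map b' (c.p ∘ₗ f) ∘ₗ P'.d = K'.d ∘ₗ b.map b' (c.p ∘ₗ f))
    (hs' : b.map b' (c.p ∘ₗ f) ∘ₗ P'.sgn = K'.sgn ∘ₗ b.map b' (c.p ∘ₗ f)) :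
    WeakEquiv ((MFComplex.twoTerm i₀ P Q f hf hs).baseChange gr)
      (MFComplex.twoTerm i₀ P' K' (b.map b' (c.p ∘ₗ f)) hf' hs') :=
  have h1 : (c.p ∘ₗ f) ∘ₗ P.d = K.d ∘ₗ (c.p ∘ₗ f) := by
    rw [LinearMap.comp_assoc, hf, ← LinearMap.comp_assoc, c.p_hom.comm, LinearMap.comp_assoc]
  have h2 : (c.p ∘ₗ f) ∘ₗ P.sgn = K.sgn ∘ₗ (c.p ∘ₗ f) := by
    rw [LinearMap.comp_assoc, hs, ← LinearMap.comp_assoc, c.p_hom.sgn, LinearMap.comp_assoc]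
  ((WeakEquiv.twoTerm i₀ f hf hs c h1 h2).baseChange gr).trans
    (WeakEquiv.twoTermBaseChange b b' i₀ (c.p ∘ₗ f) h1 h2 hf' hs')

/-- Extension of scalars of the complex of a crossing, after a contraction of its second term. -/
theorem nonempty_weakEquiv_crossing {R S : Type} [CommRing R] [CommRing S] [Algebra R S]
    {gr : ℤ × ℤ → AddSubgroup S} {P Q K : GradedMF R} {P' K' : GradedMF S} {δ : ℤ × ℤ}
    {f : P.carrier →ₗ[R] Q.carrier} (c : Contraction Q K) (b : BCIso gr P P') (b' : BCIso gr K K')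
    (i₀ q r q' r' : ℤ) (hf : GradedMF.IsHomogMorphism P Q δ f) (g : P'.carrier →ₗ[S] K'.carrier)
    (hg : g = b.map b' (c.p ∘ₗ f)) (hd : g ∘ₗ P'.d = K'.d ∘ₗ g)
    (hs : g ∘ₗ (P'.flip.shift q r).sgn = (K'.flip.shift q' r').sgn ∘ₗ g) :
    Nonempty (WeakEquiv ((MFComplex.crossing i₀ q r q' r' hf).baseChange gr)
      (MFComplex.twoTerm i₀ (P'.flip.shift q r) (K'.flip.shift q' r') g hd hs)) := by
  subst hg
  exact ⟨WeakEquiv.twoTermContraction (c.flip.shift q' r') (b.flip.shift q r)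
    (b'.flip.shift q' r') i₀ _ _ hd hs⟩

section Closure

variable {S : Type} [CommRing S] [Algebra BdryRing S] {T : TwoVar S} {M : ℕ}

/-- Replace `χ⁰` by `p χ⁰` and `χ¹` by `χ¹ i`. As `i p` is homotopic to the identity, the
composition is still homotopic to `x₂ - x₁`, and this survives extension of scalars. Of the
relations of the pair only this composition on the arc side is needed, so the argument covers every
choice of `χ`. -/
theorem exists_chiModel_of_bcIso (χ : ChiPair (M + 1))
    (b₀ : BCIso T.gr (resolution0 (M + 1)) (koszul S (M + 1) T.gr (T.rows0 M)))
    (b₁ : BCIso T.gr (smallRes1 (M + 1)) ((koszul S (M + 1) T.gr (T.rows1 M)).shift 0 (-1)))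
    (c : Contraction (resolution1 (M + 1)) (smallRes1 (M + 1)))
    (hs : algebraMap BdryRing S (bv 2 - bv 0) = T.y - T.x) :
    ∃ χ' : ChiModel T M,
      Nonempty (WeakEquiv ((negCrossing (M + 1) χ).baseChange T.gr) χ'.complex) := by
  have hm₀ : GradedMF.IsHomogMorphism (resolution0 (M + 1)) (smallRes1 (M + 1)) (0, 1)
      (c.p ∘ₗ χ.chi0) := by simpa using c.p_hom.comp χ.morphism0
  have hm₁ : GradedMF.IsHomogMorphism (smallRes1 (M + 1)) (resolution0 (M + 1)) (0, 1)
      (χ.chi1 ∘ₗ c.i) := by simpa using χ.morphism1.comp c.i_hom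
  have hip : GradedMF.Homotopic (resolution1 (M + 1)) (resolution1 (M + 1)) (c.i ∘ₗ c.p)
      LinearMap.id :=
    GradedMF.Homotopic.symm ⟨c.h, LinearMap.ext c.h_sgn, LinearMap.ext c.homotopy⟩
  have hh : GradedMF.Homotopic (resolution0 (M + 1)) (resolution0 (M + 1))
      ((χ.chi1 ∘ₗ c.i) ∘ₗ (c.p ∘ₗ χ.chi0)) ((bv 2 - bv 0) • LinearMap.id) :=
    ((hip.comp_right χ.morphism0).comp_left χ.morphism1).trans χ.comp10
  have hm₀' := b₀.isHomogMorphism b₁ hm₀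
  have hm₁' := b₁.isHomogMorphism b₀ hm₁
  have hh' := b₀.homotopic b₀ hh
  rw [← b₀.map_comp b₁ b₀, b₀.map_smul_id, hs] at hh'
  obtain ⟨h, -, hh'⟩ := hh'
  refine ⟨{ f₀ := b₀.map b₁ (c.p ∘ₗ χ.chi0)
            f₁ := b₁.map b₀ (χ.chi1 ∘ₗ c.i)
            h := h
            f₀_d := LinearMap.congr_fun hm₀'.comm
            f₀_sgn := LinearMap.congr_fun hm₀'.sgn
            f₀_mem := fun ε d v hv => ?_
            f₁_d := LinearMap.congr_fun hm₁'.comm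
            f₁_mem := fun ε d v hv => ?_
            homotopy := LinearMap.congr_fun hh' },
    nonempty_weakEquiv_crossing c b₀ b₁ 0 (-1) (-((M + 1 : ℕ) : ℤ) + 1) (-1) (-((M + 1 : ℕ) : ℤ))
      χ.morphism0 _ rfl _ _⟩
  -- Undoing the shift `{0, -1}` turns the `x`-degree `1` of `χ⁰` into `2`, and below that of `χ¹`
  -- into `0`.
  · have h5 : b₀.map b₁ (c.p ∘ₗ χ.chi0) v ∈
        kosHomog (M + 1) T.gr (T.rows1 M) ε (d + (0, 1) - (0, -1)) := hm₀'.degree ε d v hv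
    rwa [show d + (0, 1) - (0, -1) = d + ((0, 2) : ℤ × ℤ) by ext <;> simp; ring] at h5
  · have h5 : b₁.map b₀ (χ.chi1 ∘ₗ c.i) v ∈
        kosHomog (M + 1) T.gr (T.rows0 M) ε (d + (0, -1) + (0, 1)) :=
      hm₁'.degree ε (d + (0, -1)) v (by
        change v ∈ kosHomog (M + 1) T.gr (T.rows1 M) ε (d + (0, -1) - (0, -1))
        rwa [add_sub_cancel_right])
    rwa [show d + (0, -1) + (0, 1) = d + (0 : ℤ × ℤ) by ext <;> simp] at h5

/-- Closing up identifies `x₁` with `y₂` and `y₁` with `x₂`. All second entries vanish, and the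
first entries become the derivatives computed in `hSum_self`, `quot1_self` and `quot2_self`. -/
theorem exists_chiModel (χ : ChiPair (M + 1))
    (hgr : ∀ d r, r ∈ markGr (Fin 4) d → algebraMap BdryRing S r ∈ T.gr d)
    (ha : algebraMap BdryRing S (aElt _) = T.a) (h0 : algebraMap BdryRing S (bv 0) = T.x)
    (h1 : algebraMap BdryRing S (bv 1) = T.y) (h2 : algebraMap BdryRing S (bv 2) = T.y)
    (h3 : algebraMap BdryRing S (bv 3) = T.x) :
    ∃ χ' : ChiModel T M,
      Nonempty (WeakEquiv ((negCrossing (M + 1) χ).baseChange T.gr) χ'.complex) := by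
  refine exists_chiModel_of_bcIso χ ?_ ?_ (contractionRes1 (M + 1)) (by rw [map_sub, h2, h0])
  · exact koszulBCIso (markGr_isGr _) T.isGr hgr (M + 1) (arcRows (M + 1)) (T.rows0 M)
      (Fin.forall_fin_two.2 ⟨by
        change _ = algebraMap BdryRing S (aElt _ * hSum (M + 1) (bv 0) (bv 3))
        rw [map_mul, map_hSum, ha, h0, h3, hSum_self]
        change T.a * (((M : S) + 2) * T.x ^ (M + 1)) = _
        push_cast
        ring, by
        change _ = algebraMap BdryRing S (aElt _ * hSum (M + 1) (bv 1) (bv 2))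
        rw [map_mul, map_hSum, ha, h1, h2, hSum_self]
        change T.a * (((M : S) + 2) * T.y ^ (M + 1)) = _
        push_cast
        ring⟩)
      (Fin.forall_fin_two.2 ⟨by
        change _ = algebraMap BdryRing S (bv 0 - bv 3)
        rw [map_sub, h0, h3, sub_self]
        rfl, by
        change _ = algebraMap BdryRing S (bv 1 - bv 2)
        rw [map_sub, h1, h2, sub_self]
        rfl⟩)
      (Fin.forall_fin_two.2 ⟨rfl, rfl⟩)
  · exact (koszulBCIso (markGr_isGr _) T.isGr hgr (M + 1) (smallRows (M + 1)) (T.rows1 M)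
      (Fin.forall_fin_two.2 ⟨by
        change _ = algebraMap BdryRing S
          (aElt _ * quot1 (bv 0 + bv 1) (bv 0 * bv 1) (bv 2 + bv 3) (M + 1 + 1))
        rw [map_mul, map_quot1, map_add, map_mul, map_add, ha, h0, h1, h2, h3, add_comm T.y T.x,
          quot1_self]
        change T.a * (((M : S) + 2) * hSum (M + 1) T.x T.y) = _
        push_cast
        ring, by
        change _ = algebraMap BdryRing S
          (aElt _ * quot2 (bv 0 * bv 1) (bv 2 + bv 3) (bv 2 * bv 3) (M + 1 + 1))
        rw [map_mul, map_quot2, map_mul, map_add, map_mul, ha, h0, h1, h2, h3, add_comm T.y T.x,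
          mul_comm T.y T.x, quot2_self]
        change T.a * (((M : S) + 2) * -hSum M T.x T.y) = _
        ring⟩)
      (Fin.forall_fin_two.2 ⟨by
        change _ = algebraMap BdryRing S (bv 0 + bv 1 - (bv 2 + bv 3))
        rw [map_sub, map_add, map_add, h0, h1, h2, h3, add_comm T.y T.x, sub_self]
        rfl, by
        change _ = algebraMap BdryRing S (bv 0 * bv 1 - bv 2 * bv 3)
        rw [map_sub, map_mul, map_mul, h0, h1, h2, h3, mul_comm T.y T.x, sub_self]
        rfl⟩)
      (Fin.forall_fin_two.2 ⟨rfl, rfl⟩)).shift 0 (-1)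

end Closure

/-! ### The homology of the closed arc with one marking -/

section Arc

theorem C_mul_X_pow_dvd_iff {R : Type} [CommRing R] (a : R) (N : ℕ) (P : R[X]) :
    Polynomial.C a * Polynomial.X ^ N ∣ P ↔
      Polynomial.X ^ N ∣ P ∧ ∀ m, N ≤ m → a ∣ P.coeff m := by
  constructor
  · intro h
    exact ⟨(dvd_mul_left _ _).trans h, fun m _ =>
      (Polynomial.C_dvd_iff_dvd_coeff _ _).1 ((dvd_mul_right _ _).trans h) m⟩
  · rintro ⟨⟨Q, rfl⟩, h⟩
    rw [mul_comm]
    refine mul_dvd_mul_left _ ((Polynomial.C_dvd_iff_dvd_coeff _ _).2 fun m => ?_)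
    have h1 := h (m + N) (Nat.le_add_left N m)
    rwa [Polynomial.coeff_X_pow_mul] at h1

variable (N : ℕ)

/-- The quotient map from `ℚ[a][t]` to the homology of the unknot. -/
def arcMap : ℚ[X][X] →ₗ[ℚ[X]] (GrMod.prod
    (GrMod.dsum fun l : Fin N => GrMod.free.shift (-1) (-(N : ℤ) + 1 + 2 * (l : ℕ)))
    (GrMod.dsum fun m : ℕ =>
      GrMod.torsion.shift (-1) (-(N : ℤ) + 1 + 2 * N + 2 * (m : ℕ)))).carrier :=
  (lowCoeff N).map.prod (highCoeff N (-1) (-(N : ℤ) + 1)).map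

theorem arcMap_eq_zero (P : ℚ[X][X]) :
    arcMap N P = 0 ↔ Polynomial.C Polynomial.X * Polynomial.X ^ N ∣ P := by
  rw [C_mul_X_pow_dvd_iff, ← lowCoeff_map_eq_zero,
    ← highCoeff_map_eq_zero N (-1) (-(N : ℤ) + 1)]
  exact Prod.ext_iff

theorem arcMap_mem {d : ℤ × ℤ} {P : ℚ[X][X]} (hP : P ∈ varGr (d - (-1, -(N : ℤ) + 1))) :
    arcMap N P ∈ (GrMod.prod
      (GrMod.dsum fun l : Fin N => GrMod.free.shift (-1) (-(N : ℤ) + 1 + 2 * (l : ℕ)))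
      (GrMod.dsum fun m : ℕ =>
        GrMod.torsion.shift (-1) (-(N : ℤ) + 1 + 2 * N + 2 * (m : ℕ)))).homog d :=
  ⟨(lowCoeff N).map_mem hP, (highCoeff N (-1) (-(N : ℤ) + 1)).map_mem hP⟩

theorem arcMap_exists_lift (d : ℤ × ℤ) (t : (GrMod.prod
      (GrMod.dsum fun l : Fin N => GrMod.free.shift (-1) (-(N : ℤ) + 1 + 2 * (l : ℕ)))
      (GrMod.dsum fun m : ℕ =>
        GrMod.torsion.shift (-1) (-(N : ℤ) + 1 + 2 * N + 2 * (m : ℕ)))).carrier) :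
    ∃ P, arcMap N P = t ∧ (t ∈ (GrMod.prod
      (GrMod.dsum fun l : Fin N => GrMod.free.shift (-1) (-(N : ℤ) + 1 + 2 * (l : ℕ)))
      (GrMod.dsum fun m : ℕ =>
        GrMod.torsion.shift (-1) (-(N : ℤ) + 1 + 2 * N + 2 * (m : ℕ)))).homog d →
          P ∈ varGr (d - (-1, -(N : ℤ) + 1))) := by
  obtain ⟨t₁, t₂⟩ := t
  obtain ⟨P₁, h₁, hs₁, hd₁⟩ := (lowCoeff N).exists_lift d t₁
  obtain ⟨P₂, h₂, hs₂, hd₂⟩ := (highCoeff N (-1) (-(N : ℤ) + 1)).exists_lift d t₂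
  refine ⟨P₁ + P₂, ?_, fun h => add_mem (hd₁ h.1) (hd₂ h.2)⟩
  -- The two lifts have coefficients below `N` and from `N` on respectively, so neither affects the
  -- other summand.
  have h3 : (lowCoeff N).map P₂ = 0 := by
    rw [lowCoeff_map_eq_zero, Polynomial.X_pow_dvd_iff]
    exact fun n hn => hs₂ n (if_neg (Nat.not_le.2 hn))
  have h4 : (highCoeff N (-1) (-(N : ℤ) + 1)).map P₁ = 0 := by
    rw [highCoeff_map_eq_zero]
    intro m hm
    rw [hs₁ m (dif_neg (Nat.not_lt.2 hm))]
    exact dvd_zero _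
  refine Prod.ext ?_ ?_
  · change (lowCoeff N).map (P₁ + P₂) = t₁
    rw [map_add, h₁, h3, add_zero]
  · change (highCoeff N (-1) (-(N : ℤ) + 1)).map (P₁ + P₂) = t₂
    rw [map_add, h₂, h4, zero_add]

variable {V : Type} {v : V}

theorem isUnit_natCast_succ : IsUnit ((N : MarkRing V) + 1) := by
  have h1 : IsUnit ((N : ℚ) + 1) := by
    have : (N : ℚ) + 1 ≠ 0 := by positivity
    exact this.isUnit
  have h2 := h1.map (algebraMap ℚ (MarkRing V))
  rwa [map_add, map_natCast, map_one] at h2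

theorem C_mul_X_pow_dvd_diag_iff (hV : ∀ u, u = v) (f : MarkRing V) :
    Polynomial.C Polynomial.X * Polynomial.X ^ N ∣ diag V f ↔
      aElt V * hSum N (MvPolynomial.X v) (MvPolynomial.X v) ∣ f := by
  rw [hSum_self, mul_left_comm, (isUnit_natCast_succ N).mul_left_dvd]
  constructor
  · intro h
    obtain ⟨k, hk⟩ := exists_eq_undiag_add v v (fun u => Or.inl (hV u)) f
    rw [sub_self, zero_mul, add_zero] at hk
    have h1 := map_dvd (undiag v) h
    rwa [map_mul, map_pow, undiag_C, undiag_X, ← hk] at h1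
  · intro h
    have h1 := map_dvd (diag V) h
    rwa [map_mul, map_pow, diag_aElt, diag_X] at h1

theorem closedArc_iso (hV : ∀ u, u = v) (ε : ZMod 2) (i : ℤ) :
    GrMod.Iso ((rowComplex N (markGr V)
        ![arcRow N (aElt V) (MvPolynomial.X v) (MvPolynomial.X v)]).homologyGr ε i)
      (if ε = 1 ∧ i = 0 then
        GrMod.prod
          (GrMod.dsum fun l : Fin N => GrMod.free.shift (-1) (-(N : ℤ) + 1 + 2 * (l : ℕ)))
          (GrMod.dsum fun m : ℕ => GrMod.torsion.shift (-1) ((N : ℤ) + 1 + 2 * m))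
      else GrMod.zero) := by
  have h0 : aElt V * hSum N (MvPolynomial.X v) (MvPolynomial.X v) ≠ 0 := by
    rw [hSum_self]
    exact mul_ne_zero ((MvPolynomial.prime_C_iff V).2 Polynomial.prime_X).ne_zero
      (mul_ne_zero (isUnit_natCast_succ N).ne_zero (pow_ne_zero _ (MvPolynomial.X_ne_zero v)))
  have : Nonempty V := ⟨v⟩
  split_ifs with h
  · obtain ⟨rfl, rfl⟩ := h
    have h1 : (fun m : ℕ => GrMod.torsion.shift (-1) ((N : ℤ) + 1 + 2 * m)) =
        fun m : ℕ => GrMod.torsion.shift (-1) (-(N : ℤ) + 1 + 2 * N + 2 * (m : ℕ)) := by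
      funext m
      congr 1
      ring
    rw [h1]
    refine (rowComplex_isGenerator (N := N) (gr := markGr V)
      (row := ![arcRow N (aElt V) (MvPolynomial.X v) (MvPolynomial.X v)]) (markGr_isGr V)
      (sub_self _) (by ext <;> simp [arcRow]; ring) (arcMap N ∘ₗ (diag V).toLinearMap)
      (surjective_comp_diag (arcMap_exists_lift N))
      (fun f => (arcMap_eq_zero N _).trans (C_mul_X_pow_dvd_diag_iff N hV f))
      (mem_homog_iff_exists (fun d P => arcMap_mem N) (arcMap_exists_lift N))).iso
  · exact MFComplex.homologyGr_iso_zero _ (rowComplex_mem_bd_of_ne h0 h)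

end Arc

/-! ### The homology of the closure of a negative crossing -/

section NegCrossing

theorem closedNegCrossing_iso {V : Type} {v w : V} (hvw : v ≠ w) (hV : ∀ u, u = v ∨ u = w) (M : ℕ)
    (χ : ChiPair (M + 1)) (ε : ZMod 2) (i : ℤ) :
    GrMod.Iso ((pieceComplex (M + 1) χ (.crossing false v w w v)).homologyGr ε i)
      (if ε = 1 ∧ i = 0 then
        GrMod.dsum fun l : Fin (M + 1) =>
          GrMod.free.shift (-1) (-((M + 1 : ℕ) : ℤ) + 1 + 2 * (l : ℕ))
      else if ε = 0 ∧ i = 1 then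
        GrMod.dsum fun m : ℕ => GrMod.torsion.shift (-2) (2 * m)
      else GrMod.zero) := by
  have : Nonempty V := ⟨v⟩
  let φ : BdryRing →ₐ[ℚ[X]] MarkRing V := MvPolynomial.rename ![v, w, w, v]
  let : Algebra BdryRing (MarkRing V) := φ.toRingHom.toAlgebra
  obtain ⟨χ', ⟨e⟩⟩ := exists_chiModel (T := twoVar hvw) χ
    (fun d r hr => map_mem_of_mem_polyGr (A := ℚ[X]) baseGr_isGr (markGr_isGr V) φ.toRingHom
      (fun d r hr => by
        change φ (MvPolynomial.C r) ∈ markGr V d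
        rw [MvPolynomial.rename_C]
        exact C_mem_markGr hr) (fun j => by
        change φ (MvPolynomial.X j) ∈ markGr V (0, 2)
        rw [MvPolynomial.rename_X]
        exact X_mem_markGr _) hr)
    (MvPolynomial.rename_C _ _) (MvPolynomial.rename_X _ _) (MvPolynomial.rename_X _ _)
    (MvPolynomial.rename_X _ _) (MvPolynomial.rename_X _ _)
  change GrMod.Iso (((negCrossing (M + 1) χ).baseChange (twoVar hvw).gr).homologyGr ε i) _
  split_ifs with h h'
  · obtain ⟨rfl, rfl⟩ := h
    have hl : ∀ d t, ∃ P, (lowCoeff (M + 1)).map P = t ∧ _ := fun d t =>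
      ((lowCoeff (M + 1)).exists_lift d t).imp fun P hP => ⟨hP.1, hP.2.2⟩
    exact (e.isGenerator (χ'.isGenerator_zero ((lowCoeff (M + 1)).map ∘ₗ (diag V).toLinearMap)
      (surjective_comp_diag hl)
      (fun f => (lowCoeff_map_eq_zero _ _).trans (X_pow_dvd_diag_iff hvw hV M f))
      (mem_homog_iff_exists (fun d P => (lowCoeff (M + 1)).map_mem) hl))).iso
  · obtain ⟨rfl, rfl⟩ := h'
    have h1 : (fun m : ℕ => GrMod.torsion.shift (-2) (2 * m)) =
        fun m : ℕ => GrMod.torsion.shift (-2) (0 + 2 * (0 : ℕ) + 2 * (m : ℕ)) := by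
      funext m
      congr 1
      simp
    rw [h1]
    have hl : ∀ d t, ∃ P, (highCoeff 0 (-2) 0).map P = t ∧ _ := fun d t =>
      ((highCoeff 0 (-2) 0).exists_lift d t).imp fun P hP => ⟨hP.1, hP.2.2⟩
    refine (e.isGenerator (χ'.isGenerator_one ((highCoeff 0 (-2) 0).map ∘ₗ (diag V).toLinearMap)
      (surjective_comp_diag hl)
      (fun f => (highCoeff_map_eq_zero _ _ _ _).trans (Iff.trans ?_ (diag_eq_C_mul_iff hV f)))
      (mem_homog_iff_exists (fun d P => (highCoeff 0 (-2) 0).map_mem) hl))).iso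
    rw [Polynomial.C_dvd_iff_dvd_coeff]
    exact forall_congr' fun m => ⟨fun h => h (Nat.zero_le m), fun h _ => h⟩
  · exact MFComplex.homologyGr_iso_zero _ (e.mem_bd_of_forall (χ'.mem_bd_of_ne h h'))

end NegCrossing

/-- The class of `1` in the first summand is nonzero because `a` is not a unit. -/
theorem not_iso_zero_torsion :
    ¬ GrMod.Iso (GrMod.dsum fun m : ℕ => GrMod.torsion.shift (-2) (2 * m)) GrMod.zero := by
  rintro ⟨e, -⟩
  let x : ⨁ m : ℕ, (GrMod.torsion.shift (-2) (2 * m)).carrier :=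
    DirectSum.lof ℚ[X] ℕ (fun m : ℕ => (GrMod.torsion.shift (-2) (2 * m)).carrier) 0
      (Ideal.Quotient.mk (Ideal.span {(Polynomial.X : ℚ[X])}) 1)
  have h1 : x = 0 := e.injective rfl
  have h2 : (Ideal.Quotient.mk (Ideal.span {(Polynomial.X : ℚ[X])})) 1 = 0 :=
    (DirectSum.lof_apply ℚ[X] (M := fun m : ℕ => (GrMod.torsion.shift (-2) (2 * m)).carrier) 0
      _).symm.trans (congrArg
        (fun y : ⨁ m : ℕ, (GrMod.torsion.shift (-2) (2 * m)).carrier => y 0) h1)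
  rw [Ideal.Quotient.eq_zero_iff_mem, Ideal.mem_span_singleton] at h2
  exact Polynomial.prime_X.not_isUnit (isUnit_of_dvd_one h2)

theorem GrMod.Iso.symm {M M' : GrMod} (h : GrMod.Iso M M') : GrMod.Iso M' M := by
  obtain ⟨e, he⟩ := h
  exact ⟨e.symm, fun d x => by rw [he, e.apply_symm_apply]⟩

theorem GrMod.Iso.trans {M M' M'' : GrMod} (h : GrMod.Iso M M') (h' : GrMod.Iso M' M'') :
    GrMod.Iso M M'' := by
  obtain ⟨e, he⟩ := h
  obtain ⟨e', he'⟩ := h'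
  exact ⟨e.trans e', fun d x => (he d x).trans (he' d _)⟩

theorem braidHomology_unknotU_iso (N : ℕ) (χ : ChiPair N) (ε : ZMod 2) (i : ℤ) :
    GrMod.Iso (braidHomology N χ unknotU ε i)
      (if ε = 1 ∧ i = 0 then
        GrMod.prod
          (GrMod.dsum fun l : Fin N => GrMod.free.shift (-1) (-(N : ℤ) + 1 + 2 * (l : ℕ)))
          (GrMod.dsum fun m : ℕ => GrMod.torsion.shift (-1) ((N : ℤ) + 1 + 2 * m))
      else GrMod.zero) :=
  closedArc_iso N (V := ClosureMarks unknotU) (v := (0, 0)) (by decide) ε i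

/-- There is one level, so the next level is the same one, and the only piece is a crossing with end
points `v, w, w, v`. A tensor product with one factor is that factor, so the claim is definitionally
the one about this piece. -/
theorem braidHomology_unknotUMinus_iso (M : ℕ) (χ : ChiPair (M + 1)) (ε : ZMod 2) (i : ℤ) :
    GrMod.Iso (braidHomology (M + 1) χ unknotUMinus ε i)
      (if ε = 1 ∧ i = 0 then
        GrMod.dsum fun l : Fin (M + 1) =>
          GrMod.free.shift (-1) (-((M + 1 : ℕ) : ℤ) + 1 + 2 * (l : ℕ))
      else if ε = 0 ∧ i = 1 then
        GrMod.dsum fun m : ℕ => GrMod.torsion.shift (-2) (2 * m)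
      else GrMod.zero) :=
  closedNegCrossing_iso (V := ClosureMarks unknotUMinus) (v := (0, 0)) (w := (0, 1)) (by decide)
    (by decide) M χ ε i

end TransverseHomology

end

theorem corollary1p5 (N : ℕ) (hN : 1 ≤ N) :
    Nonempty (TransverseHomology.ChiPair N) ∧
    ∀ χ : TransverseHomology.ChiPair N,
      (∀ (ε : ZMod 2) (i : ℤ),
        TransverseHomology.GrMod.Iso
          (TransverseHomology.braidHomology N χ TransverseHomology.unknotU ε i)
          (if ε = 1 ∧ i = 0 then
            TransverseHomology.GrMod.prod
              (TransverseHomology.GrMod.dsum fun l : Fin N =>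
                TransverseHomology.GrMod.free.shift (-1) (-(N : ℤ) + 1 + 2 * (l : ℕ)))
              (TransverseHomology.GrMod.dsum fun m : ℕ =>
                TransverseHomology.GrMod.torsion.shift (-1) ((N : ℤ) + 1 + 2 * m))
          else TransverseHomology.GrMod.zero)) ∧
      (∀ (ε : ZMod 2) (i : ℤ),
        TransverseHomology.GrMod.Iso
          (TransverseHomology.braidHomology N χ TransverseHomology.unknotUMinus ε i)
          (if ε = 1 ∧ i = 0 then
            TransverseHomology.GrMod.dsum fun l : Fin N =>
              TransverseHomology.GrMod.free.shift (-1) (-(N : ℤ) + 1 + 2 * (l : ℕ))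
          else if ε = 0 ∧ i = 1 then
            TransverseHomology.GrMod.dsum fun m : ℕ =>
              TransverseHomology.GrMod.torsion.shift (-2) (2 * m)
          else TransverseHomology.GrMod.zero)) ∧
      (∃ (ε : ZMod 2) (i : ℤ),
        ¬ TransverseHomology.GrMod.Iso
          (TransverseHomology.braidHomology N χ TransverseHomology.unknotUMinus ε i)
          (TransverseHomology.braidHomology N χ TransverseHomology.unknotU ε i)) := by
  refine ⟨TransverseHomology.nonempty_chiPair N, fun χ => ?_⟩
  have h1 := TransverseHomology.braidHomology_unknotU_iso N χ
  -- The wide-edge rows involve `h_{N-1}`, so the computation for `U_-` is indexed by `M = N - 1`.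
  obtain ⟨M, rfl⟩ : ∃ M, N = M + 1 := ⟨N - 1, by omega⟩
  have h2 := TransverseHomology.braidHomology_unknotUMinus_iso M χ
  refine ⟨h1, h2, 0, 1, fun h => ?_⟩
  have h3 := h1 0 1
  have h4 := h2 0 1
  rw [if_neg (by decide)] at h3
  rw [if_neg (by decide), if_pos (by decide)] at h4
  exact TransverseHomology.not_iso_zero_torsion ((h4.symm.trans h).trans h3)
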